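/- Conventions. An algebra over a field $\mathbb F$ is a vector space with a bilinear product (not necessarily associative or unital). $\mathcal A$ is *simple* if $\mathcal A^2\ne 0$ and its only ideals are $0$ and $\mathcal A$, *central simple* if moreover every linear endomorphism commuting with all left and right multiplications is a scalar (automatic for finite-dimensional simple algebras over algebraically closed fields), and *semisimple* if it is a finite direct sum of simple ideals. A *grading* $\Gamma$ on $\mathcal A$ is a set of nonzero subspaces with $\mathcal A=\bigoplus_{\mathcal U\in\Gamma}\mathcal U$ such that for all $\mathcal U,\mathcal V\in\Gamma$ there is $\mathcal W\in\Gamma$ with $\mathcal U\mathcal V\subseteq\mathcal W$; it is *trivial* if $\Gamma=\{\mathcal A\}$; $(\mathcal A,\Gamma)$ is *graded-simple* if $\mathcal A^2\neq0$ and the only ideals $\mathcal I$ with $\mathcal I=\bigoplus_{\mathcal U\in\Gamma}(\mathcal U\cap\mathcal I)$ are $0$ and $\mathcal A$. For an abelian group $G$, a $G$-grading $(\Gamma,G,\delta)$ is a grading $\Gamma$ with an injective map $\delta:\Gamma\to G$ such that $\delta(\mathcal U)\delta(\mathcal V)=\delta(\mathcal W)$ whenever $0\ne\mathcal U\mathcal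 V\subseteq\mathcal W$; then $\mathcal A_g$ is the $\mathcal U\in\Gamma$ with $\delta(\mathcal U)=g$, or $0$ if there is none. $\Gamma$ is a *group-grading* if it admits such $(G,\delta)$ for some abelian group $G$; it is a *fine group-grading* if moreover no other group-grading $\Gamma'\neq\Gamma$ has each of its members contained in a member of $\Gamma$. An *equivalence* $(\mathcal A,\Gamma)\to(\mathcal A',\Gamma')$ is an algebra isomorphism mapping each member of $\Gamma$ onto a member of $\Gamma'$. The *universal group* $U(\Gamma)$, with the natural map $\Gamma\to U(\Gamma)$, is the abelian group generated by $\Gamma$ subject to $\mathcal U\mathcal V=\mathcal W$ whenever $0\neq \mathcal U\mathcal V\subseteq\mathcal W$ (pairs $(G,\delta)$ are considered up to isomorphism). $\Gamma_{\mathrm{gr}}$ is the coarsening of $\Gamma$ whose members are the sums of all members of $\Gamma$ with the same image in $U(\Gamma)$. The *free product group-grading* of group-gradings $\Gamma^i$ on $\mathcal B^i$, $1\le i\le n$, is $(\Gamma^1\times\cdots\times\Gamma^n)_{\mathrm{gr}}$ on $\mathcal B^1\times\cdots\times\mathcal B^n$, where $\Gamma^1\times\cdots\times\Gamma^n=\bigcup_i\{0\times\cdots\times\mathcal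 U\times\cdots\times0\mid\mathcal U\in\Gamma^i\}$. For a surjective homomorphism $\pi:G\to\overline G$ of abelian groups and a $\overline G$-graded algebra $\mathcal A$, the *loop algebra* is $L_\pi(\mathcal A)=\bigoplus_{g\in G}\mathcal A_{\pi(g)}\otimes g\subseteq\mathcal A\otimes_{\mathbb F}\mathbb FG$, graded by its nonzero subspaces $\mathcal A_{\pi(g)}\otimes g$. **Corollary.** Let $\mathbb F$ be an algebraically closed field. (1) Any fine group-grading on a finite-dimensional semisimple algebra is equivalent to a free product group-grading $(\Gamma^1\times\cdots\times\Gamma^n)_{\mathrm{gr}}$, where each $\Gamma^i$ is a fine group-grading on a finite-dimensional semisimple algebra $\mathcal B^i$ such that $(\mathcal B^i,\Gamma^i)$ is graded-simple, and where one of the following holds: - $\operatorname{char}\mathbb F=2$ and for any index $i$ such that $\Gamma^i$ is trivial there is at most one other index $j$ such that $(\mathcal B^i,\Gamma^i)$ is equivalent to $(\mathcal B^j,\Gamma^j)$; - $\operatorname{char}\mathbb F\neq2$ and for any index $i$ such that $\Gamma^i$ is trivial there is no other index $j$ such that $(\mathcal B^i,\Gamma^i)$ is equivalent to $(\mathcal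 B^j,\Gamma^j)$. Conversely, any such free product group-grading is a fine group-grading. Moreover, the factors $(\mathcal B^i,\Gamma^i)$ are uniquely determined up to reordering and equivalence. (2) Any finite-dimensional graded-simple algebra $(\mathcal B,\Gamma')$ such that $\Gamma'$ is a fine group-grading is equivalent to a loop algebra $L_\pi(\mathcal A)$ (with its grading) associated to a surjective homomorphism $\pi:U\to\overline U$ of abelian groups with finite kernel and a simple finite-dimensional graded algebra $(\mathcal A,\overline\Gamma,\overline U,\bar\delta)$, where $\overline\Gamma$ is a fine group-grading with universal group $(\overline U,\bar\delta)$. Conversely, for any such $\pi$ and $(\mathcal A,\overline\Gamma,\overline U,\bar\delta)$, the grading on the loop algebra $L_\pi(\mathcal A)$ is a fine group-grading. Moreover, in this situation $\mathcal B$ is semisimple if and only if $\operatorname{char}\mathbb F$ does not divide the order of $\ker\pi$. (3) For $i=1,2$, let $\mathcal A^i$ be a central simple algebra with a fine group-grading $\overline\Gamma^i$ with universal group $(\overline U^i,\bar\delta^i)$, and let $\pi^i:U^i\to\overline U^i$ be a surjective homomorphism of abelian groups. Then the loop algebras $L_{\pi^1}(\mathcal A^1)$ and $L_{\pi^2}(\mathcal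 A^2)$, with their gradings, are equivalent if and only if there are an equivalence $\varphi:(\mathcal A^1,\overline\Gamma^1)\to(\mathcal A^2,\overline\Gamma^2)$, with associated group isomorphism $\alpha:\overline U^1\to\overline U^2$ (determined by $\alpha(\bar\delta^1(\mathcal U))=\bar\delta^2(\varphi(\mathcal U))$ for $\mathcal U\in\overline\Gamma^1$), and a group isomorphism $\tilde\alpha:U^1\to U^2$ such that $\pi^2\circ\tilde\alpha=\alpha\circ\pi^1$. -/

import Mathlib

universe u v w x

open scoped TensorProduct

namespace GradedAlg

/-! Throughout, an algebra over the field `F` is an `F`-vector space `A` with a bilinear product;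
no associativity, commutativity or unit is assumed. The definitions that only speak of
subspaces and products of elements do not need the bilinearity instances as arguments. -/

section Algebras

variable (F : Type w) [Field F] {A : Type u} [NonUnitalNonAssocRing A] [Module F A]

variable {F}

/-- Two-sided ideals, as subspaces. -/
def IsIdeal (I : Submodule F A) : Prop :=
  ∀ x : A, ∀ y ∈ I, x * y ∈ I ∧ y * x ∈ I

/-- An ideal that is simple as an algebra: its product is not zero, and its only ideals are
`0` and itself. -/
def IsSimpleIdeal (I : Submodule F A) : Prop :=
  IsIdeal I ∧ (∃ x ∈ I, ∃ y ∈ I, x * y ≠ 0) ∧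
    ∀ J : Submodule F A, J ≤ I → (∀ x ∈ I, ∀ y ∈ J, x * y ∈ J ∧ y * x ∈ J) → J = ⊥ ∨ J = I

variable (F A)

/-- Simple algebras: the product is not zero, and the only ideals are `0` and `A`. -/
def IsSimpleAlgebra : Prop :=
  (∃ x y : A, x * y ≠ 0) ∧ ∀ I : Submodule F A, IsIdeal I → I = ⊥ ∨ I = ⊤

/-- Central simple algebras: simple, and every element of the centroid, that is, every linear
endomorphism that commutes with all left and right multiplications, is a scalar. -/
def IsCentralSimpleAlgebra : Prop :=
  IsSimpleAlgebra F A ∧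
    ∀ f : A →ₗ[F] A, (∀ x y : A, f (x * y) = f x * y ∧ f (x * y) = x * f y) →
      ∃ c : F, ∀ x : A, f x = c • x

/-- Semisimple algebras: finite direct sums of simple ideals. -/
def IsSemisimpleAlgebra : Prop :=
  ∃ (n : ℕ) (I : Fin n → Submodule F A),
    (∀ i, IsSimpleIdeal (I i)) ∧ DirectSum.IsInternal I

end Algebras

section Gradings

variable {F : Type w} [Field F] {A : Type u} [NonUnitalNonAssocRing A] [Module F A]

/-- `U V ⊆ W`. -/
def MulLE (U V W : Submodule F A) : Prop :=
  ∀ x ∈ U, ∀ y ∈ V, x * y ∈ W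

/-- `U V ≠ 0`. -/
def MulNeZero (U V : Submodule F A) : Prop :=
  ∃ x ∈ U, ∃ y ∈ V, x * y ≠ 0

/-- A grading on `A`: a set of nonzero subspaces whose direct sum is `A`, such that the product
of any two of them is contained in a third one. -/
structure IsGrading (Γ : Set (Submodule F A)) : Prop where
  ne_bot : ∀ U ∈ Γ, U ≠ ⊥
  indep : sSupIndep Γ
  sSup_eq_top : sSup Γ = ⊤
  exists_mulLE : ∀ U ∈ Γ, ∀ V ∈ Γ, ∃ W ∈ Γ, MulLE U V W

/-- The trivial grading `{A}` (used for nonzero `A`). -/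
def IsTrivialGrading (Γ : Set (Submodule F A)) : Prop :=
  Γ = {⊤}

/-- The triple `(Γ, G, δ)` is a `G`-grading: `Γ` is a grading and `δ : Γ → G` is a one-to-one
map such that `δ U * δ V = δ W` whenever `0 ≠ U V ⊆ W`. -/
structure IsGradingBy {G : Type v} [CommGroup G] (Γ : Set (Submodule F A)) (δ : Γ → G) :
    Prop where
  isGrading : IsGrading Γ
  injective : Function.Injective δ
  map_mul : ∀ U V W : Γ, MulNeZero U.1 V.1 → MulLE U.1 V.1 W.1 → δ U * δ V = δ W

/-- The homogeneous component `A_g`: the member of `Γ` of degree `g` if there is one,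
and `0` otherwise. -/
def component {G : Type v} {Γ : Set (Submodule F A)} (δ : Γ → G) (g : G) : Submodule F A :=
  ⨆ (U : Γ) (_ : δ U = g), U.1

/-- Group-gradings: those gradings that can be realized as a `G`-grading for some abelian
group `G`. (The universal group of `Γ` lives in the universe of `A`, so nothing is gained by
allowing `G` in other universes.) -/
def IsGroupGrading (Γ : Set (Submodule F A)) : Prop :=
  ∃ (G : Type u) (_ : CommGroup G) (δ : Γ → G), IsGradingBy Γ δ

/-- `Γ'` is a proper refinement of `Γ`: each member of `Γ'` is contained in a member of `Γ`,
and at least one of these containments is proper. -/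
def IsProperRefinement (Γ' Γ : Set (Submodule F A)) : Prop :=
  (∀ U ∈ Γ', ∃ V ∈ Γ, U ≤ V) ∧ ∃ U ∈ Γ', ∃ V ∈ Γ, U < V

/-- Fine group-gradings: group-gradings without proper refinements among group-gradings. -/
def IsFineGroupGrading (Γ : Set (Submodule F A)) : Prop :=
  IsGroupGrading Γ ∧
    ∀ Γ' : Set (Submodule F A), IsGroupGrading Γ' → ¬ IsProperRefinement Γ' Γ

/-- `S` is a graded subspace: it is the sum of its intersections with the members of `Γ`. -/
def IsGradedSubspace (Γ : Set (Submodule F A)) (S : Submodule F A) : Prop :=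
  S = ⨆ U : Γ, U.1 ⊓ S

/-- Graded-simple: the product is not zero, and the only graded ideals are `0` and `A`. -/
def IsGradedSimple (Γ : Set (Submodule F A)) : Prop :=
  (∃ x y : A, x * y ≠ 0) ∧
    ∀ I : Submodule F A, IsIdeal I → IsGradedSubspace Γ I → I = ⊥ ∨ I = ⊤

/-- An equivalence `φ : (A, Γ) → (A', Γ')`: an isomorphism of algebras that maps every member
of `Γ` onto a member of `Γ'`. -/
structure IsEquivalence {A' : Type x} [NonUnitalNonAssocRing A'] [Module F A']
    (Γ : Set (Submodule F A)) (Γ' : Set (Submodule F A')) (φ : A ≃ₗ[F] A') : Prop where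
  map_mul : ∀ x y : A, φ (x * y) = φ x * φ y
  map_mem : ∀ U ∈ Γ, U.map (φ : A →ₗ[F] A') ∈ Γ'

/-- The graded algebras `(A, Γ)` and `(A', Γ')` are equivalent. -/
def GradingEquivalent {A' : Type x} [NonUnitalNonAssocRing A'] [Module F A']
    (Γ : Set (Submodule F A)) (Γ' : Set (Submodule F A')) : Prop :=
  ∃ φ : A ≃ₗ[F] A', IsEquivalence Γ Γ' φ

/-- The relations of the universal group, written additively in the free abelian group on `Γ`:
`[U] + [V] - [W]` for all `U`, `V`, `W` in `Γ` with `0 ≠ U V ⊆ W`. -/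
def universalRelations (Γ : Set (Submodule F A)) : Set (FreeAbelianGroup Γ) :=
  {r | ∃ U V W : Γ, MulNeZero U.1 V.1 ∧ MulLE U.1 V.1 W.1 ∧
    r = FreeAbelianGroup.of U + FreeAbelianGroup.of V - FreeAbelianGroup.of W}

/-- The universal group `U(Γ)` of `Γ`, written multiplicatively. -/
abbrev UniversalGroup (Γ : Set (Submodule F A)) : Type u :=
  Multiplicative (FreeAbelianGroup Γ ⧸ AddSubgroup.closure (universalRelations Γ))

/-- The natural map `Γ → U(Γ)`. -/
def universalDegree (Γ : Set (Submodule F A)) (U : Γ) : UniversalGroup Γ :=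
  Multiplicative.ofAdd (QuotientAddGroup.mk (FreeAbelianGroup.of U))

/-- The pair `(G, δ)` is, up to isomorphism of pairs, the universal group of `Γ`. -/
def IsUniversalGroup {G : Type v} [CommGroup G] (Γ : Set (Submodule F A)) (δ : Γ → G) : Prop :=
  ∃ e : UniversalGroup Γ ≃* G, ∀ U : Γ, e (universalDegree Γ U) = δ U

/-- The group-grading induced by `Γ`: its members are the sums of all members of `Γ` with a
given degree in the universal group. -/
def inducedGroupGrading (Γ : Set (Submodule F A)) : Set (Submodule F A) :=
  {S | ∃ g ∈ Set.range (universalDegree Γ), S = component (universalDegree Γ) g}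

end Gradings

section Products

variable {F : Type w} [Field F] {n : ℕ} {B : Fin n → Type u}
  [∀ i, NonUnitalNonAssocRing (B i)] [∀ i, Module F (B i)]

/-- The product grading on `B 0 × ⋯ × B (n-1)`: its members are the subspaces
`0 × ⋯ × U × ⋯ × 0` with `U` in `Γ i`. -/
def productGrading (Γ : ∀ i, Set (Submodule F (B i))) : Set (Submodule F (∀ i, B i)) :=
  ⋃ i, (fun U : Submodule F (B i) => U.map (LinearMap.single F B i)) '' Γ i

/-- The free product group-grading. -/
def freeProductGrading (Γ : ∀ i, Set (Submodule F (B i))) : Set (Submodule F (∀ i, B i)) :=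
  inducedGroupGrading (productGrading Γ)

/-- The condition on the multiplicities of the trivially graded factors: in characteristic `2`,
for each trivially graded factor there is at most one other factor equivalent to it; in other
characteristics there is none. -/
def MultiplicityCondition (Γ : ∀ i, Set (Submodule F (B i))) : Prop :=
  (ringChar F = 2 ∧ ∀ i, IsTrivialGrading (Γ i) → ∀ j k, j ≠ i → k ≠ i →
      GradingEquivalent (Γ i) (Γ j) → GradingEquivalent (Γ i) (Γ k) → j = k) ∨
  (ringChar F ≠ 2 ∧ ∀ i, IsTrivialGrading (Γ i) → ∀ j, j ≠ i →
      ¬ GradingEquivalent (Γ i) (Γ j))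

/-- Finite families of fine group-gradings on finite-dimensional semisimple graded-simple
algebras that satisfy the multiplicity condition. -/
structure IsFineFamily (Γ : ∀ i, Set (Submodule F (B i))) : Prop where
  finiteDimensional : ∀ i, FiniteDimensional F (B i)
  isSemisimple : ∀ i, IsSemisimpleAlgebra F (B i)
  isGradedSimple : ∀ i, IsGradedSimple (Γ i)
  isFine : ∀ i, IsFineGroupGrading (Γ i)
  multiplicity : MultiplicityCondition Γ

end Products

section Loop

variable {F : Type w} [Field F] {A : Type u} [NonUnitalNonAssocRing A] [Module F A]

/-- `A_g A_h ⊆ A_{gh}`. -/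
theorem mul_mem_component {G : Type v} [CommGroup G] {Γ : Set (Submodule F A)} {δ : Γ → G}
    (hδ : IsGradingBy Γ δ) {g h : G} {a b : A} (ha : a ∈ component δ g)
    (hb : b ∈ component δ h) : a * b ∈ component δ (g * h) := by
  unfold component at ha hb
  refine Submodule.iSup_induction (motive := fun a => a * b ∈ component δ (g * h)) _ ha
    (fun U x hx => ?_) (by simp) (fun x y hx hy => by rw [add_mul]; exact add_mem hx hy)
  refine Submodule.iSup_induction (motive := fun b => x * b ∈ component δ (g * h)) _ hb
    (fun V y hy => ?_) (by simp) (fun y z hy hz => by rw [mul_add]; exact add_mem hy hz)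
  by_cases hU : δ U = g
  · by_cases hV : δ V = h
    · simp only [hU, hV, iSup_pos] at hx hy
      obtain ⟨W, hW, hm⟩ := hδ.isGrading.exists_mulLE U.1 U.2 V.1 V.2
      by_cases h0 : x * y = 0
      · rw [h0]; exact zero_mem _
      · have hd := hδ.map_mul U V ⟨W, hW⟩ ⟨x, hx, y, hy, h0⟩ hm
        rw [hU, hV] at hd
        exact Submodule.mem_iSup_of_mem (⟨W, hW⟩ : Γ)
          (Submodule.mem_iSup_of_mem hd.symm (hm x hx y hy))
    · simp only [hV, not_false_eq_true, iSup_neg, Submodule.mem_bot] at hy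
      simp [hy]
  · simp only [hU, not_false_eq_true, iSup_neg, Submodule.mem_bot] at hx
    simp [hx]

/-- The subspace `A_{π(g)} ⊗ g` of `A ⊗ F[G]`. -/
noncomputable def loopComponent {G : Type v} {G' : Type v} [CommGroup G] [CommGroup G']
    {Γ : Set (Submodule F A)} (δ : Γ → G') (π : G →* G') (g : G) :
    Submodule F (A ⊗[F] MonoidAlgebra F G) :=
  (component δ (π g)).map
    ((TensorProduct.mk F A (MonoidAlgebra F G)).flip (MonoidAlgebra.single g 1))

variable [IsScalarTower F A A] [SMulCommClass F A A]

/-- The sum of the subspaces `A_{π(g)} ⊗ g`, as a subalgebra of `A ⊗ F[G]`. -/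
noncomputable def loopSubalgebra {G : Type v} {G' : Type v} [CommGroup G] [CommGroup G']
    {Γ : Set (Submodule F A)} {δ : Γ → G'} (hδ : IsGradingBy Γ δ) (π : G →* G') :
    NonUnitalSubalgebra F (A ⊗[F] MonoidAlgebra F G) where
  __ := (⨆ g, loopComponent δ π g : Submodule F (A ⊗[F] MonoidAlgebra F G))
  mul_mem' := by
    intro x y hx hy
    change x ∈ (⨆ g, loopComponent δ π g : Submodule F (A ⊗[F] MonoidAlgebra F G)) at hx
    change y ∈ (⨆ g, loopComponent δ π g : Submodule F (A ⊗[F] MonoidAlgebra F G)) at hy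
    change x * y ∈ (⨆ g, loopComponent δ π g : Submodule F (A ⊗[F] MonoidAlgebra F G))
    refine Submodule.iSup_induction
      (motive := fun x => x * y ∈ (⨆ g, loopComponent δ π g : Submodule F _)) _ hx
      (fun g x hx => ?_) (by simp) (fun a b ha hb => by rw [add_mul]; exact add_mem ha hb)
    refine Submodule.iSup_induction
      (motive := fun y => x * y ∈ (⨆ g, loopComponent δ π g : Submodule F _)) _ hy
      (fun h y hy => ?_) (by simp) (fun a b ha hb => by rw [mul_add]; exact add_mem ha hb)
    obtain ⟨a, ha, rfl⟩ := hx
    obtain ⟨b, hb, rfl⟩ := hy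
    refine Submodule.mem_iSup_of_mem (g * h) ⟨a * b, ?_, ?_⟩
    · rw [map_mul]
      exact mul_mem_component hδ ha hb
    · simp [MonoidAlgebra.single_mul_single]

variable {G : Type v} {G' : Type v} [CommGroup G] [CommGroup G']
  {Γ : Set (Submodule F A)} {δ : Γ → G'}

/-- The loop algebra `L_π(A)` of a `G'`-graded algebra `(A, Γ, G', δ)` and a homomorphism
`π : G → G'`. -/
def LoopAlgebra (hδ : IsGradingBy Γ δ) (π : G →* G') : Type (max u v w) :=
  loopSubalgebra hδ π

noncomputable instance (hδ : IsGradingBy Γ δ) (π : G →* G') :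
    NonUnitalNonAssocRing (LoopAlgebra hδ π) :=
  inferInstanceAs (NonUnitalNonAssocRing (loopSubalgebra hδ π))

noncomputable instance (hδ : IsGradingBy Γ δ) (π : G →* G') : Module F (LoopAlgebra hδ π) :=
  inferInstanceAs (Module F (loopSubalgebra hδ π))

instance (hδ : IsGradingBy Γ δ) (π : G →* G') :
    IsScalarTower F (LoopAlgebra hδ π) (LoopAlgebra hδ π) :=
  inferInstanceAs (IsScalarTower F (loopSubalgebra hδ π) (loopSubalgebra hδ π))

instance (hδ : IsGradingBy Γ δ) (π : G →* G') :
    SMulCommClass F (LoopAlgebra hδ π) (LoopAlgebra hδ π) :=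
  inferInstanceAs (SMulCommClass F (loopSubalgebra hδ π) (loopSubalgebra hδ π))

/-- The inclusion of the loop algebra in `A ⊗ F[G]`. -/
noncomputable def loopInclusion (hδ : IsGradingBy Γ δ) (π : G →* G') :
    LoopAlgebra hδ π →ₗ[F] A ⊗[F] MonoidAlgebra F G :=
  (loopSubalgebra hδ π).toSubmodule.subtype

/-- The grading on the loop algebra: its members are the nonzero subspaces `A_{π(g)} ⊗ g`. -/
def loopGrading (hδ : IsGradingBy Γ δ) (π : G →* G') : Set (Submodule F (LoopAlgebra hδ π)) :=
  {S | S ≠ ⊥ ∧ ∃ g : G, S = (loopComponent δ π g).comap (loopInclusion hδ π)}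

end Loop

end GradedAlg

open GradedAlg

/-! Parts (2) and (3) rest on one structure theorem. Let `p` be a surjective homomorphism from a
graded-simple algebra `B` onto a central simple algebra `A`; for finite-dimensional `B` the quotient
by a maximal ideal is such a map. The homogeneous elements of `ker p` span a proper graded ideal, so
`p` is injective on each component. Let `H` be the group of degrees `h` with `p(B_{gh}) = p(B_g)`
for all `g`. Then the images of the components, indexed by `G/H`, form a grading of `A`, and `B` is
the loop algebra of this grading (`isGradedFamily_quotientFamily`, `isLoop_quotientFamily`). The
independence is a shortest relation argument: comparing two coordinates of shortest relations gives
an element of the centroid of `A`, that is, a scalar; so the corresponding images coincide, and the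
two degrees agree modulo `H` (`map_le_map_of_minimal_relations`).

The predicate `IsLoop` retains of a loop algebra only the map `p`, bijective from degree `g` onto
degree `π g`. Any refinement of a loop grading is still graded-simple, so by the structure theorem
it is a loop over a refinement of the base, with the same `p`; conversely refinements of the base
pull back. Hence fineness passes both ways (`IsLoop.isFine`, `IsLoop.isFine_base`). The kernel of
`π` acts on the loop algebra by translations in the centroid. If its order is invertible in `F`,
twisting `p` by characters embeds the loop algebra in a power of `A`; if not, the sum of all
translations has as image a nonzero ideal of square zero.

For (3), an equivalence followed by the second projection is a homomorphism from the first loop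
algebra onto `A₂`. Translations act through it by a character of `ker π`, which extends to the whole
group because the units of `F` are divisible. Removing the character leaves an isomorphism `A₁ ≅ A₂`
(`IsLoop.exists_equiv_of_surjective`). The group isomorphism comes from the fact that `U` is the
universal group of the loop grading (`IsLoop.isUniversalGroup`).

For (1), a semisimple graded algebra is the direct sum of its minimal graded ideals, and fineness
forces the grading to be the free product of the restrictions. An automorphism of finite order prime
to the characteristic that preserves the components must act on them as scalars, since its
eigenspaces refine the grading. Permutations of isomorphic trivially graded factors, which all lie
in degree one, violate this: a transposition if the characteristic is not two, a 3-cycle if it is.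
Conversely, suppose that a refinement of a free product has a minimal graded ideal involving several
factors. These factors are trivially graded, and the structure theorem makes them isomorphic, so the
multiplicity condition leaves only the case of two factors in characteristic two. There a nontrivial
translation would have to satisfy an impossible quadratic equation
(`IsLoop.injective_of_two_eq_zero`). So each factor is graded by the refinement, and fineness of the
factors ends the proof. Uniqueness holds because the factors are exactly the minimal graded ideals.
-/

namespace GradedAlg

/-! ### Internal direct sums and their projections -/

section Decomposition

variable {F : Type*} [Field F] {A M : Type*} [AddCommGroup A] [Module F A] [AddCommGroup M]
  [Module F M] {ι : Type*}

/-- A family of subspaces whose internal direct sum is the whole space. -/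
structure IsDecomp (𝒜 : ι → Submodule F A) : Prop where
  indep : iSupIndep 𝒜
  iSup_eq_top : iSup 𝒜 = ⊤

variable {𝒜 : ι → Submodule F A}

theorem IsDecomp.isInternal [DecidableEq ι] (h : IsDecomp 𝒜) : DirectSum.IsInternal 𝒜 :=
  DirectSum.isInternal_submodule_of_iSupIndep_of_iSup_eq_top h.indep h.iSup_eq_top

theorem IsDecomp.of_isInternal [DecidableEq ι] (h : DirectSum.IsInternal 𝒜) : IsDecomp 𝒜 :=
  ⟨h.submodule_iSupIndep, h.submodule_iSup_eq_top⟩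

theorem IsDecomp.induction (h : IsDecomp 𝒜) {P : A → Prop} (hom : ∀ i, ∀ x ∈ 𝒜 i, P x)
    (zero : P 0) (add : ∀ x y, P x → P y → P (x + y)) (x : A) : P x :=
  Submodule.iSup_induction 𝒜 (motive := P) (h.iSup_eq_top ▸ Submodule.mem_top) hom zero add

theorem IsDecomp.hom_ext (h : IsDecomp 𝒜) {f g : A →ₗ[F] M} (hfg : ∀ i, ∀ x ∈ 𝒜 i, f x = g x) :
    f = g :=
  LinearMap.ext fun x => h.induction (P := fun x => f x = g x) hfg (by simp)
    (fun x y hx hy => by rw [map_add, map_add, hx, hy]) x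

/-- Linear maps can be defined componentwise. -/
theorem IsDecomp.exists_linearMap (h : IsDecomp 𝒜) (f : ∀ i, 𝒜 i →ₗ[F] M) :
    ∃ φ : A →ₗ[F] M, ∀ i (x : 𝒜 i), φ x = f i x := by
  classical
  let e : (DirectSum ι fun i => 𝒜 i) ≃ₗ[F] A :=
    LinearEquiv.ofBijective (DirectSum.coeLinearMap 𝒜) h.isInternal
  refine ⟨DirectSum.toModule F ι M f ∘ₗ (e.symm : A →ₗ[F] _), fun i x => ?_⟩
  have : e.symm x = DirectSum.lof F ι (fun i => 𝒜 i) i x := by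
    rw [LinearEquiv.symm_apply_eq]
    exact (DirectSum.coeLinearMap_lof 𝒜 i x).symm
  simp [this]

open Classical in
theorem IsDecomp.exists_proj (h : IsDecomp 𝒜) (i : ι) :
    ∃ φ : A →ₗ[F] A, ∀ j (x : 𝒜 j), φ x = if j = i then (x : A) else 0 := by
  obtain ⟨φ, hφ⟩ := h.exists_linearMap (fun j => if j = i then (𝒜 j).subtype else 0)
  refine ⟨φ, fun j x => ?_⟩
  rw [hφ]
  split_ifs <;> simp

/-- The projection onto a component. -/
noncomputable def IsDecomp.proj (h : IsDecomp 𝒜) (i : ι) : A →ₗ[F] A := (h.exists_proj i).choose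

theorem IsDecomp.proj_of_mem (h : IsDecomp 𝒜) {i : ι} {x : A} (hx : x ∈ 𝒜 i) :
    h.proj i x = x :=
  ((h.exists_proj i).choose_spec i ⟨x, hx⟩).trans (if_pos rfl)

theorem IsDecomp.proj_of_mem_ne (h : IsDecomp 𝒜) {i j : ι} {x : A} (hx : x ∈ 𝒜 j) (hij : j ≠ i) :
    h.proj i x = 0 :=
  ((h.exists_proj i).choose_spec j ⟨x, hx⟩).trans (if_neg hij)

theorem IsDecomp.proj_mem (h : IsDecomp 𝒜) (i : ι) (x : A) : h.proj i x ∈ 𝒜 i := by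
  classical
  refine h.induction (P := fun x => h.proj i x ∈ 𝒜 i) (fun j x hx => ?_) (by simp)
    (fun x y hx hy => by rw [map_add]; exact add_mem hx hy) x
  by_cases hj : j = i
  · subst hj; rwa [h.proj_of_mem hx]
  · rw [h.proj_of_mem_ne hx hj]; exact zero_mem _

theorem IsDecomp.exists_sum_proj (h : IsDecomp 𝒜) (x : A) :
    ∃ s : Finset ι, ∀ t, s ⊆ t → x = ∑ i ∈ t, h.proj i x := by
  classical
  refine h.induction (P := fun x => ∃ s : Finset ι, ∀ t, s ⊆ t → x = ∑ i ∈ t, h.proj i x)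
    (fun j x hx => ⟨{j}, fun t ht => ?_⟩) ⟨∅, by simp⟩ ?_ x
  · rw [Finset.sum_eq_single_of_mem j (ht (Finset.mem_singleton_self j))
      (fun i _ hi => h.proj_of_mem_ne hx hi.symm), h.proj_of_mem hx]
  · rintro x y ⟨s, hs⟩ ⟨t, ht⟩
    refine ⟨s ∪ t, fun r hr => ?_⟩
    simp only [map_add, Finset.sum_add_distrib]
    rw [← hs r (Finset.union_subset_left hr), ← ht r (Finset.union_subset_right hr)]

theorem IsDecomp.mem_of_proj_mem (h : IsDecomp 𝒜) {S : Submodule F A} {x : A}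
    (hx : ∀ i, h.proj i x ∈ S) : x ∈ S := by
  obtain ⟨s, hs⟩ := h.exists_sum_proj x
  rw [hs s subset_rfl]
  exact sum_mem fun i _ => hx i

theorem IsDecomp.eq_zero_of_proj (h : IsDecomp 𝒜) {x : A} (hx : ∀ i, h.proj i x = 0) : x = 0 := by
  simpa using h.mem_of_proj_mem (S := ⊥) (x := x) (by simpa using hx)

theorem IsDecomp.eq_of_mem_of_mem (h : IsDecomp 𝒜) {i j : ι} {x : A} (hi : x ∈ 𝒜 i)
    (hj : x ∈ 𝒜 j) (hx : x ≠ 0) : i = j := by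
  by_contra hij
  exact hx (by rw [← h.proj_of_mem hi, h.proj_of_mem_ne hj (Ne.symm hij)])

theorem IsDecomp.eq_of_eq (h : IsDecomp 𝒜) {i j : ι} (hij : 𝒜 i = 𝒜 j) (hi : 𝒜 i ≠ ⊥) :
    i = j := by
  obtain ⟨x, hx, hx0⟩ := (Submodule.ne_bot_iff _).1 hi
  exact h.eq_of_mem_of_mem hx (hij ▸ hx) hx0

/-- The graded subspaces are those closed under the projections. -/
theorem IsDecomp.eq_iSup_inf_iff (h : IsDecomp 𝒜) {S : Submodule F A} :
    S = ⨆ i, 𝒜 i ⊓ S ↔ ∀ x ∈ S, ∀ i, h.proj i x ∈ S := by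
  classical
  constructor
  · intro hS x hx i
    rw [hS] at hx
    refine Submodule.iSup_induction _ (motive := fun x => h.proj i x ∈ S) hx (fun j y hy => ?_)
      (by simp) (fun y z hy hz => by rw [map_add]; exact add_mem hy hz)
    by_cases hj : j = i
    · subst hj; rw [h.proj_of_mem hy.1]; exact hy.2
    · rw [h.proj_of_mem_ne hy.1 hj]; exact zero_mem _
  · intro hS
    refine le_antisymm (fun x hx => ?_) (iSup_le fun i => inf_le_right)
    exact h.mem_of_proj_mem fun i => Submodule.mem_iSup_of_mem i ⟨h.proj_mem i x, hS x hx i⟩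

theorem IsDecomp.proj_mem_iSup (h : IsDecomp 𝒜) {𝒬 : ι → Submodule F A} (hle : ∀ i, 𝒬 i ≤ 𝒜 i)
    {x : A} (hx : x ∈ iSup 𝒬) (i : ι) : h.proj i x ∈ 𝒬 i := by
  classical
  refine Submodule.iSup_induction _ (motive := fun x => h.proj i x ∈ 𝒬 i) hx (fun j y hy => ?_)
    (by simp) (fun y z hy hz => by rw [map_add]; exact add_mem hy hz)
  by_cases hj : j = i
  · subst hj; rwa [h.proj_of_mem (hle _ hy)]
  · rw [h.proj_of_mem_ne (hle _ hy) hj]; exact zero_mem _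

theorem IsDecomp.eq_of_le (h : IsDecomp 𝒜) {𝒬 : ι → Submodule F A} (hle : ∀ i, 𝒬 i ≤ 𝒜 i)
    (htop : iSup 𝒬 = ⊤) : 𝒬 = 𝒜 :=
  (h.indep.le_iff_eq_of_iSup_eq_top htop).1 hle

/-- A refinement of a direct sum decomposition. -/
theorem IsDecomp.refine {κ : Type*} (h : IsDecomp 𝒜) {𝒞 : ι → κ → Submodule F A}
    (hle : ∀ i k, 𝒞 i k ≤ 𝒜 i) (hsup : ∀ i, ⨆ k, 𝒞 i k = 𝒜 i) (hind : ∀ i, iSupIndep (𝒞 i)) :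
    IsDecomp fun q : ι × κ => 𝒞 q.1 q.2 := by
  classical
  constructor
  · rw [iSupIndep_iff_finsetSum_eq_zero_imp_eq_zero]
    intro s v hv h0 q hq
    have key : ∀ i, ∑ q ∈ s with q.1 = i, v q = 0 := by
      intro i
      have h1 := congrArg (h.proj i) h0
      rw [map_sum, map_zero] at h1
      rw [Finset.sum_filter]
      refine Eq.trans (Finset.sum_congr rfl fun r hr => ?_) h1
      by_cases hri : r.1 = i
      · rw [if_pos hri, ← hri, h.proj_of_mem (hle _ _ (hv r hr))]
      · rw [if_neg hri, h.proj_of_mem_ne (hle _ _ (hv r hr)) hri]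
    have h2 := (iSupIndep_iff_finsetSum_eq_zero_imp_eq_zero _).1 (hind q.1)
      (({r ∈ s | r.1 = q.1} : Finset (ι × κ)).image Prod.snd) (fun k => v (q.1, k))
    have hmem : ∀ k ∈ ({r ∈ s | r.1 = q.1} : Finset (ι × κ)).image Prod.snd, (q.1, k) ∈ s := by
      intro k hk
      simp only [Finset.mem_image, Finset.mem_filter] at hk
      obtain ⟨r, ⟨hr, hr1⟩, rfl⟩ := hk
      rwa [← hr1]
    refine h2 (fun k hk => hv _ (hmem k hk)) ?_ q.2 ?_
    · rw [Finset.sum_image, ← key q.1]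
      · refine Finset.sum_congr rfl fun r hr => ?_
        rw [← (Finset.mem_filter.1 hr).2]
      · intro a ha b hb hab
        exact Prod.ext ((Finset.mem_filter.1 ha).2.trans (Finset.mem_filter.1 hb).2.symm) hab
    · exact Finset.mem_image.2 ⟨q, Finset.mem_filter.2 ⟨hq, rfl⟩, rfl⟩
  · rw [← h.iSup_eq_top, iSup_prod]
    exact iSup_congr hsup

theorem IsDecomp.comap_equiv (h : IsDecomp 𝒜) (e : M ≃ₗ[F] A) :
    IsDecomp fun i => (𝒜 i).comap (e : M →ₗ[F] A) := by
  have : (fun i => (𝒜 i).comap (e : M →ₗ[F] A)) =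
      (Submodule.orderIsoMapComap e.symm) ∘ 𝒜 := by
    funext i
    simp only [Function.comp, Submodule.orderIsoMapComap_apply]
    exact (Submodule.map_equiv_eq_comap_symm e.symm (𝒜 i)).symm
  rw [this]
  constructor
  · exact h.indep.map_orderIso _
  · rw [← (Submodule.orderIsoMapComap e.symm).map_top, ← h.iSup_eq_top, OrderIso.map_iSup]
    rfl

/-- Blocks of a direct sum decomposition. -/
theorem IsDecomp.blocks {κ : Type*} (h : IsDecomp 𝒜) (d : ι → κ) :
    IsDecomp fun k => ⨆ (i : ι) (_ : d i = k), 𝒜 i := by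
  constructor
  · rw [iSupIndep_def]
    intro k
    have := h.indep.disjoint_biSup_biSup (s := {i | d i = k}) (t := {i | d i ≠ k})
      (Set.disjoint_left.2 fun i hi hi' => hi' hi)
    refine this.mono le_rfl ?_
    refine iSup₂_le fun l hl => iSup₂_le fun i hi => ?_
    exact le_iSup₂_of_le (f := fun i (_ : i ∈ {i | d i ≠ k}) => 𝒜 i) i
      (fun h => hl (hi.symm.trans h)) le_rfl
  · rw [eq_top_iff, ← h.iSup_eq_top]
    exact iSup_le fun i => le_iSup_of_le (d i) (le_iSup₂_of_le i rfl le_rfl)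

end Decomposition

/-! ### Gradings as families of components indexed by a group -/

section Families

variable {F : Type*} [Field F] {A : Type*} [NonUnitalNonAssocRing A] [Module F A]
  {G : Type*}

/-- The set of nonzero components. -/
def support (𝒜 : G → Submodule F A) : Set (Submodule F A) := {S | S ≠ ⊥ ∧ ∃ g, S = 𝒜 g}

/-- The degree of a nonzero component. -/
noncomputable def supportDegree (𝒜 : G → Submodule F A) (U : support 𝒜) : G := U.2.2.choose

variable {𝒜 : G → Submodule F A}

theorem eq_supportDegree (U : support 𝒜) : U.1 = 𝒜 (supportDegree 𝒜 U) := U.2.2.choose_spec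

theorem mem_support {g : G} (h : 𝒜 g ≠ ⊥) : 𝒜 g ∈ support 𝒜 := ⟨h, g, rfl⟩

theorem mem_support_of_mem {g : G} {x : A} (hx : x ∈ 𝒜 g) (h0 : x ≠ 0) : 𝒜 g ∈ support 𝒜 :=
  mem_support ((Submodule.ne_bot_iff _).2 ⟨x, hx, h0⟩)

theorem le_component {Γ : Set (Submodule F A)} (d : Γ → G) (U : Γ) : U.1 ≤ component d (d U) :=
  le_iSup₂_of_le U rfl le_rfl

theorem component_le {Γ : Set (Submodule F A)} {d : Γ → G} {g : G} {S : Submodule F A}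
    (h : ∀ U : Γ, d U = g → U.1 ≤ S) : component d g ≤ S :=
  iSup₂_le h

variable [CommGroup G]

/-- A grading by `G`, as a family of subspaces. -/
structure IsGradedFamily (𝒜 : G → Submodule F A) : Prop extends IsDecomp 𝒜 where
  mul_mem : ∀ {g h : G} {x y : A}, x ∈ 𝒜 g → y ∈ 𝒜 h → x * y ∈ 𝒜 (g * h)

theorem IsGradedFamily.refine {K : Type*} [CommGroup K] (h : IsGradedFamily 𝒜)
    {𝒞 : G → K → Submodule F A} (hle : ∀ g k, 𝒞 g k ≤ 𝒜 g) (hsup : ∀ g, ⨆ k, 𝒞 g k = 𝒜 g)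
    (hind : ∀ g, iSupIndep (𝒞 g))
    (hmul : ∀ {g g' k k' x y}, x ∈ 𝒞 g k → y ∈ 𝒞 g' k' → x * y ∈ 𝒞 (g * g') (k * k')) :
    IsGradedFamily fun q : G × K => 𝒞 q.1 q.2 :=
  { h.toIsDecomp.refine hle hsup hind with mul_mem := fun hx hy => hmul hx hy }

theorem IsGradedFamily.isGrading (h : IsGradedFamily 𝒜) : IsGrading (support 𝒜) where
  ne_bot := fun U hU => hU.1
  indep := by
    have := h.indep.sSupIndep_range
    refine this.mono ?_
    rintro U ⟨_, g, rfl⟩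
    exact ⟨g, rfl⟩
  sSup_eq_top := by
    rw [eq_top_iff, ← h.iSup_eq_top]
    refine iSup_le fun g => ?_
    by_cases hg : 𝒜 g = ⊥
    · rw [hg]; exact bot_le
    · exact le_sSup (mem_support hg)
  exists_mulLE := by
    rintro U ⟨hU, g, rfl⟩ V ⟨hV, k, rfl⟩
    by_cases hg : 𝒜 (g * k) = ⊥
    · refine ⟨_, ⟨hU, g, rfl⟩, fun x hx y hy => ?_⟩
      have := h.mul_mem hx hy
      rw [hg, Submodule.mem_bot] at this
      rw [this]; exact zero_mem _
    · exact ⟨_, mem_support hg, fun x hx y hy => h.mul_mem hx hy⟩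

theorem IsGradedFamily.supportDegree_eq (h : IsGradedFamily 𝒜) (U : support 𝒜) {g : G}
    (hg : U.1 = 𝒜 g) : supportDegree 𝒜 U = g :=
  h.toIsDecomp.eq_of_eq ((eq_supportDegree U).symm.trans hg) (eq_supportDegree U ▸ U.2.1)

theorem IsGradedFamily.isGradingBy (h : IsGradedFamily 𝒜) :
    IsGradingBy (support 𝒜) (supportDegree 𝒜) where
  isGrading := h.isGrading
  injective := fun U V hUV => Subtype.ext (by rw [eq_supportDegree U, eq_supportDegree V, hUV])
  map_mul := by
    rintro U V W ⟨x, hx, y, hy, hxy⟩ hle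
    have h1 := hle x hx y hy
    rw [eq_supportDegree] at hx hy h1
    exact h.toIsDecomp.eq_of_mem_of_mem (h.mul_mem hx hy) h1 hxy

/-- A degree map on a grading that is compatible with products. -/
def IsDegree {Γ : Set (Submodule F A)} (d : Γ → G) : Prop :=
  ∀ U V W : Γ, MulNeZero U.1 V.1 → MulLE U.1 V.1 W.1 → d U * d V = d W

theorem IsGrading.isDecomp {Γ : Set (Submodule F A)} (h : IsGrading Γ) :
    IsDecomp fun U : Γ => U.1 :=
  ⟨(sSupIndep_iff _).1 h.indep, by rw [← sSup_eq_iSup', h.sSup_eq_top]⟩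

/-- The coarsening of a grading defined by a degree map. -/
theorem IsGrading.isGradedFamily_component {Γ : Set (Submodule F A)} (h : IsGrading Γ)
    {d : Γ → G} (hd : IsDegree d) : IsGradedFamily (component d) where
  toIsDecomp := h.isDecomp.blocks d
  mul_mem := by
    intro g k a b ha hb
    unfold component at ha hb
    refine Submodule.iSup_induction (motive := fun a => a * b ∈ component d (g * k)) _ ha
      (fun U x hx => ?_) (by simp) (fun x y hx hy => by rw [add_mul]; exact add_mem hx hy)
    refine Submodule.iSup_induction (motive := fun b => x * b ∈ component d (g * k)) _ hb
      (fun V y hy => ?_) (by simp) (fun y z hy hz => by rw [mul_add]; exact add_mem hy hz)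
    by_cases hU : d U = g
    · by_cases hV : d V = k
      · simp only [hU, hV, iSup_pos] at hx hy
        obtain ⟨W, hW, hm⟩ := h.exists_mulLE U.1 U.2 V.1 V.2
        by_cases h0 : x * y = 0
        · rw [h0]; exact zero_mem _
        · have hd := hd U V ⟨W, hW⟩ ⟨x, hx, y, hy, h0⟩ hm
          rw [hU, hV] at hd
          exact Submodule.mem_iSup_of_mem (⟨W, hW⟩ : Γ)
            (Submodule.mem_iSup_of_mem hd.symm (hm x hx y hy))
      · simp only [hV, not_false_eq_true, iSup_neg, Submodule.mem_bot] at hy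
        simp [hy]
    · simp only [hU, not_false_eq_true, iSup_neg, Submodule.mem_bot] at hx
      simp [hx]

section GradingBy

variable {Γ : Set (Submodule F A)} {δ : Γ → G}

theorem IsGradingBy.isGradedFamily (h : IsGradingBy Γ δ) : IsGradedFamily (component δ) :=
  h.isGrading.isGradedFamily_component h.map_mul

theorem IsGradingBy.component_degree (h : IsGradingBy Γ δ) (U : Γ) : component δ (δ U) = U.1 :=
  le_antisymm (component_le fun V hV => by rw [h.injective hV]) (le_component δ U)

theorem IsGradingBy.support_component (h : IsGradingBy Γ δ) : support (component δ) = Γ := by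
  ext S
  constructor
  · rintro ⟨h0, g, rfl⟩
    by_cases hg : ∃ U, δ U = g
    · obtain ⟨U, rfl⟩ := hg
      rw [h.component_degree]; exact U.2
    · refine absurd ?_ h0
      rw [eq_bot_iff]
      exact component_le fun U hU => absurd ⟨U, hU⟩ hg
  · intro hS
    refine ⟨h.isGrading.ne_bot S hS, δ ⟨S, hS⟩, ?_⟩
    rw [h.component_degree]

end GradingBy

end Families

/-! ### Universal groups and refinements -/

section Universal

variable {F : Type*} [Field F] {A : Type u} [NonUnitalNonAssocRing A] [Module F A]
  {G : Type*} [CommGroup G] {Γ : Set (Submodule F A)}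

theorem exists_universalGroup_hom {d : Γ → G} (hd : IsDegree d) :
    ∃ f : UniversalGroup Γ →* G, ∀ U, f (universalDegree Γ U) = d U := by
  let f₀ : FreeAbelianGroup Γ →+ Additive G := FreeAbelianGroup.lift fun U => Additive.ofMul (d U)
  have hf₀ : AddSubgroup.closure (universalRelations Γ) ≤ f₀.ker := by
    rw [AddSubgroup.closure_le]
    rintro r ⟨U, V, W, h1, h2, rfl⟩
    have := hd U V W h1 h2
    simp only [SetLike.mem_coe, AddMonoidHom.mem_ker, map_sub, map_add, f₀,
      FreeAbelianGroup.lift_apply_of]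
    rw [← this, ofMul_mul, sub_self]
  refine ⟨AddMonoidHom.toMultiplicativeLeft (QuotientAddGroup.lift _ f₀ hf₀), fun U => ?_⟩
  change Additive.toMul (f₀ (FreeAbelianGroup.of U)) = d U
  simp [f₀]

theorem universalGroup_hom_ext {f g : UniversalGroup Γ →* G}
    (h : ∀ U, f (universalDegree Γ U) = g (universalDegree Γ U)) : f = g := by
  apply AddMonoidHom.toMultiplicativeLeft.symm.injective
  apply QuotientAddGroup.addMonoidHom_ext
  apply FreeAbelianGroup.lift_ext
  exact h

theorem isDegree_universalDegree : IsDegree (universalDegree Γ) := by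
  intro U V W h1 h2
  change Multiplicative.ofAdd (_ + _) = _
  refine congrArg Multiplicative.ofAdd ?_
  refine (QuotientAddGroup.eq_iff_sub_mem.2 ?_)
  exact AddSubgroup.subset_closure ⟨U, V, W, h1, h2, rfl⟩

/-- `δ` factors through the natural map, which is therefore injective too. So the universal group
can always serve as grading group, whatever the universe of `G`. -/
theorem IsGradingBy.universal {δ : Γ → G} (h : IsGradingBy Γ δ) :
    IsGradingBy Γ (universalDegree Γ) where
  isGrading := h.isGrading
  injective := by
    obtain ⟨f, hf⟩ := exists_universalGroup_hom h.map_mul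
    intro U V hUV
    apply h.injective
    rw [← hf, ← hf, hUV]
  map_mul := isDegree_universalDegree

theorem IsGradingBy.isGroupGrading {δ : Γ → G} (h : IsGradingBy Γ δ) : IsGroupGrading Γ :=
  ⟨_, _, _, h.universal⟩

theorem IsGroupGrading.universal (h : IsGroupGrading Γ) : IsGradingBy Γ (universalDegree Γ) := by
  obtain ⟨G, _, δ, h⟩ := h
  exact h.universal

theorem IsGradedFamily.isGroupGrading {𝒜 : G → Submodule F A} (h : IsGradedFamily 𝒜) :
    IsGroupGrading (support 𝒜) :=
  h.isGradingBy.isGroupGrading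

/-- The family of homogeneous components for the universal group. -/
abbrev universalFamily (Γ : Set (Submodule F A)) : UniversalGroup Γ → Submodule F A :=
  component (universalDegree Γ)

theorem IsGroupGrading.isGradedFamily (h : IsGroupGrading Γ) :
    IsGradedFamily (universalFamily Γ) :=
  h.universal.isGradedFamily

theorem IsGroupGrading.support_eq (h : IsGroupGrading Γ) : support (universalFamily Γ) = Γ :=
  h.universal.support_component

theorem IsGroupGrading.universalFamily_degree (h : IsGroupGrading Γ) (U : Γ) :
    universalFamily Γ (universalDegree Γ U) = U.1 :=
  h.universal.component_degree U

theorem IsGrading.eq_of_le (h : IsGrading Γ) {U V : Submodule F A} (hU : U ∈ Γ) (hV : V ∈ Γ)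
    (hle : U ≤ V) : U = V := by
  by_contra hne
  have := h.indep.pairwiseDisjoint hU hV hne
  exact h.ne_bot U hU (disjoint_self.1 (this.mono_right hle))

/-- A set of subspaces that spans the space and is contained in a grading is the whole grading. -/
theorem IsGrading.eq_of_subset (h : IsGrading Γ) {Γ' : Set (Submodule F A)} (hsub : Γ' ⊆ Γ)
    (htop : sSup Γ' = ⊤) : Γ' = Γ := by
  refine hsub.antisymm fun V hV => ?_
  by_contra hV'
  have := h.indep.disjoint_sSup hV hsub hV'
  rw [htop, disjoint_top] at this
  exact h.ne_bot V hV this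

/-- The usable form of fineness. No inclusion can be proper, so `Γ'` is a subset of `Γ` that still
spans, and a spanning subset of an independent set of nonzero subspaces is the whole set. -/
theorem IsFineGroupGrading.eq_of_refines (h : IsFineGroupGrading Γ) {Γ' : Set (Submodule F A)}
    (hΓ' : IsGroupGrading Γ') (hle : ∀ U ∈ Γ', ∃ V ∈ Γ, U ≤ V) : Γ' = Γ := by
  refine h.1.universal.isGrading.eq_of_subset (fun U hU => ?_) hΓ'.universal.isGrading.sSup_eq_top
  obtain ⟨V, hV, hUV⟩ := hle U hU
  have : ¬ U < V := fun hlt => h.2 Γ' hΓ' ⟨hle, U, hU, V, hV, hlt⟩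
  rw [eq_of_le_of_not_lt hUV this]
  exact hV

theorem IsFineGroupGrading.support_eq_of_refines (h : IsFineGroupGrading Γ)
    {𝒜 : G → Submodule F A} (h𝒜 : IsGradedFamily 𝒜)
    (hle : ∀ g, 𝒜 g ≠ ⊥ → ∃ V ∈ Γ, 𝒜 g ≤ V) : support 𝒜 = Γ := by
  refine h.eq_of_refines h𝒜.isGroupGrading ?_
  rintro U ⟨h0, g, rfl⟩
  exact hle g h0

theorem isFineGroupGrading_of_forall_eq (h : IsGroupGrading Γ)
    (hΓ : ∀ Γ' : Set (Submodule F A), IsGroupGrading Γ' → (∀ U ∈ Γ', ∃ V ∈ Γ, U ≤ V) → Γ' = Γ) :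
    IsFineGroupGrading Γ := by
  refine ⟨h, fun Γ' hΓ' hr => ?_⟩
  obtain ⟨U, hU, V, hV, hlt⟩ := hr.2
  rw [hΓ Γ' hΓ' hr.1] at hU
  exact hlt.ne (h.universal.isGrading.eq_of_le hU hV hlt.le)

/-- A finer group-grading maps to the coarser one at the level of degrees. -/
theorem exists_hom_of_refines {K : Type*} [CommGroup K] {ℬ : K → Submodule F A}
    (hℬ : IsGradedFamily ℬ)
    (hle : ∀ U ∈ Γ, ∃ k, U ≤ ℬ k) :
    ∃ f : UniversalGroup Γ →* K, ∀ g, universalFamily Γ g ≤ ℬ (f g) := by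
  choose d hd using hle
  have hdeg : IsDegree fun U : Γ => d U.1 U.2 := by
    rintro U V W ⟨x, hx, y, hy, hxy⟩ hle
    exact hℬ.toIsDecomp.eq_of_mem_of_mem (hℬ.mul_mem (hd _ U.2 hx) (hd _ V.2 hy))
      (hd _ W.2 (hle x hx y hy)) hxy
  obtain ⟨f, hf⟩ := exists_universalGroup_hom hdeg
  refine ⟨f, fun g => component_le fun U hU => ?_⟩
  rw [← hU, hf]
  exact hd _ U.2

end Universal

/-! ### Graded simplicity, annihilators and the centroid -/

section Simple

variable {F : Type*} [Field F] {A : Type*} [NonUnitalNonAssocRing A] [Module F A]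
  {G : Type*}

theorem isGradedSubspace_support_iff {𝒜 : G → Submodule F A} {S : Submodule F A} :
    IsGradedSubspace (support 𝒜) S ↔ S = ⨆ g, 𝒜 g ⊓ S := by
  have : (⨆ U : support 𝒜, U.1 ⊓ S) = ⨆ g, 𝒜 g ⊓ S := by
    apply le_antisymm
    · refine iSup_le fun U => ?_
      rw [eq_supportDegree U]
      exact le_iSup (fun g => 𝒜 g ⊓ S) _
    · refine iSup_le fun g => ?_
      by_cases hg : 𝒜 g = ⊥
      · rw [hg, bot_inf_eq]; exact bot_le
      · exact le_iSup (fun U : support 𝒜 => U.1 ⊓ S) ⟨𝒜 g, mem_support hg⟩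
  rw [IsGradedSubspace, this]

variable [CommGroup G]

/-- Graded-simplicity in terms of homogeneous components. -/
structure IsGradedSimpleFamily (𝒜 : G → Submodule F A) : Prop where
  exists_mul_ne_zero : ∃ x y : A, x * y ≠ 0
  eq_bot_or_eq : ∀ 𝒬 : G → Submodule F A, (∀ g, 𝒬 g ≤ 𝒜 g) →
    (∀ g k x y, x ∈ 𝒜 g → y ∈ 𝒬 k → x * y ∈ 𝒬 (g * k) ∧ y * x ∈ 𝒬 (g * k)) →
    (∀ g, 𝒬 g = ⊥) ∨ (∀ g, 𝒬 g = 𝒜 g)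

theorem IsGradedFamily.isGradedSubspace_iff {𝒜 : G → Submodule F A} (h : IsGradedFamily 𝒜)
    {S : Submodule F A} :
    IsGradedSubspace (support 𝒜) S ↔ ∀ x ∈ S, ∀ g, h.toIsDecomp.proj g x ∈ S := by
  rw [isGradedSubspace_support_iff, h.toIsDecomp.eq_iSup_inf_iff]

theorem IsGradedFamily.isIdeal_iSup {𝒜 : G → Submodule F A} (h : IsGradedFamily 𝒜)
    {𝒬 : G → Submodule F A}
    (hmul : ∀ g k x y, x ∈ 𝒜 g → y ∈ 𝒬 k → x * y ∈ 𝒬 (g * k) ∧ y * x ∈ 𝒬 (g * k)) :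
    IsIdeal (iSup 𝒬) := by
  intro x y hy
  refine Submodule.iSup_induction 𝒬 (motive := fun y => x * y ∈ iSup 𝒬 ∧ y * x ∈ iSup 𝒬) hy
    (fun k y hy => ?_) (by simp) (fun y z hy hz => ?_)
  · refine h.toIsDecomp.induction (P := fun x => x * y ∈ iSup 𝒬 ∧ y * x ∈ iSup 𝒬)
      (fun g x hx => ?_) (by simp) (fun a b ha hb => ?_) x
    · exact ⟨Submodule.mem_iSup_of_mem _ (hmul g k x y hx hy).1,
        Submodule.mem_iSup_of_mem _ (hmul g k x y hx hy).2⟩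
    · rw [add_mul, mul_add]
      exact ⟨add_mem ha.1 hb.1, add_mem ha.2 hb.2⟩
  · rw [add_mul, mul_add]
    exact ⟨add_mem hy.1 hz.1, add_mem hy.2 hz.2⟩

theorem IsGradedFamily.isGradedSimple_support_iff {𝒜 : G → Submodule F A}
    (h : IsGradedFamily 𝒜) : IsGradedSimple (support 𝒜) ↔ IsGradedSimpleFamily 𝒜 := by
  constructor
  · intro hs
    refine ⟨hs.1, fun 𝒬 hle hmul => ?_⟩
    have hgr : IsGradedSubspace (support 𝒜) (iSup 𝒬) := by
      rw [h.isGradedSubspace_iff]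
      intro x hx g
      exact Submodule.mem_iSup_of_mem g (h.toIsDecomp.proj_mem_iSup hle hx g)
    rcases hs.2 _ (h.isIdeal_iSup hmul) hgr with h0 | h1
    · left
      intro g
      rw [eq_bot_iff, ← h0]
      exact le_iSup 𝒬 g
    · right
      exact fun g => congrFun (h.toIsDecomp.eq_of_le hle h1) g
  · intro hs
    refine ⟨hs.1, fun I hI hgr => ?_⟩
    have hI' := isGradedSubspace_support_iff.1 hgr
    rcases hs.2 (fun g => 𝒜 g ⊓ I) (fun g => inf_le_left) (fun g k x y hx hy =>
      ⟨⟨h.mul_mem hx hy.1, (hI x y hy.2).1⟩,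
        ⟨mul_comm k g ▸ h.mul_mem hy.1 hx, (hI x y hy.2).2⟩⟩) with h0 | h1
    · left
      rw [hI', eq_bot_iff]
      exact iSup_le fun g => (h0 g).le
    · right
      rw [eq_top_iff, ← h.iSup_eq_top]
      exact iSup_le fun g => (h1 g).ge.trans inf_le_right

theorem isIdeal_iSup {ι : Sort*} {I : ι → Submodule F A} (h : ∀ i, IsIdeal (I i)) :
    IsIdeal (iSup I) := by
  intro x y hy
  refine Submodule.iSup_induction I (motive := fun y => x * y ∈ iSup I ∧ y * x ∈ iSup I) hy
    (fun i y hy => ⟨Submodule.mem_iSup_of_mem i (h i x y hy).1,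
      Submodule.mem_iSup_of_mem i (h i x y hy).2⟩) (by simp) (fun y z hy hz => ?_)
  rw [add_mul, mul_add]
  exact ⟨add_mem hy.1 hz.1, add_mem hy.2 hz.2⟩

theorem IsIdeal.inf {I J : Submodule F A} (hI : IsIdeal I) (hJ : IsIdeal J) : IsIdeal (I ⊓ J) :=
  fun x y hy => ⟨⟨(hI x y hy.1).1, (hJ x y hy.2).1⟩, ⟨(hI x y hy.1).2, (hJ x y hy.2).2⟩⟩

theorem isIdeal_top : IsIdeal (⊤ : Submodule F A) := fun _ _ _ => ⟨trivial, trivial⟩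

theorem isIdeal_bot : IsIdeal (⊥ : Submodule F A) := by
  intro x y hy
  rw [Submodule.mem_bot] at hy
  simp [hy]

variable {B : Type*} [NonUnitalNonAssocRing B] [Module F B]

theorem isIdeal_ker {p : A →ₗ[F] B} (hp : ∀ x y, p (x * y) = p x * p y) :
    IsIdeal (LinearMap.ker p) := by
  intro x y hy
  rw [LinearMap.mem_ker] at hy
  simp [hp, hy]

theorem IsIdeal.map {p : A →ₗ[F] B} (hp : ∀ x y, p (x * y) = p x * p y)
    (hs : Function.Surjective p) {I : Submodule F A} (hI : IsIdeal I) : IsIdeal (I.map p) := by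
  rintro x _ ⟨y, hy, rfl⟩
  obtain ⟨x, rfl⟩ := hs x
  exact ⟨⟨x * y, (hI x y hy).1, hp x y⟩, ⟨y * x, (hI x y hy).2, hp y x⟩⟩

theorem IsIdeal.comap {p : A →ₗ[F] B} (hp : ∀ x y, p (x * y) = p x * p y)
    {I : Submodule F B} (hI : IsIdeal I) : IsIdeal (I.comap p) := by
  intro x y hy
  simp only [Submodule.mem_comap, hp] at hy ⊢
  exact hI _ _ hy

theorem IsSimpleAlgebra.injective (h : IsSimpleAlgebra F A) {p : A →ₗ[F] B}
    (hp : ∀ x y, p (x * y) = p x * p y) (h0 : p ≠ 0) : Function.Injective p := by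
  rcases h.2 _ (isIdeal_ker hp) with h1 | h1
  · exact LinearMap.ker_eq_bot.1 h1
  · exact absurd (LinearMap.ker_eq_top.1 h1) h0

variable [IsScalarTower F A A] [SMulCommClass F A A]

/-- The annihilator of a subspace. -/
def annihilator (S : Submodule F A) : Submodule F A where
  carrier := {x | ∀ y ∈ S, x * y = 0 ∧ y * x = 0}
  add_mem' := fun {a b} ha hb y hy => by
    rw [add_mul, mul_add, (ha y hy).1, (ha y hy).2, (hb y hy).1, (hb y hy).2, add_zero]
    exact ⟨rfl, rfl⟩
  zero_mem' := fun y _ => by simp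
  smul_mem' := fun c x hx y hy => by
    rw [smul_mul_assoc, mul_smul_comm, (hx y hy).1, (hx y hy).2, smul_zero]
    exact ⟨rfl, rfl⟩

theorem mem_annihilator {S : Submodule F A} {x : A} :
    x ∈ annihilator S ↔ ∀ y ∈ S, x * y = 0 ∧ y * x = 0 :=
  Iff.rfl

theorem isIdeal_annihilator_top : IsIdeal (annihilator (⊤ : Submodule F A)) := by
  intro x y hy
  rw [(hy x trivial).1, (hy x trivial).2]
  exact ⟨zero_mem _, zero_mem _⟩

theorem IsSimpleAlgebra.eq_zero_of_mul_eq_zero (h : IsSimpleAlgebra F A) {x : A}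
    (hx : ∀ y, x * y = 0 ∧ y * x = 0) : x = 0 := by
  rcases h.2 _ isIdeal_annihilator_top with h0 | h1
  · rw [← Submodule.mem_bot F, ← h0]
    exact fun y _ => hx y
  · obtain ⟨a, b, hab⟩ := h.1
    have ha : a ∈ annihilator (⊤ : Submodule F A) := by rw [h1]; trivial
    exact absurd (ha b trivial).1 hab

/-- An eigenspace of an element of the centroid is a nonzero ideal, hence everything. -/
theorem IsSimpleAlgebra.isCentral [IsAlgClosed F] [FiniteDimensional F A]
    (h : IsSimpleAlgebra F A) : IsCentralSimpleAlgebra F A := by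
  refine ⟨h, fun f hf => ?_⟩
  obtain ⟨a, b, hab⟩ := h.1
  have : Nontrivial A := ⟨a * b, 0, hab⟩
  obtain ⟨c, hc⟩ := Module.End.exists_eigenvalue f
  refine ⟨c, fun x => ?_⟩
  have hI : IsIdeal (Module.End.eigenspace f c) := by
    intro x y hy
    rw [Module.End.mem_eigenspace_iff] at hy
    rw [Module.End.mem_eigenspace_iff, Module.End.mem_eigenspace_iff, (hf x y).2, (hf y x).1, hy,
      smul_mul_assoc, mul_smul_comm]
    exact ⟨rfl, rfl⟩
  rcases h.2 _ hI with h0 | h1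
  · exact absurd h0 hc
  · exact Module.End.mem_eigenspace_iff.1 (h1 ▸ trivial : x ∈ Module.End.eigenspace f c)

/-- A subspace of `A × A` that looks like the graph of an element of the centroid of a central
simple algebra is contained in the graph of a scalar. -/
theorem IsCentralSimpleAlgebra.exists_smul (h : IsCentralSimpleAlgebra F A)
    (W : Submodule F (A × A)) (hmul : ∀ w ∈ W, ∀ a, (a * w.1, a * w.2) ∈ W ∧ (w.1 * a, w.2 * a) ∈ W)
    (hcomm : ∀ w ∈ W, ∀ w' ∈ W, w.1 * w'.2 = w.2 * w'.1) (hfst : ∀ a, ∃ b, (a, b) ∈ W) :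
    ∃ c : F, ∀ w ∈ W, w.2 = c • w.1 := by
  -- Applying `hcomm` to `(0, c)` and `(a, b)` shows that `c` annihilates `A`. Hence `W` is the
  -- graph of a linear map, which `hmul` puts in the centroid.
  have huniq0 : ∀ c, ((0 : A), c) ∈ W → c = 0 := by
    intro c hc
    refine h.1.eq_zero_of_mul_eq_zero fun a => ?_
    obtain ⟨b, hb⟩ := hfst a
    have h1 := hcomm _ hc _ hb
    have h2 := hcomm _ hb _ hc
    simp only [zero_mul, mul_zero] at h1 h2
    exact ⟨h1.symm, h2⟩
  have huniq : ∀ {a b b'}, (a, b) ∈ W → (a, b') ∈ W → b = b' := by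
    intro a b b' hb hb'
    have := sub_mem hb hb'
    simp only [Prod.mk_sub_mk, sub_self] at this
    exact sub_eq_zero.1 (huniq0 _ this)
  choose f hf using hfst
  let φ : A →ₗ[F] A :=
    { toFun := f
      map_add' := fun x y => huniq (hf (x + y)) (add_mem (hf x) (hf y))
      map_smul' := fun c x => huniq (hf (c • x)) (W.smul_mem c (hf x)) }
  obtain ⟨c, hc⟩ := h.2 φ fun x y =>
    ⟨huniq (hf (x * y)) (hmul _ (hf x) y).2, huniq (hf (x * y)) (hmul _ (hf y) x).1⟩
  refine ⟨c, fun w hw => ?_⟩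
  rw [← hc]
  exact huniq hw (hf w.1)

end Simple

/-! ### The structure theorem: central simple quotients of graded-simple algebras -/

section Structure

variable {F : Type*} [Field F] {A : Type*} [NonUnitalNonAssocRing A] [Module F A]
  {B : Type*} [NonUnitalNonAssocRing B] [Module F B]
  {G : Type*} [CommGroup G] {𝓑 : G → Submodule F B} {p : B →ₗ[F] A}

/-- The homogeneous elements of `ker p` form a graded ideal, which is not everything because `p ≠
0`. So `p` is injective on each component, though in general not globally. -/
theorem IsGradedSimpleFamily.eq_zero_of_map_eq_zero (h : IsGradedFamily 𝓑)
    (hs : IsGradedSimpleFamily 𝓑) (hp : ∀ x y, p (x * y) = p x * p y) (hp0 : p ≠ 0) {g : G}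
    {x : B} (hx : x ∈ 𝓑 g) (hpx : p x = 0) : x = 0 := by
  rcases hs.2 (fun g => 𝓑 g ⊓ LinearMap.ker p) (fun g => inf_le_left) (fun g k x y hx hy =>
    ⟨⟨h.mul_mem hx hy.1, (isIdeal_ker hp x y hy.2).1⟩,
      ⟨mul_comm k g ▸ h.mul_mem hy.1 hx, (isIdeal_ker hp x y hy.2).2⟩⟩) with h0 | h1
  · rw [← Submodule.mem_bot F, ← h0 g]
    exact ⟨hx, hpx⟩
  · refine absurd (h.toIsDecomp.hom_ext fun g x hx => ?_) hp0
    rw [← h1 g] at hx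
    exact hx.2

/-- The degrees that can be absorbed by the homomorphism `p`. -/
def degreeStabilizer (𝓑 : G → Submodule F B) (p : B →ₗ[F] A) : Subgroup G where
  carrier := {h | ∀ g, (𝓑 (g * h)).map p = (𝓑 g).map p}
  mul_mem' := fun {a b} ha hb g => by rw [← mul_assoc, hb, ha]
  one_mem' := fun g => by rw [mul_one]
  inv_mem' := fun {a} ha g => by rw [← ha (g * a⁻¹), inv_mul_cancel_right]

/-- The family of images of the components. -/
def quotientFamily (𝓑 : G → Submodule F B) (p : B →ₗ[F] A) (q : G ⧸ degreeStabilizer 𝓑 p) :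
    Submodule F A :=
  Quotient.liftOn' q (fun g => (𝓑 g).map p) fun a b hab => by
    have := QuotientGroup.leftRel_apply.1 hab a
    rw [mul_inv_cancel_left] at this
    exact this.symm

theorem quotientFamily_mk (g : G) :
    quotientFamily 𝓑 p (QuotientGroup.mk g) = (𝓑 g).map p := rfl

/-- Linear relations modulo the kernel of `p` between homogeneous elements with degrees in a
translate of `S`. -/
def relations (𝓑 : G → Submodule F B) (p : B →ₗ[F] A) (S : Finset G) (k : G) :
    Submodule F (G → B) where
  carrier := {z | (∀ s ∈ S, z s ∈ 𝓑 (k * s)) ∧ ∑ s ∈ S, p (z s) = 0}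
  add_mem' := fun {a b} ha hb => ⟨fun s hs => add_mem (ha.1 s hs) (hb.1 s hs), by
    simp only [Pi.add_apply, map_add, Finset.sum_add_distrib, ha.2, hb.2, add_zero]⟩
  zero_mem' := ⟨fun s _ => zero_mem _, by simp⟩
  smul_mem' := fun c a ha => ⟨fun s hs => Submodule.smul_mem _ c (ha.1 s hs), by
    simp only [Pi.smul_apply, map_smul, ← Finset.smul_sum, ha.2, smul_zero]⟩

/-- Relations form a graded bimodule over `B`; commutativity of `G` puts left and right products in
the same degree. -/
theorem relations_mul (h : IsGradedFamily 𝓑) (hp : ∀ x y, p (x * y) = p x * p y)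
    {S : Finset G} {k l : G} {z : G → B} (hz : z ∈ relations 𝓑 p S k) {b : B} (hb : b ∈ 𝓑 l) :
    (fun s => b * z s) ∈ relations 𝓑 p S (l * k) ∧
      (fun s => z s * b) ∈ relations 𝓑 p S (l * k) := by
  refine ⟨⟨fun s hs => ?_, ?_⟩, ⟨fun s hs => ?_, ?_⟩⟩
  · rw [mul_assoc]; exact h.mul_mem hb (hz.1 s hs)
  · simp only [hp, ← Finset.mul_sum, hz.2, mul_zero]
  · rw [mul_assoc, mul_comm]; exact h.mul_mem (hz.1 s hs) hb
  · simp only [hp, ← Finset.sum_mul, hz.2, zero_mul]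

variable [IsScalarTower F A A] [SMulCommClass F A A]

/-- The heart of the structure theorem. The hypothesis `hmin` says that a relation supported on `S`
is determined by any one of its coordinates. The pairs `(p (z t), p (z s))` then span something like
the graph of an element of the centroid of `A`. Centrality gives `p (z s) = c • p (z t)` with one
scalar `c` for all relations, and every homogeneous element occurs as a coordinate of a relation. -/
theorem map_le_map_of_minimal_relations (h : IsGradedFamily 𝓑) (hs : IsGradedSimpleFamily 𝓑)
    (hp : ∀ x y, p (x * y) = p x * p y) (hsurj : Function.Surjective p)
    (hA : IsCentralSimpleAlgebra F A) {S : Finset G}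
    (hmin : ∀ k, ∀ z ∈ relations 𝓑 p S k, ∀ s ∈ S, z s = 0 → ∀ t ∈ S, z t = 0)
    {k₀ : G} {z₀ : G → B} (hz₀ : z₀ ∈ relations 𝓑 p S k₀) {s₀ : G} (hs₀ : s₀ ∈ S)
    (hne : z₀ s₀ ≠ 0) {s t : G} (hsS : s ∈ S) (htS : t ∈ S) (k : G) :
    (𝓑 (k * s)).map p ≤ (𝓑 (k * t)).map p := by
  -- The `u`-th coordinates of relations form a graded ideal, nonzero because of `z₀`, hence every
  -- homogeneous element is such a coordinate. The shift by `u⁻¹` makes degree and index agree.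
  have hall : ∀ u ∈ S, ∀ l, ∀ b ∈ 𝓑 (l * u), ∃ z ∈ relations 𝓑 p S l, z u = b := by
    intro u hu
    have hne' : z₀ u ≠ 0 := fun h0 => hne (hmin _ _ hz₀ _ hu h0 _ hs₀)
    rcases hs.2 (fun l => (relations 𝓑 p S (l * u⁻¹)).map (LinearMap.proj u)) (by
      rintro l _ ⟨z, hz, rfl⟩
      have := hz.1 u hu
      rwa [inv_mul_cancel_right] at this) (by
      rintro g l x _ hx ⟨z, hz, rfl⟩
      rw [mul_assoc]
      exact ⟨⟨_, (relations_mul h hp hz hx).1, rfl⟩, ⟨_, (relations_mul h hp hz hx).2, rfl⟩⟩)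
      with h0 | h1
    · have hmem : z₀ u ∈ (relations 𝓑 p S (k₀ * u * u⁻¹)).map (LinearMap.proj u) := by
        rw [mul_inv_cancel_right]
        exact ⟨z₀, hz₀, rfl⟩
      rw [h0 (k₀ * u)] at hmem
      exact absurd hmem hne'
    · intro l b hb
      rw [← h1 (l * u), mul_inv_cancel_right] at hb
      exact hb
  have hall' : ∀ a, ∃ b ∈ Submodule.span F
      {w : A × A | ∃ l, ∃ z ∈ relations 𝓑 p S l, w = (p (z t), p (z s))}, b.1 = a := by
    intro a
    obtain ⟨b, rfl⟩ := hsurj a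
    refine h.toIsDecomp.induction (P := fun b => ∃ w ∈ Submodule.span F
      {w : A × A | ∃ l, ∃ z ∈ relations 𝓑 p S l, w = (p (z t), p (z s))}, w.1 = p b)
      (fun l b hb => ?_) ⟨0, zero_mem _, by simp⟩ ?_ b
    · obtain ⟨z, hz, rfl⟩ := hall t htS (l * t⁻¹) b (by rwa [inv_mul_cancel_right])
      exact ⟨_, Submodule.subset_span ⟨_, z, hz, rfl⟩, rfl⟩
    · rintro x y ⟨v, hv, hv'⟩ ⟨w, hw, hw'⟩
      exact ⟨v + w, add_mem hv hw, by simp [hv', hw']⟩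
  suffices hex : ∃ c : F, ∀ w ∈ Submodule.span F
      {w : A × A | ∃ l, ∃ z ∈ relations 𝓑 p S l, w = (p (z t), p (z s))}, w.2 = c • w.1 by
    obtain ⟨c, hc⟩ := hex
    rintro _ ⟨b, hb, rfl⟩
    obtain ⟨z, hz, rfl⟩ := hall s hsS k b hb
    have : p (z s) = c • p (z t) := hc _ (Submodule.subset_span ⟨_, z, hz, rfl⟩)
    rw [this]
    exact Submodule.smul_mem _ c ⟨_, hz.1 t htS, rfl⟩
  refine hA.exists_smul _ ?_ ?_ ?_
  · intro w hw a
    obtain ⟨b, rfl⟩ := hsurj a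
    refine h.toIsDecomp.induction (P := fun b => (p b * w.1, p b * w.2) ∈ Submodule.span F
      {w : A × A | ∃ l, ∃ z ∈ relations 𝓑 p S l, w = (p (z t), p (z s))} ∧
      (w.1 * p b, w.2 * p b) ∈ Submodule.span F
      {w : A × A | ∃ l, ∃ z ∈ relations 𝓑 p S l, w = (p (z t), p (z s))})
      (fun l b hb => ?_) ?_ ?_ b
    · refine Submodule.span_induction (p := fun w _ => (p b * w.1, p b * w.2) ∈ Submodule.span F
        {w : A × A | ∃ l, ∃ z ∈ relations 𝓑 p S l, w = (p (z t), p (z s))} ∧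
        (w.1 * p b, w.2 * p b) ∈ Submodule.span F
        {w : A × A | ∃ l, ∃ z ∈ relations 𝓑 p S l, w = (p (z t), p (z s))}) ?_ ?_ ?_ ?_ hw
      · rintro _ ⟨l', z, hz, rfl⟩
        simp only [← hp]
        exact ⟨Submodule.subset_span ⟨_, _, (relations_mul h hp hz hb).1, rfl⟩,
          Submodule.subset_span ⟨_, _, (relations_mul h hp hz hb).2, rfl⟩⟩
      · simp only [Prod.fst_zero, Prod.snd_zero, mul_zero, zero_mul]
        exact ⟨zero_mem _, zero_mem _⟩
      · rintro x y - - hx hy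
        simp only [Prod.fst_add, Prod.snd_add, mul_add, add_mul]
        exact ⟨add_mem hx.1 hy.1, add_mem hx.2 hy.2⟩
      · rintro c x - hx
        simp only [Prod.smul_fst, Prod.smul_snd, mul_smul_comm, smul_mul_assoc]
        exact ⟨Submodule.smul_mem _ c hx.1, Submodule.smul_mem _ c hx.2⟩
    · simp only [map_zero, zero_mul, mul_zero]
      exact ⟨zero_mem _, zero_mem _⟩
    · intro x y hx hy
      simp only [map_add, add_mul, mul_add]
      exact ⟨add_mem hx.1 hy.1, add_mem hx.2 hy.2⟩
  · intro w hw w' hw'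
    refine Submodule.span_induction₂ (p := fun w w' _ _ => w.1 * w'.2 = w.2 * w'.1)
      ?_ ?_ ?_ ?_ ?_ ?_ ?_ hw hw'
    · rintro _ _ ⟨l, z, hz, rfl⟩ ⟨l', z', hz', rfl⟩
      -- The relations `z t * z' _` and `z _ * z' t` have the same degree and the same `t`-th
      -- coordinate, so by minimality they also agree at `s`.
      have h1 := (relations_mul h hp hz' (hz.1 t htS)).1
      have h2 := (relations_mul h hp hz (hz'.1 t htS)).2
      have e : l' * t * l = l * t * l' := by rw [mul_right_comm, mul_comm l' l, mul_right_comm]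
      rw [e] at h2
      have h3 := hmin _ _ (sub_mem h1 h2) t htS (sub_self _) s hsS
      simp only [Pi.sub_apply, sub_eq_zero] at h3
      rw [← hp, ← hp, h3]
    · simp
    · simp
    · intro x y z _ _ _ hx hy; simp [add_mul, hx, hy]
    · intro x y z _ _ _ hx hy; simp [mul_add, hx, hy]
    · intro c x y _ _ hx; simp [smul_mul_assoc, hx]
    · intro c x y _ _ hx; simp [mul_smul_comm, hx]
  · intro a
    obtain ⟨w, hw, rfl⟩ := hall' a
    exact ⟨w.2, hw⟩

/-- Homogeneous elements whose degrees are distinct modulo the stabilizer have linearly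
independent images. -/
theorem relations_eq_zero (h : IsGradedFamily 𝓑) (hs : IsGradedSimpleFamily 𝓑)
    (hp : ∀ x y, p (x * y) = p x * p y) (hsurj : Function.Surjective p)
    (hA : IsCentralSimpleAlgebra F A) (n : ℕ) : ∀ S : Finset G, S.card = n →
    (∀ s ∈ S, ∀ t ∈ S, s⁻¹ * t ∈ degreeStabilizer 𝓑 p → s = t) →
    ∀ k, ∀ z ∈ relations 𝓑 p S k, ∀ s ∈ S, z s = 0 := by
  classical
  have hp0 : p ≠ 0 := by
    rintro rfl
    obtain ⟨a, b, hab⟩ := hA.1.1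
    obtain ⟨x, hx⟩ := hsurj (a * b)
    exact hab hx.symm
  induction n with
  | zero =>
    intro S hS _ k z _ s hs
    rw [Finset.card_eq_zero] at hS
    simp [hS] at hs
  | succ n ih =>
    intro S hS hinj k z hz s hsS
    by_contra hne
    -- A relation with vanishing coordinate at `s` is a relation on `S.erase s`, to which the
    -- induction hypothesis applies.
    have hmin : ∀ k, ∀ z ∈ relations 𝓑 p S k, ∀ s ∈ S, z s = 0 → ∀ t ∈ S, z t = 0 := by
      intro k z hz s hsS h0 t ht
      by_cases hts : t = s
      · rw [hts, h0]
      · refine ih (S.erase s) (by rw [Finset.card_erase_of_mem hsS, hS]; rfl)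
          (fun a ha b hb => hinj a (Finset.mem_of_mem_erase ha) b (Finset.mem_of_mem_erase hb)) k z
          ⟨fun a ha => hz.1 a (Finset.mem_of_mem_erase ha), ?_⟩ t (Finset.mem_erase.2 ⟨hts, ht⟩)
        rw [← hz.2, ← Finset.add_sum_erase _ _ hsS, h0, map_zero, zero_add]
    -- The two inclusions of images put `t⁻¹ * s` in the stabilizer, so `S` reduces to `s`; a
    -- relation with one term is excluded by injectivity on components.
    have hsub : ∀ t ∈ S, t = s := by
      intro t ht
      refine hinj t ht s hsS fun g => ?_
      have key := fun {a b : G} (ha : a ∈ S) (hb : b ∈ S) =>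
        map_le_map_of_minimal_relations h hs hp hsurj hA hmin hz hsS hne ha hb (g * t⁻¹)
      have h1 := key ht hsS
      have h2 := key hsS ht
      rw [inv_mul_cancel_right] at h1 h2
      rw [← mul_assoc]
      exact le_antisymm h2 h1
    have hS1 : S = {s} := Finset.eq_singleton_iff_unique_mem.2 ⟨hsS, hsub⟩
    have h2 := hz.2
    rw [hS1, Finset.sum_singleton] at h2
    exact hne (hs.eq_zero_of_map_eq_zero h hp hp0 (hz.1 s hsS) h2)

/-- For independence, each coset is replaced by one representative. These are pairwise incongruent
modulo the stabilizer, so `relations_eq_zero` applies to lifts of the given elements. -/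
theorem isGradedFamily_quotientFamily (h : IsGradedFamily 𝓑) (hs : IsGradedSimpleFamily 𝓑)
    (hp : ∀ x y, p (x * y) = p x * p y) (hsurj : Function.Surjective p)
    (hA : IsCentralSimpleAlgebra F A) : IsGradedFamily (quotientFamily 𝓑 p) where
  indep := by
    classical
    rw [iSupIndep_iff_finsetSum_eq_zero_imp_eq_zero]
    intro T v hv h0
    have hex : ∀ q, ∃ x ∈ 𝓑 (Quotient.out q), q ∈ T → p x = v q := by
      intro q
      by_cases hq : q ∈ T
      · have := hv q hq
        rw [← QuotientGroup.out_eq' q, quotientFamily_mk] at this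
        obtain ⟨x, hx, hxv⟩ := this
        exact ⟨x, hx, fun _ => by rw [hxv, QuotientGroup.out_eq']⟩
      · exact ⟨0, zero_mem _, fun h => absurd h hq⟩
    choose x hx hxv using hex
    intro q hq
    have hinj : Function.Injective (Quotient.out : G ⧸ degreeStabilizer 𝓑 p → G) :=
      Quotient.out_injective
    have := relations_eq_zero h hs hp hsurj hA _ (T.image Quotient.out) rfl (by
      simp only [Finset.mem_image]
      rintro _ ⟨a, ha, rfl⟩ _ ⟨b, hb, rfl⟩ hab
      rw [← QuotientGroup.eq, QuotientGroup.out_eq', QuotientGroup.out_eq'] at hab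
      rw [hab]) 1 (fun g => x (QuotientGroup.mk g)) ⟨by
        simp only [Finset.mem_image]
        rintro _ ⟨a, ha, rfl⟩
        rw [QuotientGroup.out_eq', one_mul]
        exact hx a, by
        rw [Finset.sum_image (fun a _ b _ hab => hinj hab), ← h0]
        refine Finset.sum_congr rfl fun a ha => ?_
        exact (congrArg (fun q => p (x q)) (QuotientGroup.out_eq' a)).trans (hxv a ha)⟩ (Quotient.out q)
        (Finset.mem_image_of_mem _ hq)
    rw [QuotientGroup.out_eq'] at this
    rw [← hxv q hq, this, map_zero]
  iSup_eq_top := by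
    rw [eq_top_iff, ← LinearMap.range_eq_top.2 hsurj, LinearMap.range_eq_map, ← h.iSup_eq_top,
      Submodule.map_iSup]
    exact iSup_le fun g => le_iSup (quotientFamily 𝓑 p) (QuotientGroup.mk g)
  mul_mem := by
    intro q r x y hx hy
    induction q using QuotientGroup.induction_on with | H a => ?_
    induction r using QuotientGroup.induction_on with | H b => ?_
    rw [quotientFamily_mk] at hx hy
    obtain ⟨x, hx, rfl⟩ := hx
    obtain ⟨y, hy, rfl⟩ := hy
    exact ⟨x * y, h.mul_mem hx hy, hp x y⟩

end Structure

/-! ### Equivalences from componentwise inclusions -/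

section Equivalences

variable {F : Type*} [Field F] {A : Type*} [NonUnitalNonAssocRing A] [Module F A]
  {B : Type*} [NonUnitalNonAssocRing B] [Module F B]

theorem IsDecomp.map_equiv {ι κ : Type*} {𝒜 : ι → Submodule F A} {ℬ : κ → Submodule F B}
    (h𝒜 : IsDecomp 𝒜) (hℬ : IsDecomp ℬ) (e : A ≃ₗ[F] B) (β : ι ≃ κ)
    (hle : ∀ i, ∀ x ∈ 𝒜 i, e x ∈ ℬ (β i)) (i : ι) :
    (𝒜 i).map (e : A →ₗ[F] B) = ℬ (β i) := by
  have h1 : (fun k => (𝒜 (β.symm k)).map (e : A →ₗ[F] B)) = ℬ := by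
    refine hℬ.eq_of_le ?_ ?_
    · rintro k _ ⟨x, hx, rfl⟩
      have := hle _ x hx
      rwa [Equiv.apply_symm_apply] at this
    · rw [← Submodule.map_iSup, Equiv.iSup_comp (g := 𝒜) β.symm, h𝒜.iSup_eq_top,
        Submodule.map_top, LinearEquiv.range]
  have := congrFun h1 (β i)
  rwa [Equiv.symm_apply_apply] at this

theorem isEquivalence_support {ι κ : Type*} {𝒜 : ι → Submodule F A} {ℬ : κ → Submodule F B}
    {e : A ≃ₗ[F] B} (hmul : ∀ x y, e (x * y) = e x * e y) {β : ι → κ}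
    (he : ∀ i, (𝒜 i).map (e : A →ₗ[F] B) = ℬ (β i)) :
    IsEquivalence (support 𝒜) (support ℬ) e where
  map_mul := hmul
  map_mem := by
    rintro U ⟨hU, i, rfl⟩
    exact ⟨fun h0 => hU (Submodule.map_injective_of_injective (f := (e : A →ₗ[F] B)) e.injective
      (h0.trans (Submodule.map_bot _).symm)), β i, he i⟩

end Equivalences

/-! ### Abstract loops: lifting of maps, translations, graded simplicity -/

section Loops

variable {F : Type*} [Field F] {A L : Type*} [NonUnitalNonAssocRing A] [Module F A]
  [NonUnitalNonAssocRing L] [Module F L] {U V : Type*} [CommGroup U] [CommGroup V]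

/-- An abstract version of the loop algebra: `p` identifies the component of degree `g` of `L`
with the component of degree `π g` of `A`. -/
structure IsLoop (ℒ : U → Submodule F L) (𝒜 : V → Submodule F A) (π : U →* V) (p : L →ₗ[F] A) :
    Prop where
  source : IsGradedFamily ℒ
  target : IsGradedFamily 𝒜
  surj : Function.Surjective π
  map_mul : ∀ x y, p (x * y) = p x * p y
  eq_zero : ∀ g, ∀ x ∈ ℒ g, p x = 0 → x = 0
  map_eq : ∀ g, (ℒ g).map p = 𝒜 (π g)

variable {ℒ : U → Submodule F L} {𝒜 : V → Submodule F A} {π : U →* V} {p : L →ₗ[F] A}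

theorem IsLoop.mem (h : IsLoop ℒ 𝒜 π p) {g : U} {x : L} (hx : x ∈ ℒ g) : p x ∈ 𝒜 (π g) :=
  h.map_eq g ▸ ⟨x, hx, rfl⟩

theorem IsLoop.exists_mem (h : IsLoop ℒ 𝒜 π p) {g : U} {a : A} (ha : a ∈ 𝒜 (π g)) :
    ∃ x ∈ ℒ g, p x = a := by
  rw [← h.map_eq g] at ha
  exact ha

theorem IsLoop.ext (h : IsLoop ℒ 𝒜 π p) {g : U} {x y : L} (hx : x ∈ ℒ g) (hy : y ∈ ℒ g)
    (hxy : p x = p y) : x = y :=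
  sub_eq_zero.1 (h.eq_zero g _ (sub_mem hx hy) (by rw [map_sub, hxy, sub_self]))

theorem IsLoop.surjective (h : IsLoop ℒ 𝒜 π p) : Function.Surjective p := by
  intro a
  refine h.target.toIsDecomp.induction (P := fun a => ∃ x, p x = a) (fun k a ha => ?_)
    ⟨0, map_zero p⟩ ?_ a
  · obtain ⟨g, rfl⟩ := h.surj k
    obtain ⟨x, -, hx⟩ := h.exists_mem ha
    exact ⟨x, hx⟩
  · rintro _ _ ⟨x, rfl⟩ ⟨y, rfl⟩
    exact ⟨x + y, map_add p x y⟩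

theorem IsLoop.exists_section (h : IsLoop ℒ 𝒜 π p) (g : U) :
    ∃ l : A →ₗ[F] L, (∀ a, l a ∈ ℒ g) ∧ ∀ a, p (l a) = h.target.toIsDecomp.proj (π g) a := by
  have hex : ∀ a, ∃ x ∈ ℒ g, p x = h.target.toIsDecomp.proj (π g) a := fun a =>
    h.exists_mem (h.target.toIsDecomp.proj_mem _ a)
  choose l hl hl' using hex
  exact ⟨{
    toFun := l
    map_add' := fun x y => h.ext (hl _) (add_mem (hl _) (hl _)) (by simp [hl'])
    map_smul' := fun c x => h.ext (hl _) (Submodule.smul_mem _ c (hl _)) (by simp [hl']) },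
    hl, hl'⟩

/-- The partial inverse of `p` with values in the component of degree `g`. -/
noncomputable def IsLoop.section (h : IsLoop ℒ 𝒜 π p) (g : U) : A →ₗ[F] L :=
  (h.exists_section g).choose

theorem IsLoop.section_mem (h : IsLoop ℒ 𝒜 π p) (g : U) (a : A) : h.section g a ∈ ℒ g :=
  (h.exists_section g).choose_spec.1 a

theorem IsLoop.map_section (h : IsLoop ℒ 𝒜 π p) (g : U) (a : A) :
    p (h.section g a) = h.target.toIsDecomp.proj (π g) a :=
  (h.exists_section g).choose_spec.2 a

theorem IsLoop.map_section_of_mem (h : IsLoop ℒ 𝒜 π p) {g : U} {a : A} (ha : a ∈ 𝒜 (π g)) :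
    p (h.section g a) = a := by
  rw [h.map_section, h.target.toIsDecomp.proj_of_mem ha]

theorem IsLoop.section_map (h : IsLoop ℒ 𝒜 π p) {g : U} {x : L} (hx : x ∈ ℒ g) :
    h.section g (p x) = x :=
  h.ext (h.section_mem g _) hx (h.map_section_of_mem (h.mem hx))

section Hom

variable {A' L' : Type*} [NonUnitalNonAssocRing A'] [Module F A']
  [NonUnitalNonAssocRing L'] [Module F L'] {U' V' : Type*} [CommGroup U'] [CommGroup V']
  {ℒ' : U' → Submodule F L'} {𝒜' : V' → Submodule F A'} {π' : U' →* V'} {p' : L' →ₗ[F] A'}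

/-- On each component `φ ∘ p` is lifted through `p'`, which is bijective from degree `β g` onto
degree `π' (β g)`. -/
theorem IsLoop.exists_linearMap (h : IsLoop ℒ 𝒜 π p) (h' : IsLoop ℒ' 𝒜' π' p') (φ : A →ₗ[F] A')
    (β : U → U') (hβ : ∀ g, ∀ a ∈ 𝒜 (π g), φ a ∈ 𝒜' (π' (β g))) :
    ∃ Ψ : L →ₗ[F] L', ∀ g, ∀ x ∈ ℒ g, Ψ x ∈ ℒ' (β g) ∧ p' (Ψ x) = φ (p x) := by
  obtain ⟨Ψ, hΨ⟩ := h.source.toIsDecomp.exists_linearMap fun g =>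
    h'.section (β g) ∘ₗ φ ∘ₗ p ∘ₗ (ℒ g).subtype
  refine ⟨Ψ, fun g x hx => ?_⟩
  have := hΨ g ⟨x, hx⟩
  simp only [LinearMap.comp_apply, Submodule.subtype_apply] at this
  rw [this]
  exact ⟨h'.section_mem _ _, h'.map_section_of_mem (hβ g _ (h.mem hx))⟩

/-- Both `φ` and its inverse lift. That the lifts are mutually inverse and multiplicative is checked
on homogeneous elements after projection, where nothing is lost. -/
theorem IsLoop.exists_equiv (h : IsLoop ℒ 𝒜 π p) (h' : IsLoop ℒ' 𝒜' π' p') (φ : A ≃ₗ[F] A')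
    (hφ : ∀ x y, φ (x * y) = φ x * φ y) (β : U ≃* U')
    (hβ : ∀ g, (𝒜 (π g)).map (φ : A →ₗ[F] A') = 𝒜' (π' (β g))) :
    GradingEquivalent (support ℒ) (support ℒ') := by
  obtain ⟨Ψ, hΨ⟩ := h.exists_linearMap h' φ β fun g a ha => hβ g ▸ ⟨a, ha, rfl⟩
  obtain ⟨Θ, hΘ⟩ := h'.exists_linearMap h φ.symm β.symm fun g a ha => by
    have := hβ (β.symm g)
    rw [MulEquiv.apply_symm_apply] at this
    rw [← this] at ha
    obtain ⟨b, hb, rfl⟩ := ha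
    simpa using hb
  have h1 : Ψ ∘ₗ Θ = LinearMap.id := by
    refine h'.source.toIsDecomp.hom_ext fun g x hx => ?_
    obtain ⟨a1, a2⟩ := hΘ g x hx
    obtain ⟨b1, b2⟩ := hΨ _ _ a1
    rw [MulEquiv.apply_symm_apply] at b1
    exact h'.ext b1 hx (by rw [LinearMap.comp_apply, b2, a2]; simp)
  have h2 : Θ ∘ₗ Ψ = LinearMap.id := by
    refine h.source.toIsDecomp.hom_ext fun g x hx => ?_
    obtain ⟨a1, a2⟩ := hΨ g x hx
    obtain ⟨b1, b2⟩ := hΘ _ _ a1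
    rw [MulEquiv.symm_apply_apply] at b1
    exact h.ext b1 hx (by rw [LinearMap.comp_apply, b2, a2]; simp)
  let e : L ≃ₗ[F] L' := LinearEquiv.ofLinearMap Ψ Θ h1 h2
  refine ⟨e, isEquivalence_support ?_
    (h.source.toIsDecomp.map_equiv h'.source.toIsDecomp e β.toEquiv fun g x hx => (hΨ g x hx).1)⟩
  intro x y
  change Ψ (x * y) = Ψ x * Ψ y
  refine h.source.toIsDecomp.induction (P := fun x => Ψ (x * y) = Ψ x * Ψ y) (fun g x hx => ?_)
    (by simp) (fun a b ha hb => by simp [add_mul, ha, hb]) x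
  refine h.source.toIsDecomp.induction (P := fun y => Ψ (x * y) = Ψ x * Ψ y) (fun k y hy => ?_)
    (by simp) (fun a b ha hb => by simp [mul_add, ha, hb]) y
  obtain ⟨a1, a2⟩ := hΨ _ _ hx
  obtain ⟨b1, b2⟩ := hΨ _ _ hy
  obtain ⟨c1, c2⟩ := hΨ _ _ (h.source.mul_mem hx hy)
  rw [_root_.map_mul] at c1
  refine h'.ext c1 (h'.source.mul_mem a1 b1) ?_
  rw [c2, h'.map_mul, a2, b2, h.map_mul]
  exact hφ _ _

end Hom

theorem IsLoop.exists_translation (h : IsLoop ℒ 𝒜 π p) (k : U) (hk : π k = 1) :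
    ∃ c : L →ₗ[F] L, ∀ g, ∀ x ∈ ℒ g, c x ∈ ℒ (g * k) ∧ p (c x) = p x := by
  refine h.exists_linearMap h LinearMap.id (fun g => g * k) fun g a ha => ?_
  rwa [_root_.map_mul, hk, mul_one]

/-- The element of the centroid of `L` defined by an element of the kernel of `π`. -/
noncomputable def IsLoop.translation (h : IsLoop ℒ 𝒜 π p) (k : π.ker) : L →ₗ[F] L :=
  (h.exists_translation k.1 k.2).choose

theorem IsLoop.translation_mem (h : IsLoop ℒ 𝒜 π p) (k : π.ker) {g : U} {x : L} (hx : x ∈ ℒ g) :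
    h.translation k x ∈ ℒ (g * k.1) :=
  ((h.exists_translation k.1 k.2).choose_spec g x hx).1

theorem IsLoop.map_translation (h : IsLoop ℒ 𝒜 π p) (k : π.ker) (x : L) :
    p (h.translation k x) = p x := by
  have : p ∘ₗ h.translation k = p := h.source.toIsDecomp.hom_ext fun g x hx =>
    ((h.exists_translation k.1 k.2).choose_spec g x hx).2
  exact LinearMap.congr_fun this x

theorem IsLoop.translation_mul (h : IsLoop ℒ 𝒜 π p) (k : π.ker) (x y : L) :
    h.translation k (x * y) = h.translation k x * y ∧
      h.translation k (x * y) = x * h.translation k y := by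
  refine h.source.toIsDecomp.induction (P := fun x => h.translation k (x * y) =
    h.translation k x * y ∧ h.translation k (x * y) = x * h.translation k y) (fun g x hx => ?_)
    (by simp) (fun a b ha hb => by
      simp only [add_mul, map_add]
      exact ⟨by rw [ha.1, hb.1], by rw [ha.2, hb.2]⟩) x
  refine h.source.toIsDecomp.induction (P := fun y => h.translation k (x * y) =
    h.translation k x * y ∧ h.translation k (x * y) = x * h.translation k y) (fun l y hy => ?_)
    (by simp) (fun a b ha hb => by
      simp only [mul_add, map_add]
      exact ⟨by rw [ha.1, hb.1], by rw [ha.2, hb.2]⟩) y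
  have h1 := h.translation_mem k (h.source.mul_mem hx hy)
  refine ⟨h.ext h1 (mul_right_comm g l k.1 ▸ h.source.mul_mem (h.translation_mem k hx) hy) ?_,
    h.ext h1 (mul_assoc g l k.1 ▸ h.source.mul_mem hx (h.translation_mem k hy)) ?_⟩
  · rw [h.map_translation, h.map_mul, h.map_mul, h.map_translation]
  · rw [h.map_translation, h.map_mul, h.map_mul, h.map_translation]

theorem IsLoop.translation_comp (h : IsLoop ℒ 𝒜 π p) (k l : π.ker) :
    h.translation k ∘ₗ h.translation l = h.translation (k * l) := by
  refine h.source.toIsDecomp.hom_ext fun g x hx => ?_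
  refine h.ext (h.translation_mem k (h.translation_mem l hx)) ?_ ?_
  · rw [mul_assoc, mul_comm l.1]
    exact h.translation_mem (k * l) hx
  · rw [LinearMap.comp_apply, h.map_translation, h.map_translation, h.map_translation]

theorem IsLoop.translation_one (h : IsLoop ℒ 𝒜 π p) : h.translation 1 = LinearMap.id := by
  refine h.source.toIsDecomp.hom_ext fun g x hx => ?_
  have := h.translation_mem 1 hx
  rw [OneMemClass.coe_one, mul_one] at this
  exact h.ext this hx (h.map_translation _ _)

/-- Elements of the component of degree `g * k` with `k` in the kernel are translates. -/
theorem IsLoop.translation_section (h : IsLoop ℒ 𝒜 π p) {g : U} (k : π.ker) {x : L}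
    (hx : x ∈ ℒ (g * k.1)) : h.translation k (h.section g (p x)) = x := by
  refine h.ext (h.translation_mem k (h.section_mem g _)) hx ?_
  rw [h.map_translation, h.map_section_of_mem]
  have := h.mem hx
  rwa [_root_.map_mul, k.2, mul_one] at this

variable [IsScalarTower F A A] [SMulCommClass F A A]

/-- Loop algebras of simple algebras are graded-simple. -/
theorem IsLoop.isGradedSimpleFamily (h : IsLoop ℒ 𝒜 π p) (hA : IsSimpleAlgebra F A) :
    IsGradedSimpleFamily ℒ := by
  constructor
  · obtain ⟨a, b, hab⟩ := hA.1
    obtain ⟨x, rfl⟩ := h.surjective a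
    obtain ⟨y, rfl⟩ := h.surjective b
    exact ⟨x, y, fun h0 => hab (by rw [← h.map_mul, h0, map_zero])⟩
  intro 𝒬 hle hmul
  -- The elements of `A` all of whose homogeneous lifts, in every degree of `U`, belong to the given
  -- graded ideal.
  let J : Submodule F A := ⨅ g, (𝒬 g).comap (h.section g)
  have hsec : ∀ {g l : U} {y : L}, y ∈ ℒ l → ∀ a, h.section g (a * p y) =
      h.section (g * l⁻¹) a * y ∧ h.section g (p y * a) = y * h.section (g * l⁻¹) a := by
    intro g l y hy a
    have hp : h.target.toIsDecomp.proj (π g) (a * p y) =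
          h.target.toIsDecomp.proj (π (g * l⁻¹)) a * p y ∧
        h.target.toIsDecomp.proj (π g) (p y * a) =
          p y * h.target.toIsDecomp.proj (π (g * l⁻¹)) a := by
      refine h.target.toIsDecomp.induction (P := fun a =>
        h.target.toIsDecomp.proj (π g) (a * p y) =
          h.target.toIsDecomp.proj (π (g * l⁻¹)) a * p y ∧
        h.target.toIsDecomp.proj (π g) (p y * a) =
          p y * h.target.toIsDecomp.proj (π (g * l⁻¹)) a) (fun k a ha => ?_) (by simp)
        (fun a b ha hb => by simp [add_mul, mul_add, ha.1, hb.1, ha.2, hb.2]) a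
      have m1 := h.target.mul_mem ha (h.mem hy)
      have m2 := h.target.mul_mem (h.mem hy) ha
      rw [mul_comm] at m2
      by_cases hk : k = π (g * l⁻¹)
      · have e : k * π l = π g := by rw [hk, ← _root_.map_mul, inv_mul_cancel_right]
        rw [e] at m1 m2
        rw [h.target.toIsDecomp.proj_of_mem m1, h.target.toIsDecomp.proj_of_mem m2,
          h.target.toIsDecomp.proj_of_mem (hk ▸ ha)]
        exact ⟨rfl, rfl⟩
      · have e : k * π l ≠ π g := by
          intro e
          apply hk
          rw [_root_.map_mul, ← e, map_inv, mul_inv_cancel_right]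
        rw [h.target.toIsDecomp.proj_of_mem_ne m1 e, h.target.toIsDecomp.proj_of_mem_ne m2 e,
          h.target.toIsDecomp.proj_of_mem_ne ha hk, zero_mul, mul_zero]
        exact ⟨rfl, rfl⟩
    have e : g * l⁻¹ * l = g := inv_mul_cancel_right g l
    constructor
    · have m := h.source.mul_mem (h.section_mem (g * l⁻¹) a) hy
      rw [e] at m
      refine h.ext (h.section_mem g _) m ?_
      rw [h.map_section, h.map_mul, h.map_section, hp.1]
    · have m := h.source.mul_mem hy (h.section_mem (g * l⁻¹) a)
      rw [mul_comm l, e] at m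
      refine h.ext (h.section_mem g _) m ?_
      rw [h.map_section, h.map_mul, h.map_section, hp.2]
  have hJ : ∀ {a}, a ∈ J ↔ ∀ g, h.section g a ∈ 𝒬 g := by
    intro a
    simp [J, Submodule.mem_iInf]
  have hideal : IsIdeal J := by
    intro b a ha
    obtain ⟨y, rfl⟩ := h.surjective b
    refine h.source.toIsDecomp.induction (P := fun y => p y * a ∈ J ∧ a * p y ∈ J)
      (fun l y hy => ?_) (by simp) (fun y z hy hz => ?_) y
    · simp only [hJ]
      refine ⟨fun g => ?_, fun g => ?_⟩
      · rw [(hsec hy a).2]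
        have := (hmul l (g * l⁻¹) _ _ hy (hJ.1 ha (g * l⁻¹))).1
        rwa [mul_comm l, inv_mul_cancel_right] at this
      · rw [(hsec hy a).1]
        have := (hmul l (g * l⁻¹) _ _ hy (hJ.1 ha (g * l⁻¹))).2
        rwa [mul_comm l, inv_mul_cancel_right] at this
    · rw [map_add, add_mul, mul_add]
      exact ⟨add_mem hy.1 hz.1, add_mem hy.2 hz.2⟩
  rcases hA.2 J hideal with h0 | h1
  -- If `y` is in the graded ideal, all lifts of `p y * a` and `a * p y` are products with `y`, so
  -- these elements lie in `J = 0`. Thus `p y` annihilates `A`.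
  · left
    intro l
    rw [Submodule.eq_bot_iff]
    intro y hy
    refine h.eq_zero l y (hle l hy) (hA.eq_zero_of_mul_eq_zero fun a => ?_)
    have key : p y * a ∈ J ∧ a * p y ∈ J := by
      simp only [hJ]
      refine ⟨fun g => ?_, fun g => ?_⟩
      · rw [(hsec (hle l hy) a).2]
        have := (hmul (g * l⁻¹) l _ _ (h.section_mem (g * l⁻¹) a) hy).2
        rwa [inv_mul_cancel_right] at this
      · rw [(hsec (hle l hy) a).1]
        have := (hmul (g * l⁻¹) l _ _ (h.section_mem (g * l⁻¹) a) hy).1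
        rwa [inv_mul_cancel_right] at this
    rw [h0] at key
    exact key
  · right
    refine fun g => le_antisymm (hle g) fun x hx => ?_
    rw [← h.section_map hx]
    exact hJ.1 (h1 ▸ trivial : p x ∈ J) g

end Loops

/-! ### The concrete loop algebra as an abstract loop -/

section LoopAlgebras

variable {F : Type w} [Field F] {A : Type u} [NonUnitalNonAssocRing A] [Module F A]
  {G : Type v} {G' : Type v} [CommGroup G] [CommGroup G']

/-- The coefficient of an element of the monoid algebra, with values in `A`. -/
noncomputable def tensorCoeff (F : Type w) [Field F] (A : Type u) [NonUnitalNonAssocRing A]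
    [Module F A] {G : Type v} (g : G) : A ⊗[F] MonoidAlgebra F G →ₗ[F] A :=
  TensorProduct.lift (LinearMap.flip
    { toFun := fun f => f.coeff g • LinearMap.id
      map_add' := fun f f' => by rw [MonoidAlgebra.coeff_add, Finsupp.add_apply, add_smul]
      map_smul' := fun c f => by
        rw [MonoidAlgebra.coeff_smul, Finsupp.smul_apply, smul_assoc]; rfl })

theorem tensorCoeff_tmul_single {G : Type v} [DecidableEq G] (g h : G) (a : A) :
    tensorCoeff F A g (a ⊗ₜ MonoidAlgebra.single h 1) = if h = g then a else 0 := by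
  simp only [tensorCoeff, TensorProduct.lift.tmul, LinearMap.flip_apply, LinearMap.coe_mk,
    AddHom.coe_mk, MonoidAlgebra.coeff_single, Finsupp.single_apply]
  split_ifs <;> simp

/-- The evaluation at the augmentation of the group algebra. -/
noncomputable def tensorAug (F : Type w) [Field F] (A : Type u) [NonUnitalNonAssocRing A]
    [Module F A] (G : Type v) [CommGroup G] : A ⊗[F] MonoidAlgebra F G →ₗ[F] A :=
  TensorProduct.lift ((LinearMap.lsmul F A ∘ₗ
    (MonoidAlgebra.lift F F G (1 : G →* F)).toLinearMap).flip)

theorem tensorAug_tmul (a : A) (f : MonoidAlgebra F G) :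
    tensorAug F A G (a ⊗ₜ f) = MonoidAlgebra.lift F F G (1 : G →* F) f • a := by
  simp [tensorAug]

theorem tensorAug_tmul_single (a : A) (g : G) :
    tensorAug F A G (a ⊗ₜ MonoidAlgebra.single g 1) = a := by
  simp [tensorAug_tmul]

variable [IsScalarTower F A A] [SMulCommClass F A A]

theorem tensorAug_mul (x y : A ⊗[F] MonoidAlgebra F G) :
    tensorAug F A G (x * y) = tensorAug F A G x * tensorAug F A G y := by
  induction x with
  | zero => simp
  | add x x' hx hx' => rw [add_mul, map_add, map_add, hx, hx', add_mul]
  | tmul a f =>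
    induction y with
    | zero => simp
    | add y y' hy hy' => rw [mul_add, map_add, map_add, hy, hy', mul_add]
    | tmul b f' =>
      rw [Algebra.TensorProduct.tmul_mul_tmul, tensorAug_tmul, tensorAug_tmul, tensorAug_tmul,
        map_mul, smul_mul_smul_comm]

variable {Γ : Set (Submodule F A)} {δ : Γ → G'} (hδ : IsGradingBy Γ δ) (π : G →* G')

theorem loopInclusion_injective : Function.Injective (loopInclusion hδ π) :=
  Subtype.val_injective

theorem loopInclusion_mul (x y : LoopAlgebra hδ π) :
    loopInclusion hδ π (x * y) = loopInclusion hδ π x * loopInclusion hδ π y := rfl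

/-- The homogeneous components of the loop algebra. -/
noncomputable def loopFamily (g : G) : Submodule F (LoopAlgebra hδ π) :=
  (loopComponent δ π g).comap (loopInclusion hδ π)

theorem support_loopFamily : support (loopFamily hδ π) = loopGrading hδ π := rfl

/-- The projection of the loop algebra of `A` on `A`. -/
noncomputable def loopProjection : LoopAlgebra hδ π →ₗ[F] A :=
  tensorAug F A G ∘ₗ loopInclusion hδ π

theorem range_loopInclusion :
    LinearMap.range (loopInclusion hδ π) = ⨆ g, loopComponent δ π g :=
  Submodule.range_subtype _

theorem map_loopFamily (g : G) :
    (loopFamily hδ π g).map (loopInclusion hδ π) = loopComponent δ π g := by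
  rw [loopFamily, Submodule.map_comap_eq, range_loopInclusion]
  exact inf_eq_right.2 (le_iSup (loopComponent δ π) g)

theorem isGradedFamily_loopFamily : IsGradedFamily (loopFamily hδ π) where
  indep := by
    classical
    rw [iSupIndep_iff_finsetSum_eq_zero_imp_eq_zero]
    intro s v hv h0 g hg
    have h1 : tensorCoeff F A g (loopInclusion hδ π (∑ i ∈ s, v i)) = 0 := by simp [h0]
    rw [map_sum, map_sum, Finset.sum_eq_single_of_mem g hg] at h1
    · obtain ⟨a, ha, hav⟩ := hv g hg
      simp only [LinearMap.flip_apply, TensorProduct.mk_apply] at hav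
      rw [← hav, tensorCoeff_tmul_single, if_pos rfl] at h1
      rw [h1, TensorProduct.zero_tmul] at hav
      exact loopInclusion_injective hδ π (hav.symm.trans (map_zero _).symm)
    · intro k hk hkg
      obtain ⟨a, ha, hav⟩ := hv k hk
      simp only [LinearMap.flip_apply, TensorProduct.mk_apply] at hav
      rw [← hav, tensorCoeff_tmul_single, if_neg hkg]
  iSup_eq_top := by
    apply Submodule.map_injective_of_injective (loopInclusion_injective hδ π)
    rw [Submodule.map_iSup, Submodule.map_top, range_loopInclusion]
    exact iSup_congr fun g => map_loopFamily hδ π g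
  mul_mem := by
    rintro g h x y ⟨a, ha, hax⟩ ⟨b, hb, hby⟩
    refine ⟨a * b, ?_, ?_⟩
    · rw [map_mul]
      exact mul_mem_component hδ ha hb
    · rw [loopInclusion_mul, ← hax, ← hby]
      simp [MonoidAlgebra.single_mul_single]

/-- The augmentation of the group algebra maps `a ⊗ g` to `a`, so it is injective on each component.
From here on the tensor product is only used through `IsLoop`. -/
theorem isLoop_loopFamily (hπ : Function.Surjective π) :
    IsLoop (loopFamily hδ π) (component δ) π (loopProjection hδ π) where
  source := isGradedFamily_loopFamily hδ π
  target := hδ.isGradedFamily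
  surj := hπ
  map_mul := fun x y => by
    simp only [loopProjection, LinearMap.comp_apply, loopInclusion_mul, tensorAug_mul]
  eq_zero := by
    rintro g x ⟨a, ha, hax⟩ h0
    simp only [LinearMap.flip_apply, TensorProduct.mk_apply] at hax
    rw [loopProjection, LinearMap.comp_apply, ← hax, tensorAug_tmul_single] at h0
    rw [h0, TensorProduct.zero_tmul] at hax
    exact loopInclusion_injective hδ π (hax.symm.trans (map_zero _).symm)
  map_eq := by
    intro g
    rw [loopProjection, Submodule.map_comp, map_loopFamily, loopComponent, ← Submodule.map_comp]
    have e : tensorAug F A G ∘ₗ (TensorProduct.mk F A (MonoidAlgebra F G)).flip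
        (MonoidAlgebra.single g 1) = LinearMap.id :=
      LinearMap.ext fun a => tensorAug_tmul_single a g
    rw [e, Submodule.map_id]

end LoopAlgebras

/-! ### Central simple quotients of a loop are twists by characters -/

section Characters

/-- The units of an algebraically closed field form a divisible, hence injective, abelian group. -/
theorem exists_extension_units {F : Type*} [Field F] [IsAlgClosed F] {U : Type*} [CommGroup U]
    (H : Subgroup U) (χ : H →* Fˣ) : ∃ ψ : U →* Fˣ, ∀ h : H, ψ h = χ h := by
  have hsurj : ∀ {n : ℕ}, n ≠ 0 → Function.Surjective fun a : Fˣ => a ^ n := by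
    intro n hn a
    obtain ⟨z, hz⟩ := IsAlgClosed.exists_pow_nat_eq (a : F) (Nat.pos_of_ne_zero hn)
    have hz0 : z ≠ 0 := by
      rintro rfl
      rw [zero_pow hn] at hz
      exact a.ne_zero hz.symm
    exact ⟨Units.mk0 z hz0, Units.ext (by simpa using hz)⟩
  let : DivisibleBy (Additive Fˣ) ℕ := divisibleByOfSMulRightSurj (Additive Fˣ) ℕ
    fun {n} hn a => hsurj hn a.toMul
  let : DivisibleBy (Additive Fˣ) ℤ := AddGroup.divisibleByIntOfDivisibleByNat (Additive Fˣ)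
  obtain ⟨ψ, hψ⟩ := (Module.Baer.of_divisible (Additive Fˣ)).extension_property_addMonoidHom
    (MonoidHom.toAdditive H.subtype) (fun a b hab => Subtype.ext hab) (MonoidHom.toAdditive χ)
  refine ⟨MonoidHom.toAdditive.symm ψ, fun h => ?_⟩
  exact DFunLike.congr_fun hψ (Additive.ofMul h)

variable {F : Type*} [Field F] {A L : Type*} [NonUnitalNonAssocRing A] [Module F A]
  [NonUnitalNonAssocRing L] [Module F L] {U V : Type*} [CommGroup U] [CommGroup V]
  {ℒ : U → Submodule F L} {𝒜 : V → Submodule F A} {π : U →* V} {p : L →ₗ[F] A}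
  {A' : Type*} [NonUnitalNonAssocRing A'] [Module F A'] [IsScalarTower F A' A']
  [SMulCommClass F A' A']

/-- A translation lies in the centroid of `L`. The pairs `(q x, q (T x))` thus satisfy the
conditions of `IsCentralSimpleAlgebra.exists_smul`, so `T` acts through `q` as a scalar,
multiplicatively in the kernel element. -/
theorem IsLoop.exists_character (h : IsLoop ℒ 𝒜 π p) (hA' : IsCentralSimpleAlgebra F A')
    {q : L →ₗ[F] A'} (hq : ∀ x y, q (x * y) = q x * q y) (hqs : Function.Surjective q) :
    ∃ χ : π.ker →* Fˣ, ∀ k x, q (h.translation k x) = (χ k : F) • q x := by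
  have hex : ∀ k, ∃ c : F, ∀ x, q (h.translation k x) = c • q x := by
    intro k
    obtain ⟨c, hc⟩ := hA'.exists_smul (LinearMap.range (q.prod (q ∘ₗ h.translation k))) (by
      rintro _ ⟨x, rfl⟩ a
      obtain ⟨y, rfl⟩ := hqs a
      refine ⟨⟨y * x, ?_⟩, ⟨x * y, ?_⟩⟩
      · simp [hq, (h.translation_mul k y x).2]
      · simp [hq, (h.translation_mul k x y).1]) (by
      rintro _ ⟨x, rfl⟩ _ ⟨y, rfl⟩
      change q x * q (h.translation k y) = q (h.translation k x) * q y
      rw [← hq, ← hq, ← (h.translation_mul k x y).1, (h.translation_mul k x y).2]) (by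
      intro a
      obtain ⟨x, rfl⟩ := hqs a
      exact ⟨_, x, rfl⟩)
    exact ⟨c, fun x => hc _ ⟨x, rfl⟩⟩
  choose c hc using hex
  obtain ⟨a, b, hab⟩ := hA'.1.1
  obtain ⟨x, hx⟩ := hqs (a * b)
  rw [← hx] at hab
  have hinj : ∀ {s t : F}, s • q x = t • q x → s = t := fun hst => smul_left_injective F hab hst
  refine ⟨MonoidHom.toHomUnits { toFun := c, map_one' := ?_, map_mul' := ?_ }, hc⟩
  · apply hinj
    rw [← hc, h.translation_one, one_smul, LinearMap.id_apply]
  · intro k l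
    apply hinj
    rw [← hc, ← h.translation_comp, LinearMap.comp_apply, hc, hc, smul_smul]

/-- Up to a character of the whole group and an isomorphism, `p` is the only homomorphism onto a
central simple algebra. The character of `π.ker` given by the translations is extended to `χ` on
`U`; then `χ(g)⁻¹ • q`, composed with the lift to degree `g`, depends only on `π g` and defines `φ`.
-/
theorem IsLoop.exists_equiv_of_surjective [IsAlgClosed F] (h : IsLoop ℒ 𝒜 π p)
    (hA : IsSimpleAlgebra F A) (hA' : IsCentralSimpleAlgebra F A')
    {q : L →ₗ[F] A'} (hq : ∀ x y, q (x * y) = q x * q y) (hqs : Function.Surjective q) :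
    ∃ (χ : U →* Fˣ) (φ : A ≃ₗ[F] A'), (∀ a b, φ (a * b) = φ a * φ b) ∧
      ∀ g, ∀ x ∈ ℒ g, q x = (χ g : F) • φ (p x) := by
  obtain ⟨χ₀, hχ₀⟩ := h.exists_character hA' hq hqs
  obtain ⟨χ, hχ⟩ := exists_extension_units _ χ₀
  choose σ hσ using h.surj
  obtain ⟨φ, hφ⟩ := h.target.toIsDecomp.exists_linearMap fun v =>
    ((χ (σ v))⁻¹ : Fˣ) • (q ∘ₗ h.section (σ v) ∘ₗ (𝒜 v).subtype)
  have key : ∀ g, ∀ x ∈ ℒ g, q x = (χ g : F) • φ (p x) := by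
    intro g x hx
    have h1 := hφ (π g) ⟨p x, h.mem hx⟩
    simp only [LinearMap.smul_apply, LinearMap.comp_apply, Submodule.subtype_apply] at h1
    -- The element of the kernel by which `g` differs from the chosen representative of its class:
    -- `x` is the translate by `k` of the lift of `p x` in degree `σ (π g)`.
    let k : π.ker := ⟨(σ (π g))⁻¹ * g, by
      rw [MonoidHom.mem_ker, _root_.map_mul, map_inv, hσ, inv_mul_cancel]⟩
    have hk : σ (π g) * k.1 = g := mul_inv_cancel_left _ _
    have h2 := h.translation_section (g := σ (π g)) k (x := x) (hk.symm ▸ hx)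
    rw [h1, ← h2, h.map_translation, h.map_section, hχ₀, ← hχ]
    have h3 : (χ g : Fˣ) = χ k * χ (σ (π g)) := by rw [← _root_.map_mul, mul_comm, hk]
    rw [h.target.toIsDecomp.proj_of_mem (by rw [hσ]; exact h.mem hx), Units.smul_def, smul_smul,
      ← Units.val_mul, h3, mul_inv_cancel_right]
  have hmul : ∀ a b, φ (a * b) = φ a * φ b := by
    intro a b
    obtain ⟨x, rfl⟩ := h.surjective a
    obtain ⟨y, rfl⟩ := h.surjective b
    refine h.source.toIsDecomp.induction (P := fun x => φ (p x * p y) = φ (p x) * φ (p y))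
      (fun g x hx => ?_) (by simp) (fun a b ha hb => by simp [add_mul, ha, hb]) x
    refine h.source.toIsDecomp.induction (P := fun y => φ (p x * p y) = φ (p x) * φ (p y))
      (fun k y hy => ?_) (by simp) (fun a b ha hb => by simp [mul_add, ha, hb]) y
    have h1 := key _ _ (h.source.mul_mem hx hy)
    rw [hq, key _ _ hx, key _ _ hy, h.map_mul, smul_mul_smul_comm, _root_.map_mul,
      Units.val_mul] at h1
    exact (smul_right_injective A' (mul_ne_zero (χ g).ne_zero (χ k).ne_zero) h1).symm
  have hsurj : Function.Surjective φ := by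
    intro a
    obtain ⟨x, rfl⟩ := hqs a
    refine h.source.toIsDecomp.induction (P := fun x => ∃ b, φ b = q x) (fun g x hx => ?_)
      ⟨0, by simp⟩ ?_ x
    · exact ⟨(χ g : F) • p x, by rw [map_smul, key g x hx]⟩
    · rintro x y ⟨b, hb⟩ ⟨c, hc⟩
      exact ⟨b + c, by rw [map_add, map_add, hb, hc]⟩
  have h0 : φ ≠ 0 := by
    rintro rfl
    obtain ⟨a, b, hab⟩ := hA'.1.1
    obtain ⟨x, hx⟩ := hsurj (a * b)
    exact hab hx.symm
  exact ⟨χ, LinearEquiv.ofBijective φ ⟨hA.injective hmul h0, hsurj⟩, hmul, key⟩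

end Characters

/-! ### Equivalences and universal groups -/

section UniversalEquivalence

variable {F : Type*} [Field F] {A : Type*} [NonUnitalNonAssocRing A] [Module F A]
  {B : Type*} [NonUnitalNonAssocRing B] [Module F B]
  {Γ : Set (Submodule F A)} {Γ' : Set (Submodule F B)}
  {G G' : Type*} [CommGroup G] [CommGroup G'] {δ : Γ → G} {δ' : Γ' → G'}

theorem IsEquivalence.exists_map_eq {φ : A ≃ₗ[F] B} (hφ : IsEquivalence Γ Γ' φ)
    (hΓ : IsGrading Γ) (hΓ' : IsGrading Γ') {W : Submodule F B} (hW : W ∈ Γ') :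
    ∃ V ∈ Γ, V.map (φ : A →ₗ[F] B) = W := by
  have h : Submodule.map (φ : A →ₗ[F] B) '' Γ = Γ' := by
    refine hΓ'.eq_of_subset ?_ ?_
    · rintro _ ⟨V, hV, rfl⟩
      exact hφ.map_mem V hV
    · rw [sSup_image]
      refine ((Submodule.orderIsoMapComap φ).map_sSup Γ).symm.trans ?_
      rw [hΓ.sSup_eq_top]
      exact OrderIso.map_top _
  rw [← h] at hW
  exact hW

theorem IsEquivalence.symm {φ : A ≃ₗ[F] B} (hφ : IsEquivalence Γ Γ' φ)
    (hΓ : IsGrading Γ) (hΓ' : IsGrading Γ') : IsEquivalence Γ' Γ φ.symm where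
  map_mul := fun x y => by
    apply φ.injective
    rw [hφ.map_mul]
    simp
  map_mem := fun W hW => by
    obtain ⟨V, hV, rfl⟩ := hφ.exists_map_eq hΓ hΓ' hW
    rw [← Submodule.map_comp, LinearEquiv.symm_comp, Submodule.map_id]
    exact hV

theorem IsEquivalence.exists_universalGroup_hom {φ : A ≃ₗ[F] B} (hφ : IsEquivalence Γ Γ' φ) :
    ∃ f : UniversalGroup Γ →* UniversalGroup Γ', ∀ V : Γ, f (universalDegree Γ V) =
      universalDegree Γ' ⟨V.1.map (φ : A →ₗ[F] B), hφ.map_mem V.1 V.2⟩ := by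
  refine GradedAlg.exists_universalGroup_hom fun U V W h0 hle =>
    isDegree_universalDegree _ _ _ ?_ ?_
  · obtain ⟨x, hx, y, hy, hxy⟩ := h0
    refine ⟨φ x, ⟨x, hx, rfl⟩, φ y, ⟨y, hy, rfl⟩, ?_⟩
    rw [← hφ.map_mul]
    simpa using hxy
  · rintro _ ⟨x, hx, rfl⟩ _ ⟨y, hy, rfl⟩
    exact ⟨x * y, hle x hx y hy, hφ.map_mul x y⟩

theorem IsUniversalGroup.hom_ext {K : Type*} [CommGroup K] (h : IsUniversalGroup Γ δ)
    {f g : G →* K} (hfg : ∀ V, f (δ V) = g (δ V)) : f = g := by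
  obtain ⟨e, he⟩ := h
  have : f.comp (e : UniversalGroup Γ →* G) = g.comp (e : UniversalGroup Γ →* G) := by
    refine universalGroup_hom_ext fun V => ?_
    simp [he, hfg]
  ext x
  have := DFunLike.congr_fun this (e.symm x)
  simpa using this

theorem IsEquivalence.exists_universal_equiv {φ : A ≃ₗ[F] B} (hφ : IsEquivalence Γ Γ' φ)
    (hΓ : IsGrading Γ) (hΓ' : IsGrading Γ') (h : IsUniversalGroup Γ δ)
    (h' : IsUniversalGroup Γ' δ') :
    ∃ α : G ≃* G', ∀ V : Γ, α (δ V) = δ' ⟨V.1.map (φ : A →ₗ[F] B), hφ.map_mem V.1 V.2⟩ := by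
  obtain ⟨f, hf⟩ := hφ.exists_universalGroup_hom
  obtain ⟨g, hg⟩ := (hφ.symm hΓ hΓ').exists_universalGroup_hom
  have hgf : g.comp f = MonoidHom.id _ := by
    refine universalGroup_hom_ext fun V => ?_
    simp only [MonoidHom.comp_apply, hf, hg, MonoidHom.id_apply, ← Submodule.map_comp,
      LinearEquiv.symm_comp, Submodule.map_id]
  have hfg : f.comp g = MonoidHom.id _ := by
    refine universalGroup_hom_ext fun V => ?_
    simp only [MonoidHom.comp_apply, hf, hg, MonoidHom.id_apply, ← Submodule.map_comp,
      LinearEquiv.comp_symm, Submodule.map_id]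
  obtain ⟨e, he⟩ := h
  obtain ⟨e', he'⟩ := h'
  refine ⟨e.symm.trans ((MonoidHom.toMulEquiv f g hgf hfg).trans e'), fun V => ?_⟩
  rw [← he, ← he']
  simp [hf]

theorem universalFamily_eq_component (e : UniversalGroup Γ ≃* G)
    (he : ∀ U, e (universalDegree Γ U) = δ U) (y : UniversalGroup Γ) :
    universalFamily Γ y = component δ (e y) := by
  refine iSup_congr fun U => iSup_congr_Prop ?_ fun _ => rfl
  rw [← he, e.injective.eq_iff]

theorem IsGradingBy.component_mem (h : IsGradingBy Γ δ) {g : G} (hg : component δ g ≠ ⊥) :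
    component δ g ∈ Γ :=
  h.support_component.subset (mem_support hg)

theorem IsGradedFamily.component_supportDegree {𝒜 : G → Submodule F A} (h : IsGradedFamily 𝒜)
    (g : G) : component (supportDegree 𝒜) g = 𝒜 g := by
  apply le_antisymm
  · refine component_le fun U hU => ?_
    rw [← hU]
    exact (eq_supportDegree U).le
  · by_cases hg : 𝒜 g = ⊥
    · rw [hg]; exact bot_le
    · have := le_component (supportDegree 𝒜) ⟨𝒜 g, mem_support hg⟩
      rwa [h.supportDegree_eq _ rfl] at this

end UniversalEquivalence

/-! ### Fineness and universal group of a loop grading -/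

section LoopUniversal

variable {F : Type*} [Field F] {A L : Type*} [NonUnitalNonAssocRing A] [Module F A]
  [NonUnitalNonAssocRing L] [Module F L] {U V : Type*} [CommGroup U] [CommGroup V]
  {ℒ : U → Submodule F L} {𝒜 : V → Submodule F A} {π : U →* V} {p : L →ₗ[F] A}
  {Γ : Set (Submodule F A)} {δ : Γ → V}

theorem ne_zero_of_surjective (hA : IsSimpleAlgebra F A) (hp : Function.Surjective p) :
    p ≠ 0 := by
  rintro rfl
  obtain ⟨a, b, hab⟩ := hA.1
  obtain ⟨x, hx⟩ := hp (a * b)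
  exact hab hx.symm

theorem IsGradedFamily.exists_ne_bot (h : IsGradedFamily 𝒜) (hA : ∃ a b : A, a * b ≠ 0) :
    ∃ g, 𝒜 g ≠ ⊥ := by
  by_contra! h0
  obtain ⟨a, b, hab⟩ := hA
  have : a * b ∈ (⊤ : Submodule F A) := trivial
  rw [← h.iSup_eq_top, iSup_eq_bot.2 h0] at this
  exact hab this

theorem IsLoop.ne_bot_iff (h : IsLoop ℒ 𝒜 π p) (g : U) : ℒ g ≠ ⊥ ↔ 𝒜 (π g) ≠ ⊥ := by
  rw [not_iff_not]
  constructor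
  · intro h0
    rw [← h.map_eq, h0, Submodule.map_bot]
  · intro h0
    rw [Submodule.eq_bot_iff]
    intro x hx
    have := h.mem hx
    rw [h0] at this
    exact h.eq_zero g x hx this

/-- A subspace graded for the finer grading is graded for the coarser one, so refining leaves fewer
graded ideals. -/
theorem IsGradedSimple.of_refines {Γ Γ₁ : Set (Submodule F A)} (h : IsGradedSimple Γ)
    (hle : ∀ S ∈ Γ₁, ∃ T ∈ Γ, S ≤ T) : IsGradedSimple Γ₁ := by
  refine ⟨h.1, fun I hI hgr => h.2 I hI (le_antisymm ?_ (iSup_le fun _ => inf_le_right))⟩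
  refine hgr.le.trans (iSup_le fun S => ?_)
  obtain ⟨T, hT, hST⟩ := hle S.1 S.2
  exact (inf_le_inf_right I hST).trans (le_iSup (fun T : Γ => T.1 ⊓ I) ⟨T, hT⟩)

variable [IsScalarTower F A A] [SMulCommClass F A A]

/-- The structure theorem in the language of loops. -/
theorem isLoop_quotientFamily (h : IsGradedFamily ℒ) (hs : IsGradedSimpleFamily ℒ)
    (hp : ∀ x y, p (x * y) = p x * p y) (hsurj : Function.Surjective p)
    (hA : IsCentralSimpleAlgebra F A) :
    IsLoop ℒ (quotientFamily ℒ p) (QuotientGroup.mk' (degreeStabilizer ℒ p)) p where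
  source := h
  target := isGradedFamily_quotientFamily h hs hp hsurj hA
  surj := QuotientGroup.mk'_surjective _
  map_mul := hp
  eq_zero := fun _ _ hx h0 => hs.eq_zero_of_map_eq_zero h hp (ne_zero_of_surjective hA.1 hsurj) hx h0
  map_eq := fun g => (quotientFamily_mk g).symm

/-- A group-grading that refines a graded-simple one gives rise to a loop. -/
theorem IsLoop.of_refines (h : IsLoop ℒ 𝒜 π p) (hA : IsCentralSimpleAlgebra F A)
    {Γ₁ : Set (Submodule F L)} (hΓ₁ : IsGroupGrading Γ₁)
    (hle : ∀ S ∈ Γ₁, ∃ T ∈ support ℒ, S ≤ T) :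
    IsLoop (universalFamily Γ₁) (quotientFamily (universalFamily Γ₁) p)
      (QuotientGroup.mk' (degreeStabilizer (universalFamily Γ₁) p)) p := by
  refine isLoop_quotientFamily hΓ₁.isGradedFamily ?_ h.map_mul h.surjective hA
  rw [← hΓ₁.isGradedFamily.isGradedSimple_support_iff, hΓ₁.support_eq]
  exact ((h.source.isGradedSimple_support_iff).2 (h.isGradedSimpleFamily hA.1)).of_refines hle

/-- A refinement of `ℒ` is a loop over a grading of `A` with the same `p`, and this grading refines
`𝒜`, so it equals `𝒜`. Since `p` is injective on `ℒ k`, members with equal images are equal. -/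
theorem IsLoop.isFine (h : IsLoop ℒ 𝒜 π p) (hA : IsCentralSimpleAlgebra F A)
    (hfine : IsFineGroupGrading (support 𝒜)) : IsFineGroupGrading (support ℒ) := by
  refine isFineGroupGrading_of_forall_eq h.source.isGroupGrading fun Γ₁ hΓ₁ hle => ?_
  have h₁ := h.of_refines hA hΓ₁ hle
  have hsupp : support (quotientFamily (universalFamily Γ₁) p) = support 𝒜 := by
    refine hfine.support_eq_of_refines h₁.target fun q hq => ?_
    obtain ⟨g, rfl⟩ := h₁.surj q
    rw [← h₁.ne_bot_iff] at hq
    obtain ⟨T, ⟨hT, k, rfl⟩, hk⟩ := hle _ (hΓ₁.support_eq ▸ mem_support hq)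
    refine ⟨𝒜 (π k), mem_support ((h.ne_bot_iff k).1 hT), ?_⟩
    rw [← h₁.map_eq, ← h.map_eq]
    exact Submodule.map_mono hk
  refine h.source.isGrading.eq_of_subset (fun S hS => ?_) hΓ₁.universal.isGrading.sSup_eq_top
  obtain ⟨T, hT, hST⟩ := hle S hS
  obtain ⟨-, k, rfl⟩ := id hT
  suffices S = ℒ k by rw [this]; exact hT
  refine le_antisymm hST fun x hx => ?_
  rw [← hΓ₁.support_eq] at hS
  obtain ⟨hS0, g, rfl⟩ := hS
  have h2 : quotientFamily (universalFamily Γ₁) p (QuotientGroup.mk g) ∈ support 𝒜 := by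
    rw [← hsupp]
    exact mem_support ((h₁.ne_bot_iff g).1 hS0)
  rw [quotientFamily_mk] at h2
  have h3 := h.target.isGrading.eq_of_le h2 (mem_support ((h.ne_bot_iff k).1 hT.1))
    (h.map_eq k ▸ Submodule.map_mono hST)
  have h4 := h.mem hx
  rw [← h3] at h4
  obtain ⟨y, hy, hyx⟩ := h4
  rwa [← h.ext (hST hy) hx hyx]

/-- The degree map induces `f : U(ℒ) → U`. It is onto because its range contains `ker π` and maps
onto `V`. It is injective because the `U(ℒ)`-grading is again a loop, over a quotient of `U(ℒ)`,
with the same underlying grading of `A`, to which the universal property of `V` applies. -/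
theorem IsLoop.isUniversalGroup (hδ : IsGradingBy Γ δ) (h : IsLoop ℒ (component δ) π p)
    (hA : IsCentralSimpleAlgebra F A) (huniv : IsUniversalGroup Γ δ) :
    IsUniversalGroup (support ℒ) (supportDegree ℒ) := by
  obtain ⟨f, hf⟩ := exists_universalGroup_hom h.source.isGradingBy.map_mul
  have hgr : IsGroupGrading (support ℒ) := h.source.isGroupGrading
  have hX : ∀ x, universalFamily (support ℒ) x ≠ ⊥ →
      universalFamily (support ℒ) x = ℒ (f x) := by
    intro x hx
    have hmem : universalFamily (support ℒ) x ∈ support ℒ := by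
      have := mem_support hx
      rwa [hgr.support_eq] at this
    have h1 : universalDegree (support ℒ) ⟨_, hmem⟩ = x :=
      hgr.isGradedFamily.toIsDecomp.eq_of_eq
        (hgr.universalFamily_degree _) (by rwa [hgr.universalFamily_degree])
    conv_rhs => rw [← h1]
    rw [hf]
    exact eq_supportDegree (⟨_, hmem⟩ : support ℒ)
  obtain ⟨e, he⟩ := id huniv
  have h₁ := h.of_refines hA hgr fun S hS => ⟨S, hS, le_rfl⟩
  have hsurj : Function.Surjective f := by
    rw [← MonoidHom.range_eq_top]
    have hsupp : ∀ g, ℒ g ≠ ⊥ → g ∈ f.range := fun g hg =>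
      ⟨universalDegree _ ⟨ℒ g, mem_support hg⟩, by rw [hf, h.source.supportDegree_eq _ rfl]⟩
    -- A degree `g` in the support and its translate `g * k` are both in the range, hence so is
    -- their quotient `k`.
    have hker : ∀ k ∈ π.ker, k ∈ f.range := by
      intro k hk
      obtain ⟨g, hg⟩ := h.source.exists_ne_bot (h.isGradedSimpleFamily hA.1).1
      have hgk : ℒ (g * k) ≠ ⊥ := by
        rw [h.ne_bot_iff, _root_.map_mul, MonoidHom.mem_ker.1 hk, mul_one, ← h.ne_bot_iff]
        exact hg
      have := mul_mem (inv_mem (hsupp g hg)) (hsupp _ hgk)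
      rwa [inv_mul_cancel_left] at this
    -- The group `V` is generated by the degrees of `Γ`, each of which lifts to a degree in the
    -- support of `ℒ`.
    have hmap : QuotientGroup.mk' (f.range.map π) = 1 := by
      refine huniv.hom_ext fun W => ?_
      rw [MonoidHom.one_apply, QuotientGroup.mk'_apply, QuotientGroup.eq_one_iff]
      obtain ⟨g, hg⟩ := h.surj (δ W)
      refine ⟨g, hsupp g ?_, hg⟩
      rw [h.ne_bot_iff, hg, hδ.component_degree]
      exact hδ.isGrading.ne_bot _ W.2
    rw [eq_top_iff]
    intro g _
    have h2 := DFunLike.congr_fun hmap (π g)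
    rw [MonoidHom.one_apply, QuotientGroup.mk'_apply, QuotientGroup.eq_one_iff] at h2
    obtain ⟨k, hk, hkg⟩ := h2
    have h3 := mul_mem hk (hker (k⁻¹ * g) (by
      rw [MonoidHom.mem_ker, _root_.map_mul, map_inv, hkg, inv_mul_cancel]))
    rwa [mul_inv_cancel_left] at h3
  have hinj : Function.Injective f := by
    rw [injective_iff_map_eq_one]
    intro x hx
    -- Universality of `V` yields a homomorphism from `V` to `U(ℒ)` modulo the stabilizer. Its
    -- composite with `π ∘ f` is the quotient map, so the kernel of `f` lies in the stabilizer.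
    obtain ⟨ψ, hψ⟩ := exists_hom_of_refines (Γ := Γ) h₁.target fun W hW => by
      obtain ⟨g, hg⟩ := h.surj (δ ⟨W, hW⟩)
      have hW' : ℒ g ≠ ⊥ := by
        rw [h.ne_bot_iff, hg, hδ.component_degree]
        exact hδ.isGrading.ne_bot _ hW
      refine ⟨QuotientGroup.mk (universalDegree _ ⟨ℒ g, mem_support hW'⟩), ?_⟩
      rw [quotientFamily_mk, hgr.universalFamily_degree, h.map_eq, hg, hδ.component_degree]
    have hcomp : ((ψ.comp (e.symm : V →* UniversalGroup Γ)).comp π).comp f =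
        QuotientGroup.mk' (degreeStabilizer (universalFamily (support ℒ)) p) := by
      refine universalGroup_hom_ext fun W => ?_
      obtain ⟨y, hy, hy0⟩ := (Submodule.ne_bot_iff _).1 W.2.1
      have hy' := hy
      rw [eq_supportDegree W] at hy'
      have hpy : p y ≠ 0 := fun h0 => hy0 (h.eq_zero _ _ hy' h0)
      refine h₁.target.toIsDecomp.eq_of_mem_of_mem (x := p y) ?_ ?_ hpy
      · refine hψ _ ?_
        rw [universalFamily_eq_component e he]
        simp only [MonoidHom.coe_coe, MulEquiv.apply_symm_apply, hf]
        exact h.mem hy'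
      · rw [← hgr.universalFamily_degree W] at hy
        exact h₁.mem hy
    have h1 := DFunLike.congr_fun hcomp x
    simp only [MonoidHom.comp_apply, hx, map_one] at h1
    have hmem : x ∈ degreeStabilizer (universalFamily (support ℒ)) p :=
      (QuotientGroup.eq_one_iff x).1 h1.symm
    obtain ⟨y, hy⟩ := hgr.isGradedFamily.exists_ne_bot (h.isGradedSimpleFamily hA.1).1
    have hyx : universalFamily (support ℒ) (y * x) ≠ ⊥ := by
      intro h0
      have := hmem y
      rw [h0, Submodule.map_bot] at this
      exact hy (by
        rw [Submodule.eq_bot_iff]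
        intro z hz
        refine h₁.eq_zero y z hz ?_
        have : p z ∈ (⊥ : Submodule F A) := this ▸ ⟨z, hz, rfl⟩
        exact this)
    -- As `f x = 1`, the nonzero components of degrees `y` and `y * x` are the same component of
    -- `ℒ`; uniqueness of the degree gives `x = 1`.
    have h3 : universalFamily (support ℒ) (y * x) = universalFamily (support ℒ) y := by
      rw [hX _ hyx, hX _ hy, _root_.map_mul, hx, mul_one]
    have h4 := hgr.isGradedFamily.toIsDecomp.eq_of_eq h3 hyx
    exact mul_eq_left.1 h4
  exact ⟨MulEquiv.ofBijective f ⟨hinj, hsurj⟩, hf⟩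

end LoopUniversal

/-! ### Equivalence of loop algebras -/

section LoopEquivalence

variable {F : Type*} [Field F] {A₁ A₂ : Type u}
  [NonUnitalNonAssocRing A₁] [Module F A₁] [NonUnitalNonAssocRing A₂] [Module F A₂]
  {U₁ V₁ U₂ V₂ : Type v} [CommGroup U₁] [CommGroup V₁] [CommGroup U₂] [CommGroup V₂]
  {L₁ L₂ : Type*} [NonUnitalNonAssocRing L₁] [Module F L₁] [NonUnitalNonAssocRing L₂]
  [Module F L₂] {ℒ₁ : U₁ → Submodule F L₁} {ℒ₂ : U₂ → Submodule F L₂}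
  {p₁ : L₁ →ₗ[F] A₁} {p₂ : L₂ →ₗ[F] A₂} {π₁ : U₁ →* V₁} {π₂ : U₂ →* V₂}
  {Γ₁ : Set (Submodule F A₁)} {Γ₂ : Set (Submodule F A₂)} {δ₁ : Γ₁ → V₁} {δ₂ : Γ₂ → V₂}

theorem IsLoop.gradingEquivalent (hδ₁ : IsGradingBy Γ₁ δ₁) (hδ₂ : IsGradingBy Γ₂ δ₂)
    (h₁ : IsLoop ℒ₁ (component δ₁) π₁ p₁) (h₂ : IsLoop ℒ₂ (component δ₂) π₂ p₂)
    {φ : A₁ ≃ₗ[F] A₂} (hφ : IsEquivalence Γ₁ Γ₂ φ) (α : V₁ ≃* V₂) (β : U₁ ≃* U₂)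
    (hα : ∀ W : Γ₁, α (δ₁ W) = δ₂ ⟨W.1.map (φ : A₁ →ₗ[F] A₂), hφ.map_mem W.1 W.2⟩)
    (hβ : ∀ g, π₂ (β g) = α (π₁ g)) : GradingEquivalent (support ℒ₁) (support ℒ₂) := by
  refine h₁.exists_equiv h₂ φ hφ.map_mul β fun g => ?_
  rw [hβ]
  refine IsDecomp.map_equiv hδ₁.isGradedFamily.toIsDecomp hδ₂.isGradedFamily.toIsDecomp φ
    α.toEquiv (fun v x hx => ?_) (π₁ g)
  suffices component δ₁ v ≤ (component δ₂ (α v)).comap (φ : A₁ →ₗ[F] A₂) from this hx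
  refine component_le fun W hW y hy => ?_
  rw [← hW, hα]
  exact le_component δ₂ _ ⟨y, hy, rfl⟩

variable [IsAlgClosed F] [IsScalarTower F A₁ A₁] [SMulCommClass F A₁ A₁]
  [IsScalarTower F A₂ A₂] [SMulCommClass F A₂ A₂]

/-- An equivalence `Ψ` induces `β`, because `U₁` and `U₂` are the universal groups of the loop
gradings. The map `p₂ ∘ Ψ` agrees on each component, up to a nonzero scalar, with `φ ∘ p₁`; the
scalars do not change images of components, so `φ` is an equivalence of the bases. The square of
group homomorphisms is checked on the degrees of the support. -/
theorem IsLoop.exists_of_gradingEquivalent (hδ₁ : IsGradingBy Γ₁ δ₁) (hδ₂ : IsGradingBy Γ₂ δ₂)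
    (h₁ : IsLoop ℒ₁ (component δ₁) π₁ p₁) (h₂ : IsLoop ℒ₂ (component δ₂) π₂ p₂)
    (hA₁ : IsCentralSimpleAlgebra F A₁) (hA₂ : IsCentralSimpleAlgebra F A₂)
    (hu₁ : IsUniversalGroup Γ₁ δ₁) (hu₂ : IsUniversalGroup Γ₂ δ₂)
    (heq : GradingEquivalent (support ℒ₁) (support ℒ₂)) :
    ∃ (φ : A₁ ≃ₗ[F] A₂) (hφ : IsEquivalence Γ₁ Γ₂ φ) (α : V₁ ≃* V₂) (β : U₁ ≃* U₂),
      (∀ W : Γ₁, α (δ₁ W) = δ₂ ⟨W.1.map (φ : A₁ →ₗ[F] A₂), hφ.map_mem W.1 W.2⟩) ∧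
      ∀ g : U₁, π₂ (β g) = α (π₁ g) := by
  obtain ⟨Ψ, hΨ⟩ := heq
  have huL₁ := h₁.isUniversalGroup hδ₁ hA₁ hu₁
  obtain ⟨β, hβ⟩ := hΨ.exists_universal_equiv h₁.source.isGrading h₂.source.isGrading
    huL₁ (h₂.isUniversalGroup hδ₂ hA₂ hu₂)
  have hβ' : ∀ g, ℒ₁ g ≠ ⊥ → (ℒ₁ g).map (Ψ : L₁ →ₗ[F] L₂) = ℒ₂ (β g) := by
    intro g hg
    have h := hβ ⟨ℒ₁ g, mem_support hg⟩
    rw [h₁.source.supportDegree_eq _ rfl] at h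
    rw [h]
    exact eq_supportDegree (⟨_, hΨ.map_mem _ (mem_support hg)⟩ : support ℒ₂)
  obtain ⟨χ, φ, hφ, hχ⟩ := h₁.exists_equiv_of_surjective hA₁.1 hA₂
    (q := p₂ ∘ₗ (Ψ : L₁ →ₗ[F] L₂)) (fun x y => by simp [hΨ.map_mul, h₂.map_mul])
    (h₂.surjective.comp Ψ.surjective)
  have hmap : ∀ g, ℒ₁ g ≠ ⊥ →
      (component δ₁ (π₁ g)).map (φ : A₁ →ₗ[F] A₂) = component δ₂ (π₂ (β g)) := by
    intro g hg
    rw [← h₂.map_eq, ← hβ' g hg, ← h₁.map_eq]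
    apply le_antisymm
    · rintro _ ⟨_, ⟨x, hx, rfl⟩, rfl⟩
      refine ⟨Ψ (((χ g)⁻¹ : Fˣ) • x), ⟨_, (ℒ₁ g).smul_mem _ hx, rfl⟩, ?_⟩
      have h1 := hχ g x hx
      simp only [LinearMap.comp_apply, LinearEquiv.coe_coe] at h1
      rw [Units.smul_def, map_smul, map_smul, h1, smul_smul, ← Units.val_mul, inv_mul_cancel,
        Units.val_one, one_smul]
      rfl
    · rintro _ ⟨_, ⟨x, hx, rfl⟩, rfl⟩
      refine ⟨(χ g : F) • p₁ x, ⟨(χ g : F) • x, (ℒ₁ g).smul_mem _ hx, map_smul _ _ _⟩, ?_⟩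
      rw [LinearEquiv.coe_coe, map_smul]
      exact (hχ g x hx).symm
  have hex : ∀ W : Γ₁, ∃ g, π₁ g = δ₁ W ∧ ℒ₁ g ≠ ⊥ ∧
      W.1.map (φ : A₁ →ₗ[F] A₂) = component δ₂ (π₂ (β g)) := by
    intro W
    obtain ⟨g, hg⟩ := h₁.surj (δ₁ W)
    have hg0 : ℒ₁ g ≠ ⊥ := by
      rw [h₁.ne_bot_iff, hg, hδ₁.component_degree]
      exact hδ₁.isGrading.ne_bot _ W.2
    refine ⟨g, hg, hg0, ?_⟩
    rw [← hmap g hg0, hg, hδ₁.component_degree]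
  have hequiv : IsEquivalence Γ₁ Γ₂ φ := by
    refine ⟨hφ, fun W hW => ?_⟩
    obtain ⟨g, hg, hg0, hgW⟩ := hex ⟨W, hW⟩
    rw [hgW]
    refine hδ₂.component_mem ?_
    rw [← hgW]
    exact fun h0 => hδ₁.isGrading.ne_bot _ hW (Submodule.map_injective_of_injective
      (f := (φ : A₁ →ₗ[F] A₂)) φ.injective (h0.trans (Submodule.map_bot _).symm))
  obtain ⟨α, hα⟩ := hequiv.exists_universal_equiv hδ₁.isGrading hδ₂.isGrading hu₁ hu₂
  refine ⟨φ, hequiv, α, β, hα, fun g => ?_⟩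
  have hhom : π₂.comp (β : U₁ →* U₂) = (α : V₁ →* V₂).comp π₁ := by
    refine huL₁.hom_ext fun W => ?_
    have hW0 := W.2.1
    rw [eq_supportDegree W] at hW0
    set g := supportDegree ℒ₁ W
    have h1 : component δ₁ (π₁ g) ∈ Γ₁ := hδ₁.component_mem ((h₁.ne_bot_iff g).1 hW0)
    have h2 : δ₁ ⟨_, h1⟩ = π₁ g := hδ₁.isGradedFamily.toIsDecomp.eq_of_eq
      (hδ₁.component_degree _) (by rw [hδ₁.component_degree]; exact hδ₁.isGrading.ne_bot _ h1)
    change π₂ (β g) = α (π₁ g)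
    rw [← h2, hα]
    refine (hδ₂.isGradedFamily.toIsDecomp.eq_of_eq ((hδ₂.component_degree _).trans (hmap g hW0))
      ?_).symm
    rw [hδ₂.component_degree]
    exact hδ₂.isGrading.ne_bot _ (hequiv.map_mem _ h1)
  exact DFunLike.congr_fun hhom g

end LoopEquivalence

/-! ### Simple quotients -/

section QuotientAlgebra

variable {F : Type*} [Field F] {B : Type u} [NonUnitalNonAssocRing B] [Module F B]

theorem IsIdeal.mk_out_mul_out {M : Submodule F B} (hM : IsIdeal M) (x y : B) :
    (Submodule.Quotient.mk (Quotient.out (Submodule.Quotient.mk (p := M) x) *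
      Quotient.out (Submodule.Quotient.mk (p := M) y)) : B ⧸ M) =
    Submodule.Quotient.mk (x * y) := by
  rw [Submodule.Quotient.eq]
  have hx : Quotient.out (Submodule.Quotient.mk (p := M) x) - x ∈ M :=
    (Submodule.Quotient.eq M).1 (Quotient.out_eq _)
  have hy : Quotient.out (Submodule.Quotient.mk (p := M) y) - y ∈ M :=
    (Submodule.Quotient.eq M).1 (Quotient.out_eq _)
  have := add_mem (hM (Quotient.out (Submodule.Quotient.mk (p := M) y)) _ hx).2 (hM x _ hy).1
  rwa [sub_mul, mul_sub, sub_add_sub_cancel] at this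

/-- The quotient by an ideal is an algebra. -/
noncomputable abbrev quotientRing {M : Submodule F B} (hM : IsIdeal M) :
    NonUnitalNonAssocRing (B ⧸ M) :=
  { (inferInstance : AddCommGroup (B ⧸ M)) with
    mul := fun a b => Submodule.Quotient.mk (Quotient.out a * Quotient.out b)
    left_distrib := fun a b c => by
      obtain ⟨x, rfl⟩ := Submodule.Quotient.mk_surjective M a
      obtain ⟨y, rfl⟩ := Submodule.Quotient.mk_surjective M b
      obtain ⟨z, rfl⟩ := Submodule.Quotient.mk_surjective M c
      refine (hM.mk_out_mul_out x (y + z)).trans ?_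
      rw [mul_add]
      exact (congrArg₂ (· + ·) (hM.mk_out_mul_out x y) (hM.mk_out_mul_out x z)).symm
    right_distrib := fun a b c => by
      obtain ⟨x, rfl⟩ := Submodule.Quotient.mk_surjective M a
      obtain ⟨y, rfl⟩ := Submodule.Quotient.mk_surjective M b
      obtain ⟨z, rfl⟩ := Submodule.Quotient.mk_surjective M c
      refine (hM.mk_out_mul_out (x + y) z).trans ?_
      rw [add_mul]
      exact (congrArg₂ (· + ·) (hM.mk_out_mul_out x z) (hM.mk_out_mul_out y z)).symm
    zero_mul := fun a => by
      obtain ⟨x, rfl⟩ := Submodule.Quotient.mk_surjective M a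
      refine (hM.mk_out_mul_out 0 x).trans ?_
      rw [zero_mul]
      rfl
    mul_zero := fun a => by
      obtain ⟨x, rfl⟩ := Submodule.Quotient.mk_surjective M a
      refine (hM.mk_out_mul_out x 0).trans ?_
      rw [mul_zero]
      rfl }

theorem exists_quotient_algebra [IsScalarTower F B B] [SMulCommClass F B B]
    {M : Submodule F B} (hM : IsIdeal M) :
    ∃ (A : Type u) (_ : NonUnitalNonAssocRing A) (_ : Module F A) (_ : IsScalarTower F A A)
      (_ : SMulCommClass F A A) (p : B →ₗ[F] A), (∀ x y, p (x * y) = p x * p y) ∧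
      Function.Surjective p ∧ LinearMap.ker p = M := by
  let := quotientRing hM
  have hmul : ∀ x y : B, (Submodule.Quotient.mk (x * y) : B ⧸ M) =
      Submodule.Quotient.mk x * Submodule.Quotient.mk y := fun x y =>
    (hM.mk_out_mul_out x y).symm
  refine ⟨B ⧸ M, inferInstance, inferInstanceAs (Module F (B ⧸ M)), ⟨fun c a b => ?_⟩,
    ⟨fun c a b => ?_⟩, M.mkQ, hmul, M.mkQ_surjective, M.ker_mkQ⟩
  · obtain ⟨x, rfl⟩ := M.mkQ_surjective a
    obtain ⟨y, rfl⟩ := M.mkQ_surjective b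
    change (Submodule.Quotient.mk (c • x) : B ⧸ M) * Submodule.Quotient.mk y =
      c • ((Submodule.Quotient.mk x : B ⧸ M) * Submodule.Quotient.mk y)
    rw [← hmul, ← hmul, smul_mul_assoc, Submodule.Quotient.mk_smul]
  · obtain ⟨x, rfl⟩ := M.mkQ_surjective a
    obtain ⟨y, rfl⟩ := M.mkQ_surjective b
    change c • ((Submodule.Quotient.mk x : B ⧸ M) * Submodule.Quotient.mk y) =
      (Submodule.Quotient.mk x : B ⧸ M) * Submodule.Quotient.mk (c • y)
    rw [← hmul, ← hmul, mul_smul_comm, Submodule.Quotient.mk_smul]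

/-- The span of all products. -/
def productSpan (F : Type*) [Field F] (B : Type*) [NonUnitalNonAssocRing B] [Module F B] :
    Submodule F B :=
  Submodule.span F {z | ∃ x y : B, z = x * y}

theorem mul_mem_productSpan (x y : B) : x * y ∈ productSpan F B :=
  Submodule.subset_span ⟨x, y, rfl⟩

theorem isIdeal_productSpan : IsIdeal (productSpan F B) :=
  fun x y _ => ⟨mul_mem_productSpan x y, mul_mem_productSpan y x⟩

/-- The span of the products is a nonzero graded ideal. This is what prevents a quotient by a proper
ideal from having zero product. -/
theorem IsGradedSimple.productSpan_eq_top {G : Type*} [CommGroup G] {𝓑 : G → Submodule F B}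
    (h : IsGradedFamily 𝓑) (hs : IsGradedSimple (support 𝓑)) : productSpan F B = ⊤ := by
  refine (hs.2 _ isIdeal_productSpan ?_).resolve_left fun h0 => ?_
  · rw [h.isGradedSubspace_iff]
    intro z hz g
    refine Submodule.span_induction (p := fun z _ => h.toIsDecomp.proj g z ∈ productSpan F B)
      ?_ (by simp) (fun x y _ _ hx hy => by rw [map_add]; exact add_mem hx hy)
      (fun c x _ hx => by rw [map_smul]; exact Submodule.smul_mem _ c hx) hz
    rintro _ ⟨x, y, rfl⟩
    refine h.toIsDecomp.induction (P := fun x => h.toIsDecomp.proj g (x * y) ∈ productSpan F B)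
      (fun a x hx => ?_) (by simp) (fun a b ha hb => by
        rw [add_mul, map_add]; exact add_mem ha hb) x
    refine h.toIsDecomp.induction (P := fun y => h.toIsDecomp.proj g (x * y) ∈ productSpan F B)
      (fun b y hy => ?_) (by simp) (fun a b ha hb => by
        rw [mul_add, map_add]; exact add_mem ha hb) y
    have hxy := h.mul_mem hx hy
    by_cases hg : a * b = g
    · rw [← hg, h.toIsDecomp.proj_of_mem hxy]
      exact mul_mem_productSpan x y
    · rw [h.toIsDecomp.proj_of_mem_ne hxy hg]
      exact zero_mem _
  · obtain ⟨x, y, hxy⟩ := hs.1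
    refine hxy ?_
    have := mul_mem_productSpan (F := F) x y
    rwa [h0, Submodule.mem_bot] at this

/-- The quotient by a maximal proper ideal. If its product were zero, that ideal would contain all
products, which span `B`. -/
theorem exists_simple_quotient [IsScalarTower F B B] [SMulCommClass F B B]
    [FiniteDimensional F B] (hB : productSpan F B = ⊤) (h0 : ∃ x y : B, x * y ≠ 0) :
    ∃ (A : Type u) (_ : NonUnitalNonAssocRing A) (_ : Module F A) (_ : IsScalarTower F A A)
      (_ : SMulCommClass F A A) (p : B →ₗ[F] A), (∀ x y, p (x * y) = p x * p y) ∧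
      Function.Surjective p ∧ IsSimpleAlgebra F A := by
  have hne : (⊥ : Submodule F B) ≠ ⊤ := by
    intro h
    obtain ⟨x, y, hxy⟩ := h0
    have : x * y ∈ (⊥ : Submodule F B) := h ▸ trivial
    exact hxy this
  obtain ⟨M, ⟨hM, hMtop⟩, hmax⟩ := (wellFounded_gt (α := Submodule F B)).has_min
    {I | IsIdeal I ∧ I ≠ ⊤} ⟨⊥, isIdeal_bot, hne⟩
  obtain ⟨A, _, _, _, _, p, hp, hps, hker⟩ := exists_quotient_algebra hM
  refine ⟨A, _, _, ‹_›, ‹_›, p, hp, hps, ?_, fun I hI => ?_⟩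
  · by_contra! h
    apply hMtop
    rw [← hker, eq_top_iff, ← hB, productSpan, Submodule.span_le]
    rintro _ ⟨x, y, rfl⟩
    simp [hp, h]
  · by_cases htop : I.comap p = ⊤
    · right
      rw [eq_top_iff]
      intro a _
      obtain ⟨x, rfl⟩ := hps a
      exact (htop ▸ trivial : x ∈ I.comap p)
    · left
      have hle : M ≤ I.comap p := by
        rw [← hker]
        exact LinearMap.ker_le_comap p
      have heq : M = I.comap p := eq_of_le_of_not_lt hle (hmax _ ⟨hI.comap hp, htop⟩)
      rw [Submodule.eq_bot_iff]
      intro a ha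
      obtain ⟨x, rfl⟩ := hps a
      have : x ∈ M := heq ▸ ha
      rwa [← hker] at this

end QuotientAlgebra

/-! ### Descent of fineness to the base; finiteness of the kernel -/

section LoopRealization

variable {F : Type*} [Field F] {A L : Type*} [NonUnitalNonAssocRing A] [Module F A]
  [NonUnitalNonAssocRing L] [Module F L] {U V : Type*} [CommGroup U] [CommGroup V]
  {ℒ : U → Submodule F L} {𝒜 : V → Submodule F A} {π : U →* V} {p : L →ₗ[F] A}

/-- A loop inherits refinements of the grading of the base. -/
theorem IsLoop.refine {K : Type*} [CommGroup K] (h : IsLoop ℒ 𝒜 π p) {ℬ : K → Submodule F A}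
    (hℬ : IsGradedFamily ℬ) (hle : ∀ k, ∃ v, ℬ k ≤ 𝒜 v) :
    IsGradedFamily fun q : U × K => ℒ q.1 ⊓ (ℬ q.2).comap p := by
  -- Each `𝒜 v` is the sum of the finer pieces inside it, hence stable under the projections of the
  -- finer grading.
  have hproj : ∀ k v, ∀ a ∈ 𝒜 v, hℬ.toIsDecomp.proj k a ∈ 𝒜 v := by
    have hS : ∀ v, 𝒜 v = ⨆ k, ℬ k ⊓ 𝒜 v := by
      have h1 : (fun v => ⨆ k, ℬ k ⊓ 𝒜 v) = 𝒜 := by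
        refine h.target.toIsDecomp.eq_of_le (fun v => iSup_le fun k => inf_le_right) ?_
        rw [eq_top_iff, ← hℬ.iSup_eq_top]
        refine iSup_le fun k => ?_
        obtain ⟨v, hv⟩ := hle k
        refine le_iSup_of_le v (le_iSup_of_le k ?_)
        rw [inf_eq_left.2 hv]
      exact fun v => (congrFun h1 v).symm
    exact fun k v a ha => hℬ.toIsDecomp.eq_iSup_inf_iff.1 (hS v) a ha k
  refine h.source.refine (𝒞 := fun g k => ℒ g ⊓ (ℬ k).comap p) (fun g k => inf_le_left)
    (fun g => le_antisymm (iSup_le fun k => inf_le_left) fun x hx => ?_) (fun g => ?_) ?_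
  · obtain ⟨s, hs⟩ := hℬ.toIsDecomp.exists_sum_proj (p x)
    have hex : ∀ k, ∃ y ∈ ℒ g, p y = hℬ.toIsDecomp.proj k (p x) := fun k =>
      h.exists_mem (hproj k _ _ (h.mem hx))
    choose y hy hyp using hex
    have : x = ∑ k ∈ s, y k := by
      refine h.ext hx (sum_mem fun k _ => hy k) ?_
      rw [map_sum, Finset.sum_congr rfl fun k _ => hyp k]
      exact hs s subset_rfl
    rw [this]
    refine sum_mem fun k _ => Submodule.mem_iSup_of_mem k ⟨hy k, ?_⟩
    change p (y k) ∈ ℬ k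
    rw [hyp]
    exact hℬ.toIsDecomp.proj_mem _ _
  · rw [iSupIndep_iff_finsetSum_eq_zero_imp_eq_zero]
    intro s v hv h0 k hk
    refine h.eq_zero g _ (hv k hk).1 ?_
    have h1 : ∑ k ∈ s, p (v k) = 0 := by rw [← map_sum, h0, map_zero]
    exact (iSupIndep_iff_finsetSum_eq_zero_imp_eq_zero _).1 hℬ.indep s (fun k => p (v k))
      (fun k hk => (hv k hk).2) h1 k hk
  · intro g g' k k' x y hx hy
    refine ⟨h.source.mul_mem hx.1 hy.1, ?_⟩
    have := hℬ.mul_mem hx.2 hy.2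
    rwa [← h.map_mul] at this

/-- A refinement of `𝒜` pulls back along `p` to a refinement of `ℒ`. Fineness makes each nonzero
intersection of `ℒ g` with a preimage equal to `ℒ g`; applying `p` shows that the original pieces
were whole components. -/
theorem IsLoop.isFine_base (h : IsLoop ℒ 𝒜 π p) (hfine : IsFineGroupGrading (support ℒ)) :
    IsFineGroupGrading (support 𝒜) := by
  refine isFineGroupGrading_of_forall_eq h.target.isGroupGrading fun Γ₁ hΓ₁ hle => ?_
  have hle' : ∀ k, ∃ v, universalFamily Γ₁ k ≤ 𝒜 v := by
    intro k
    by_cases hk : universalFamily Γ₁ k = ⊥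
    · exact ⟨1, hk ▸ bot_le⟩
    · obtain ⟨T, ⟨-, v, rfl⟩, hv⟩ := hle _ (hΓ₁.support_eq ▸ mem_support hk)
      exact ⟨v, hv⟩
  have h₁ := h.refine hΓ₁.isGradedFamily hle'
  have h₂ := hfine.support_eq_of_refines h₁ fun q hq => by
    refine ⟨ℒ q.1, mem_support fun h0 => hq ?_, inf_le_left⟩
    rw [h0, bot_inf_eq]
  refine h.target.isGrading.eq_of_subset (fun S hS => ?_) hΓ₁.universal.isGrading.sSup_eq_top
  obtain ⟨T, hT, hST⟩ := hle S hS
  suffices S = T by rw [this]; exact hT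
  refine le_antisymm hST ?_
  obtain ⟨hT0, v, rfl⟩ := hT
  obtain ⟨g, rfl⟩ := h.surj v
  rw [← hΓ₁.support_eq] at hS
  obtain ⟨hS0, k, rfl⟩ := hS
  obtain ⟨a, ha, ha0⟩ := (Submodule.ne_bot_iff _).1 hS0
  obtain ⟨x, hx, rfl⟩ := h.exists_mem (hST ha)
  have hx0 : x ≠ 0 := by rintro rfl; exact ha0 (map_zero p)
  have hmem : ℒ g ⊓ (universalFamily Γ₁ k).comap p ∈ support ℒ := by
    rw [← h₂]
    exact ⟨(Submodule.ne_bot_iff _).2 ⟨x, ⟨hx, ha⟩, hx0⟩, (g, k), rfl⟩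
  have heq := h.source.isGrading.eq_of_le hmem (mem_support_of_mem hx hx0) inf_le_left
  rw [← h.map_eq]
  rintro _ ⟨y, hy, rfl⟩
  rw [← heq] at hy
  exact hy.2

/-- Translating a nonzero component by the kernel gives nonzero components in distinct degrees, of
which a finite-dimensional algebra has finitely many. -/
theorem IsLoop.finite_ker [FiniteDimensional F L] (h : IsLoop ℒ 𝒜 π p)
    (h0 : ∃ x y : L, x * y ≠ 0) : Finite π.ker := by
  obtain ⟨g, hg⟩ := h.source.exists_ne_bot h0
  have hfin := WellFoundedGT.finite_ne_bot_of_iSupIndep h.source.indep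
  have : ∀ k : π.ker, g * k.1 ∈ {i | ℒ i ≠ ⊥} := by
    intro k
    rw [Set.mem_ofPred_eq, h.ne_bot_iff, _root_.map_mul, k.2, mul_one, ← h.ne_bot_iff]
    exact hg
  have hfin' : Finite {i | ℒ i ≠ ⊥} := hfin
  refine Finite.of_injective (fun k : π.ker => (⟨g * k.1, this k⟩ : {i | ℒ i ≠ ⊥})) ?_
  intro k l hkl
  exact Subtype.ext (mul_left_cancel (congrArg Subtype.val hkl))

end LoopRealization

/-! ### The universal group of the quotient grading -/

section QuotientUniversal

variable {F : Type*} [Field F] {A L : Type*} [NonUnitalNonAssocRing A] [Module F A]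
  [NonUnitalNonAssocRing L] [Module F L] {Γ : Set (Submodule F L)} {p : L →ₗ[F] A}
  [IsScalarTower F A A] [SMulCommClass F A A]

/-- Sending the degree of `W` to the degree of `p(W)` respects the relations, since `p` is injective
on components and so preserves nonzero products. It kills the stabilizer, because degrees that
differ by an element of it have the same image. This inverts the natural map to the quotient of
`U(Γ)` by the stabilizer. -/
theorem isUniversalGroup_quotientFamily (hΓ : IsGroupGrading Γ) (hs : IsGradedSimple Γ)
    (hp : ∀ x y, p (x * y) = p x * p y) (hsurj : Function.Surjective p)
    (hA : IsCentralSimpleAlgebra F A) :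
    IsUniversalGroup (support (quotientFamily (universalFamily Γ) p))
      (supportDegree (quotientFamily (universalFamily Γ) p)) := by
  have hs' : IsGradedSimpleFamily (universalFamily Γ) := by
    rwa [← hΓ.isGradedFamily.isGradedSimple_support_iff, hΓ.support_eq]
  have h := isLoop_quotientFamily hΓ.isGradedFamily hs' hp hsurj hA
  obtain ⟨f, hf⟩ := exists_universalGroup_hom h.target.isGradingBy.map_mul
  have hmap : ∀ W : Γ, W.1.map p =
      quotientFamily (universalFamily Γ) p (QuotientGroup.mk (universalDegree Γ W)) := by
    intro W
    rw [quotientFamily_mk, hΓ.universalFamily_degree]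
  have hmem : ∀ W : Γ, W.1.map p ∈ support (quotientFamily (universalFamily Γ) p) := by
    intro W
    rw [hmap]
    refine mem_support ((h.ne_bot_iff _).1 ?_)
    rw [hΓ.universalFamily_degree]
    exact hΓ.universal.isGrading.ne_bot _ W.2
  have hinj : ∀ W ∈ Γ, ∀ x ∈ W, p x = 0 → x = 0 := by
    intro W hW x hx h0
    refine h.eq_zero (universalDegree Γ ⟨W, hW⟩) x ?_ h0
    rwa [hΓ.universalFamily_degree]
  obtain ⟨k, hk⟩ := exists_universalGroup_hom (Γ := Γ)
    (d := fun W => universalDegree _ ⟨W.1.map p, hmem W⟩) (by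
    rintro U V W ⟨x, hx, y, hy, hxy⟩ hle
    refine isDegree_universalDegree _ _ _ ⟨p x, ⟨x, hx, rfl⟩, p y, ⟨y, hy, rfl⟩, ?_⟩ ?_
    · rw [← hp]
      exact fun h0 => hxy (hinj _ W.2 _ (hle x hx y hy) h0)
    · rintro _ ⟨a, ha, rfl⟩ _ ⟨b, hb, rfl⟩
      exact ⟨a * b, hle a ha b hb, hp a b⟩)
  have hker : degreeStabilizer (universalFamily Γ) p ≤ k.ker := by
    intro c hc
    obtain ⟨g, hg⟩ := hΓ.isGradedFamily.exists_ne_bot hs.1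
    have hdeg : ∀ g, universalFamily Γ g ≠ ⊥ → ∃ W : Γ, universalDegree Γ W = g := by
      intro g hg
      have := hΓ.universal.component_mem hg
      exact ⟨⟨_, this⟩, hΓ.isGradedFamily.toIsDecomp.eq_of_eq (hΓ.universalFamily_degree _)
        (by rwa [hΓ.universalFamily_degree])⟩
    have hgc : universalFamily Γ (g * c) ≠ ⊥ := by
      intro h0
      have h1 := hc g
      rw [h0, Submodule.map_bot] at h1
      have h2 := (h.ne_bot_iff g).1 hg
      exact h2 h1.symm
    obtain ⟨W, hW⟩ := hdeg g hg
    obtain ⟨W', hW'⟩ := hdeg _ hgc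
    have h1 : k (g * c) = k g := by
      rw [← hW', hk, ← hW, hk]
      congr 1
      apply Subtype.ext
      have h2 := hc g
      rw [← hW', ← hW, hΓ.universalFamily_degree, hΓ.universalFamily_degree] at h2
      exact h2
    rw [map_mul] at h1
    exact mul_eq_left.1 h1
  have h1 : f.comp (QuotientGroup.lift _ k hker) = MonoidHom.id _ := by
    refine QuotientGroup.monoidHom_ext _ (universalGroup_hom_ext fun W => ?_)
    simp only [MonoidHom.comp_apply, QuotientGroup.mk'_apply, QuotientGroup.lift_mk, hk, hf,
      MonoidHom.id_apply]
    exact h.target.supportDegree_eq _ (hmap W)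
  have h2 : (QuotientGroup.lift _ k hker).comp f = MonoidHom.id _ := by
    refine universalGroup_hom_ext fun W => ?_
    obtain ⟨hW0, q, hq⟩ := id W.2
    obtain ⟨g, rfl⟩ := h.surj q
    have hg : universalFamily Γ g ≠ ⊥ := (h.ne_bot_iff g).2 (hq ▸ hW0)
    have hgΓ := hΓ.universal.component_mem hg
    have hdeg : universalDegree Γ ⟨_, hgΓ⟩ = g := hΓ.isGradedFamily.toIsDecomp.eq_of_eq
      (hΓ.universalFamily_degree _) (by rwa [hΓ.universalFamily_degree])
    rw [MonoidHom.comp_apply, hf, h.target.supportDegree_eq W hq, MonoidHom.id_apply,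
      QuotientGroup.mk'_apply, QuotientGroup.lift_mk]
    conv_lhs => rw [← hdeg]
    rw [hk]
    congr 1
    exact Subtype.ext hq.symm
  exact ⟨MonoidHom.toMulEquiv f _ h2 h1, hf⟩

end QuotientUniversal

/-! ### Fine graded-simple algebras are loop algebras -/

section Realization

variable {F : Type w} [Field F] [IsAlgClosed F]

/-- Here `U` is the universal group of `Γ'`, `U'` its quotient by the stabilizer of a simple
quotient `A`, and `π` the quotient map. -/
theorem exists_loop_realization {B : Type u} [NonUnitalNonAssocRing B] [Module F B]
    [IsScalarTower F B B] [SMulCommClass F B B] {Γ' : Set (Submodule F B)}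
    [FiniteDimensional F B] (hs : IsGradedSimple Γ') (hfine : IsFineGroupGrading Γ') :
    ∃ (A : Type u) (_ : NonUnitalNonAssocRing A) (_ : Module F A) (_ : IsScalarTower F A A)
      (_ : SMulCommClass F A A) (U U' : Type u) (_ : CommGroup U) (_ : CommGroup U')
      (Γ : Set (Submodule F A)) (δ : Γ → U') (hδ : IsGradingBy Γ δ) (π : U →* U'),
      FiniteDimensional F A ∧ IsSimpleAlgebra F A ∧ IsFineGroupGrading Γ ∧
      IsUniversalGroup Γ δ ∧ Function.Surjective π ∧ Finite π.ker ∧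
      GradingEquivalent Γ' (loopGrading hδ π) := by
  have hΓ := hfine.1
  have hsf : IsGradedSimpleFamily (universalFamily Γ') := by
    rwa [← hΓ.isGradedFamily.isGradedSimple_support_iff, hΓ.support_eq]
  obtain ⟨A, _, _, _, _, p, hp, hps, hA⟩ := exists_simple_quotient
    (IsGradedSimple.productSpan_eq_top hΓ.isGradedFamily (hΓ.support_eq.symm ▸ hs)) hs.1
  have hfin : FiniteDimensional F A := Module.Finite.of_surjective p hps
  have hAc := hA.isCentral
  have h := isLoop_quotientFamily hΓ.isGradedFamily hsf hp hps hAc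
  refine ⟨A, _, _, ‹_›, ‹_›, UniversalGroup Γ', _, _, _, _, _, h.target.isGradingBy,
    QuotientGroup.mk' _, hfin, hA, h.isFine_base (hΓ.support_eq.symm ▸ hfine),
    isUniversalGroup_quotientFamily hΓ hs hp hps hAc, h.surj, h.finite_ker hs.1, ?_⟩
  have := h.exists_equiv (isLoop_loopFamily h.target.isGradingBy _ h.surj)
    (LinearEquiv.refl F A) (fun _ _ => rfl) (MulEquiv.refl _) fun g => by
      rw [h.target.component_supportDegree]
      exact Submodule.map_id _
  rwa [hΓ.support_eq] at this

end Realization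

/-! ### Semisimple algebras and their ideals -/

section Semisimple

variable {F : Type*} [Field F] {A : Type*} [NonUnitalNonAssocRing A] [Module F A]
  {B : Type*} [NonUnitalNonAssocRing B] [Module F B]

theorem isSemisimpleAlgebra_of_finite {ι : Type*} [Finite ι] {I : ι → Submodule F A}
    (hI : ∀ i, IsSimpleIdeal (I i)) (hd : IsDecomp I) : IsSemisimpleAlgebra F A := by
  let e := Finite.equivFin ι
  refine ⟨Nat.card ι, fun k => I (e.symm k), fun k => hI _, IsDecomp.isInternal ⟨?_, ?_⟩⟩
  · exact hd.indep.comp e.symm.injective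
  · rw [← hd.iSup_eq_top]
    exact Equiv.iSup_comp (g := I) e.symm

theorem IsSimpleIdeal.comap {I : Submodule F B} (hI : IsSimpleIdeal I) {φ : A →ₗ[F] B}
    (hφ : ∀ x y, φ (x * y) = φ x * φ y) (hinj : Function.Injective φ)
    (hle : I ≤ LinearMap.range φ) : IsSimpleIdeal (I.comap φ) := by
  refine ⟨hI.1.comap hφ, ?_, fun J hJ hmul => ?_⟩
  · obtain ⟨x, hx, y, hy, hxy⟩ := hI.2.1
    obtain ⟨x, rfl⟩ := hle hx
    obtain ⟨y, rfl⟩ := hle hy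
    exact ⟨x, hx, y, hy, fun h0 => hxy (by rw [← hφ, h0, map_zero])⟩
  · have key : ∀ x ∈ I, ∀ y ∈ J.map φ, x * y ∈ J.map φ ∧ y * x ∈ J.map φ := by
      rintro x hx _ ⟨y, hy, rfl⟩
      obtain ⟨x, rfl⟩ := hle hx
      exact ⟨⟨x * y, (hmul x hx y hy).1, hφ x y⟩, ⟨y * x, (hmul x hx y hy).2, hφ y x⟩⟩
    rcases hI.2.2 _ (Submodule.map_le_iff_le_comap.2 hJ) key with h | h
    · left
      exact Submodule.map_injective_of_injective hinj (h.trans (Submodule.map_bot φ).symm)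
    · right
      rw [← h, Submodule.comap_map_eq_of_injective hinj]

theorem IsSemisimpleAlgebra.of_equiv (h : IsSemisimpleAlgebra F B) (e : A ≃ₗ[F] B)
    (he : ∀ x y, e (x * y) = e x * e y) : IsSemisimpleAlgebra F A := by
  obtain ⟨n, I, hI, hd⟩ := h
  refine isSemisimpleAlgebra_of_finite (I := fun i => (I i).comap (e : A →ₗ[F] B)) (fun i => ?_)
    ((IsDecomp.of_isInternal hd).comap_equiv e)
  refine (hI i).comap he e.injective ?_
  rw [LinearEquiv.range]
  exact le_top

theorem IsSimpleIdeal.le_or_inf_eq_bot {I S : Submodule F A} (hI : IsSimpleIdeal I)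
    (hS : IsIdeal S) : I ≤ S ∨ I ⊓ S = ⊥ := by
  rcases hI.2.2 (I ⊓ S) inf_le_left (fun x _ y hy =>
    ⟨⟨(hI.1 x y hy.1).1, (hS x y hy.2).1⟩, ⟨(hI.1 x y hy.1).2, (hS x y hy.2).2⟩⟩) with h | h
  · exact Or.inr h
  · exact Or.inl (inf_eq_left.1 h)

theorem IsIdeal.mul_eq_zero {I S : Submodule F A} (hI : IsIdeal I) (hS : IsIdeal S)
    (h : Disjoint I S) {x y : A} (hx : x ∈ I) (hy : y ∈ S) : x * y = 0 ∧ y * x = 0 :=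
  ⟨Submodule.disjoint_def.1 h _ (hI y x hx).2 (hS x y hy).1,
    Submodule.disjoint_def.1 h _ (hI y x hx).1 (hS x y hy).2⟩

theorem IsDecomp.mul_eq_proj_mul {ι : Type*} {I : ι → Submodule F A} (h : IsDecomp I)
    (hI : ∀ i, IsIdeal (I i)) {i : ι} {y : A} (hy : y ∈ I i) (x : A) :
    x * y = h.proj i x * y ∧ y * x = y * h.proj i x := by
  refine h.induction (P := fun x => x * y = h.proj i x * y ∧ y * x = y * h.proj i x)
    (fun j x hx => ?_) (by simp) (fun a b ha hb => ?_) x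
  · by_cases hj : j = i
    · subst hj
      rw [h.proj_of_mem hx]
      exact ⟨rfl, rfl⟩
    · rw [h.proj_of_mem_ne hx hj, zero_mul, mul_zero]
      exact (hI j).mul_eq_zero (hI i) (h.indep.pairwiseDisjoint hj) hx hy
  · rw [map_add, add_mul, add_mul, mul_add, mul_add, ha.1, ha.2, hb.1, hb.2]
    exact ⟨rfl, rfl⟩

/-- A subdirect product of finitely many simple algebras is semisimple. -/
theorem isSemisimpleAlgebra_of_homs {ι : Type*} [Finite ι] (hB : IsSimpleAlgebra F B)
    (p : ι → A →ₗ[F] B) (hp : ∀ i x y, p i (x * y) = p i x * p i y)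
    (hs : ∀ i, Function.Surjective (p i)) (hinj : ∀ x, (∀ i, p i x = 0) → x = 0) :
    IsSemisimpleAlgebra F A := by
  classical
  -- A minimal set `T` of homomorphisms with zero common kernel. The simple ideal `J i` is the
  -- common kernel of all those in `T` other than `i`.
  obtain ⟨T, hT⟩ := Set.Finite.exists_minimal (s := {T : Set ι | ∀ x, (∀ i ∈ T, p i x = 0) → x = 0})
    (Set.toFinite _) ⟨Set.univ, fun x hx => hinj x fun i => hx i trivial⟩
  let J : T → Submodule F A := fun i => ⨅ j : {j : T // j ≠ i}, LinearMap.ker (p j.1.1)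
  have memJ : ∀ {i x}, x ∈ J i ↔ ∀ j : T, j ≠ i → p j.1 x = 0 := by
    intro i x
    simp [J, Submodule.mem_iInf]
  have hideal : ∀ i, IsIdeal (J i) := fun i x y hy => by
    simp only [memJ] at hy ⊢
    refine ⟨fun j hj => ?_, fun j hj => ?_⟩
    · rw [hp, hy j hj, mul_zero]
    · rw [hp, hy j hj, zero_mul]
  have hzero : ∀ {i x}, x ∈ J i → p i.1 x = 0 → x = 0 := by
    intro i x hx h0
    refine hT.1 x fun j hj => ?_
    by_cases hji : (⟨j, hj⟩ : T) = i
    · rw [← hji] at h0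
      exact h0
    · exact memJ.1 hx ⟨j, hj⟩ hji
  -- The image of `J i` under `p i` is an ideal, and it is not zero, since otherwise `i` could be
  -- removed from `T`.
  have hmap : ∀ i : T, (J i).map (p i.1) = ⊤ := by
    intro i
    refine (hB.2 _ ((hideal i).map (hp i.1) (hs i.1))).resolve_left fun h0 => ?_
    have hmem : T \ {i.1} ∈ {T : Set ι | ∀ x, (∀ i ∈ T, p i x = 0) → x = 0} := by
      intro x hx
      have hxJ : x ∈ J i := memJ.2 fun j hj => hx j.1 ⟨j.2, fun h => hj (Subtype.ext h)⟩
      refine hzero hxJ ?_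
      rw [← Submodule.mem_bot F, ← h0]
      exact ⟨x, hxJ, rfl⟩
    exact (hT.2 hmem Set.sdiff_subset i.2).2 rfl
  refine isSemisimpleAlgebra_of_finite (I := J) (fun i => ⟨hideal i, ?_, fun S hS hmul => ?_⟩)
    ⟨?_, ?_⟩
  · obtain ⟨a, b, hab⟩ := hB.1
    obtain ⟨x, hx, rfl⟩ := (hmap i).ge (Submodule.mem_top : a ∈ ⊤)
    obtain ⟨y, hy, rfl⟩ := (hmap i).ge (Submodule.mem_top : b ∈ ⊤)
    exact ⟨x, hx, y, hy, fun h0 => hab (by rw [← hp, h0, map_zero])⟩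
  · have key : IsIdeal (S.map (p i.1)) := by
      rintro b _ ⟨y, hy, rfl⟩
      obtain ⟨x, hx, rfl⟩ := (hmap i).ge (Submodule.mem_top : b ∈ ⊤)
      exact ⟨⟨x * y, (hmul x hx y hy).1, hp _ x y⟩, ⟨y * x, (hmul x hx y hy).2, hp _ y x⟩⟩
    rcases hB.2 _ key with h0 | h1
    · left
      rw [Submodule.eq_bot_iff]
      intro x hx
      refine hzero (hS hx) ?_
      rw [← Submodule.mem_bot F, ← h0]
      exact ⟨x, hx, rfl⟩
    · right
      refine le_antisymm hS fun x hx => ?_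
      obtain ⟨y, hy, hyx⟩ := h1.ge (Submodule.mem_top : p i.1 x ∈ ⊤)
      have := hzero (sub_mem hx (hS hy)) (by rw [map_sub, hyx, sub_self])
      rwa [sub_eq_zero.1 this]
  · intro i
    rw [Submodule.disjoint_def]
    intro x hx hx'
    refine hzero hx ?_
    have : (⨆ j, ⨆ (_ : j ≠ i), J j) ≤ LinearMap.ker (p i.1) :=
      iSup₂_le fun j hj y hy => memJ.1 hy i hj.symm
    exact this hx'
  · rw [eq_top_iff]
    intro x _
    -- The elements `y i` match `x` in one projection each and vanish in the others, so their sum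
    -- agrees with `x` everywhere.
    have hex : ∀ i : T, ∃ y ∈ J i, p i.1 y = p i.1 x := fun i => (hmap i).ge Submodule.mem_top
    choose y hy hyx using hex
    have := Fintype.ofFinite T
    have hx : x = ∑ i, y i := by
      refine sub_eq_zero.1 (hT.1 _ fun j hj => ?_)
      rw [map_sub, map_sum, Finset.sum_eq_single (⟨j, hj⟩ : T)
        (fun i _ hi => memJ.1 (hy i) _ hi.symm) (by simp), hyx, sub_self]
    rw [hx]
    exact sum_mem fun i _ => Submodule.mem_iSup_of_mem i (hy i)

variable [IsScalarTower F A A] [SMulCommClass F A A]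

theorem IsSimpleIdeal.le_or_le_annihilator {I S : Submodule F A} (hI : IsSimpleIdeal I)
    (hS : IsIdeal S) : I ≤ S ∨ I ≤ annihilator S := by
  refine (hI.le_or_inf_eq_bot hS).imp_right fun h x hx y hy => ?_
  exact hI.1.mul_eq_zero hS (disjoint_iff.2 h) hx hy

theorem IsSimpleIdeal.eq_zero {I : Submodule F A} (hI : IsSimpleIdeal I) {x : A} (hx : x ∈ I)
    (h : ∀ y ∈ I, x * y = 0 ∧ y * x = 0) : x = 0 := by
  rcases hI.2.2 (I ⊓ annihilator I) inf_le_left (fun x hx y hy => by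
    rw [(hy.2 x hx).1, (hy.2 x hx).2]
    exact ⟨zero_mem _, zero_mem _⟩) with h0 | h1
  · rw [← Submodule.mem_bot F, ← h0]
    exact ⟨hx, h⟩
  · obtain ⟨a, ha, b, hb, hab⟩ := hI.2.1
    exact absurd ((inf_eq_left.1 h1 ha) b hb).1 hab

theorem IsDecomp.proj_eq_zero {ι : Type*} {I : ι → Submodule F A} (h : IsDecomp I)
    (hI : ∀ i, IsSimpleIdeal (I i)) {i : ι} {x : A}
    (hx : ∀ y ∈ I i, x * y = 0 ∧ y * x = 0) : h.proj i x = 0 := by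
  refine (hI i).eq_zero (h.proj_mem i x) fun y hy => ?_
  have := h.mul_eq_proj_mul (fun i => (hI i).1) hy x
  rw [← this.1, ← this.2]
  exact hx y hy

/-- Ideals of a direct sum of simple ideals are sums of some of these. -/
theorem IsDecomp.eq_iSup_of_isIdeal {ι : Type*} {I : ι → Submodule F A} (h : IsDecomp I)
    (hI : ∀ i, IsSimpleIdeal (I i)) {S : Submodule F A} (hS : IsIdeal S) :
    S = ⨆ i : {i // I i ≤ S}, I i.1 := by
  refine le_antisymm (fun x hx => h.mem_of_proj_mem fun i => ?_) (iSup_le fun i => i.2)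
  rcases (hI i).le_or_le_annihilator hS with hi | hi
  · exact Submodule.mem_iSup_of_mem (⟨i, hi⟩ : {i // I i ≤ S}) (h.proj_mem i x)
  · rw [h.proj_eq_zero hI fun y hy => (hi hy x hx).symm]
    exact zero_mem _

theorem IsDecomp.annihilator_eq_iSup {ι : Type*} {I : ι → Submodule F A} (h : IsDecomp I)
    (hI : ∀ i, IsSimpleIdeal (I i)) {S : Submodule F A} (hS : IsIdeal S) :
    annihilator S = ⨆ i : {i // I i ≤ annihilator S}, I i.1 := by
  refine le_antisymm (fun x hx => h.mem_of_proj_mem fun i => ?_) (iSup_le fun i => i.2)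
  rcases (hI i).le_or_le_annihilator hS with hi | hi
  · rw [h.proj_eq_zero hI fun y hy => hx y (hi hy)]
    exact zero_mem _
  · exact Submodule.mem_iSup_of_mem (⟨i, hi⟩ : {i // I i ≤ annihilator S}) (h.proj_mem i x)

theorem IsSemisimpleAlgebra.isIdeal_annihilator (h : IsSemisimpleAlgebra F A)
    {S : Submodule F A} (hS : IsIdeal S) : IsIdeal (annihilator S) := by
  obtain ⟨n, I, hI, hd⟩ := h
  rw [(IsDecomp.of_isInternal hd).annihilator_eq_iSup hI hS]
  exact isIdeal_iSup fun i => (hI i.1).1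

/-- Each simple summand either lies in `S` or annihilates it. An element of `S` that also kills `S`
is killed by every summand, hence zero. -/
theorem IsSemisimpleAlgebra.isCompl_annihilator (h : IsSemisimpleAlgebra F A)
    {S : Submodule F A} (hS : IsIdeal S) : IsCompl S (annihilator S) := by
  obtain ⟨n, I, hI, hd⟩ := h
  have hd := IsDecomp.of_isInternal hd
  constructor
  · rw [Submodule.disjoint_def]
    refine fun x hx hx' => hd.eq_zero_of_proj fun i => hd.proj_eq_zero hI fun y hy => ?_
    rcases (hI i).le_or_le_annihilator hS with hi | hi
    · exact hx' y (hi hy)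
    · exact (hi hy x hx).symm
  · rw [codisjoint_iff_le_sup, ← hd.iSup_eq_top]
    refine iSup_le fun i => ?_
    rcases (hI i).le_or_le_annihilator hS with hi | hi
    · exact hi.trans le_sup_left
    · exact hi.trans le_sup_right

theorem IsSemisimpleAlgebra.eq_bot_of_mul_eq_zero (h : IsSemisimpleAlgebra F A)
    {S : Submodule F A} (hS : IsIdeal S) (h0 : ∀ x ∈ S, ∀ y ∈ S, x * y = 0) : S = ⊥ := by
  have hle : S ≤ annihilator S := fun x hx y hy => ⟨h0 x hx y hy, h0 y hy x hx⟩
  exact disjoint_self.1 ((h.isCompl_annihilator hS).disjoint.mono_right hle)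

end Semisimple

/-! ### Semisimplicity of loop algebras -/

section LoopSemisimple

variable {F : Type*} [Field F] {A L : Type*} [NonUnitalNonAssocRing A] [Module F A]
  [NonUnitalNonAssocRing L] [Module F L] {U V : Type*} [CommGroup U] [CommGroup V]
  {ℒ : U → Submodule F L} {𝒜 : V → Submodule F A} {π : U →* V} {p : L →ₗ[F] A}

/-- Multiplication by a character with `χ₀ h ≠ 1` permutes the sum. Such a character exists because
the exponent of `H` is invertible in `F`, so `F` has enough roots of unity. -/
theorem sum_character_eq_zero {H : Type*} [CommGroup H] [Finite H] [IsAlgClosed F]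
    [NeZero (Nat.card H : F)] [Fintype (H →* Fˣ)] {h : H} (hh : h ≠ 1) :
    ∑ χ : H →* Fˣ, (χ h : F) = 0 := by
  have : NeZero (Monoid.exponent H : F) := by
    refine ⟨fun h0 => NeZero.ne (Nat.card H : F) ?_⟩
    obtain ⟨c, hc⟩ := Group.exponent_dvd_nat_card (G := H)
    rw [hc, Nat.cast_mul, h0, zero_mul]
  obtain ⟨χ₀, hχ₀⟩ := CommGroup.exists_apply_ne_one_of_hasEnoughRootsOfUnity H F hh
  have h1 : (χ₀ h : F) * ∑ χ : H →* Fˣ, (χ h : F) = ∑ χ : H →* Fˣ, (χ h : F) := by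
    rw [Finset.mul_sum]
    refine Fintype.sum_equiv (Equiv.mulLeft χ₀) _ _ fun χ => ?_
    simp
  by_contra h0
  exact hχ₀ (Units.ext (mul_right_cancel₀ h0 (h1.trans (one_mul _).symm)))

section

variable [IsScalarTower F A A] [SMulCommClass F A A]

/-- Each character of the kernel, extended to `U`, twists `p` into another homomorphism onto `A`.
Orthogonality recovers every homogeneous component from the values of these maps, so their common
kernel is zero and `L` is a subdirect product of copies of `A`. -/
theorem IsLoop.isSemisimpleAlgebra_of_card [IsAlgClosed F] [Finite π.ker] [NeZero (Nat.card π.ker : F)]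
    (h : IsLoop ℒ 𝒜 π p) (hA : IsSimpleAlgebra F A) : IsSemisimpleAlgebra F L := by
  have : NeZero (Monoid.exponent π.ker : F) := by
    refine ⟨fun h0 => NeZero.ne (Nat.card π.ker : F) ?_⟩
    obtain ⟨c, hc⟩ := Group.exponent_dvd_nat_card (G := π.ker)
    rw [hc, Nat.cast_mul, h0, zero_mul]
  have hcard := CommGroup.card_monoidHom_of_hasEnoughRootsOfUnity π.ker F
  have : Finite (π.ker →* Fˣ) := Nat.finite_of_card_ne_zero (by rw [hcard]; exact Nat.card_pos.ne')
  have := Fintype.ofFinite (π.ker →* Fˣ)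
  choose ψ hψ using fun χ : π.ker →* Fˣ => exists_extension_units π.ker χ
  choose q hq using fun χ => h.source.toIsDecomp.exists_linearMap
    fun g => (ψ χ g : F) • p ∘ₗ (ℒ g).subtype
  have hq : ∀ χ g, ∀ x ∈ ℒ g, q χ x = (ψ χ g : F) • p x := fun χ g x hx => hq χ g ⟨x, hx⟩
  refine isSemisimpleAlgebra_of_homs hA q (fun χ x y => ?_) (fun χ a => ?_) fun x hx => ?_
  · refine h.source.toIsDecomp.induction (P := fun x => q χ (x * y) = q χ x * q χ y)
      (fun g x hx => ?_) (by simp) (fun a b ha hb => by rw [add_mul, map_add, ha, hb, map_add,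
        add_mul]) x
    refine h.source.toIsDecomp.induction (P := fun y => q χ (x * y) = q χ x * q χ y)
      (fun k y hy => ?_) (by simp) (fun a b ha hb => by rw [mul_add, map_add, ha, hb, map_add,
        mul_add]) y
    rw [hq χ _ _ hx, hq χ _ _ hy, hq χ _ _ (h.source.mul_mem hx hy), h.map_mul, _root_.map_mul,
      Units.val_mul, smul_mul_assoc, mul_smul_comm, smul_smul]
  · refine h.target.toIsDecomp.induction (P := fun a => ∃ x, q χ x = a) (fun v a ha => ?_)
      ⟨0, map_zero _⟩ ?_ a
    · obtain ⟨g, rfl⟩ := h.surj v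
      obtain ⟨x, hx, rfl⟩ := h.exists_mem ha
      refine ⟨((ψ χ g)⁻¹ : F) • x, ?_⟩
      rw [map_smul, hq χ g x hx, smul_smul, inv_mul_cancel₀ (Units.ne_zero _), one_smul]
    · rintro _ _ ⟨x, rfl⟩ ⟨y, rfl⟩
      exact ⟨x + y, map_add _ x y⟩
  · refine h.source.toIsDecomp.eq_zero_of_proj fun g => ?_
    -- Fourier inversion: in degrees outside `g * π.ker` the lift to degree `g` vanishes, and inside
    -- this coset the character sum selects `g`.
    have key : ∑ χ, ((ψ χ g)⁻¹ : F) • h.section g ∘ₗ q χ =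
        (Nat.card π.ker : F) • h.source.toIsDecomp.proj g := by
      refine h.source.toIsDecomp.hom_ext fun k x hx => ?_
      simp only [LinearMap.sum_apply, LinearMap.smul_apply, LinearMap.comp_apply, hq _ k x hx,
        map_smul, smul_smul, ← Finset.sum_smul]
      by_cases hk : π k = π g
      · have hmem : g⁻¹ * k ∈ π.ker := by
          rw [MonoidHom.mem_ker, _root_.map_mul, map_inv, hk, inv_mul_cancel]
        have hsum : ∑ χ, ((ψ χ g)⁻¹ : F) * (ψ χ k : F) =
            ∑ χ : π.ker →* Fˣ, (χ ⟨g⁻¹ * k, hmem⟩ : F) := by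
          refine Finset.sum_congr rfl fun χ _ => ?_
          rw [← hψ, _root_.map_mul, map_inv, Units.val_mul, Units.val_inv_eq_inv_val]
        rw [hsum]
        by_cases hgk : g = k
        · subst hgk
          rw [h.source.toIsDecomp.proj_of_mem hx, h.section_map hx]
          have h1 : (⟨g⁻¹ * g, hmem⟩ : π.ker) = 1 := Subtype.ext (inv_mul_cancel g)
          rw [h1, ← hcard, Nat.card_eq_fintype_card]
          simp only [map_one, Units.val_one, Finset.sum_const, Finset.card_univ, nsmul_eq_mul,
            mul_one]
        · rw [sum_character_eq_zero, zero_smul, h.source.toIsDecomp.proj_of_mem_ne hx (Ne.symm hgk),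
            smul_zero]
          intro h1
          exact hgk (inv_mul_eq_one.1 (congrArg Subtype.val h1))
      · have h1 : h.section g (p x) = 0 := by
          refine h.eq_zero g _ (h.section_mem g _) ?_
          rw [h.map_section, h.target.toIsDecomp.proj_of_mem_ne (h.mem hx) hk]
        rw [h1, h.source.toIsDecomp.proj_of_mem_ne hx (fun e => hk (congrArg π e)), smul_zero,
          smul_zero]
    have := LinearMap.congr_fun key x
    simp only [LinearMap.sum_apply, LinearMap.smul_apply, LinearMap.comp_apply, hx, map_zero,
      smul_zero, Finset.sum_const_zero] at this
    exact (smul_eq_zero.1 this.symm).resolve_left (NeZero.ne _)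

end

variable [IsScalarTower F L L] [SMulCommClass F L L]

/-- If the order vanishes in `F`, the sum `N` of all translations satisfies `N² = |ker π| N = 0`.
Its range is an ideal of square zero, so it is zero by semisimplicity. But the part of `N x` in the
degree of a homogeneous `x` is `x` itself. -/
theorem IsLoop.card_ker_ne_zero [Finite π.ker] (h : IsLoop ℒ 𝒜 π p)
    (h0 : ∃ a b : A, a * b ≠ 0) (hL : IsSemisimpleAlgebra F L) : (Nat.card π.ker : F) ≠ 0 := by
  intro hcard
  have := Fintype.ofFinite π.ker
  let N : L →ₗ[F] L := ∑ k, h.translation k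
  have hN : ∀ x, N x = ∑ k, h.translation k x := fun x => LinearMap.sum_apply _ _ _
  have hmul : ∀ x y, N (x * y) = N x * y ∧ N (x * y) = x * N y := by
    intro x y
    simp only [hN, Finset.sum_mul, Finset.mul_sum]
    exact ⟨Finset.sum_congr rfl fun k _ => (h.translation_mul k x y).1,
      Finset.sum_congr rfl fun k _ => (h.translation_mul k x y).2⟩
  have htr : ∀ k x, h.translation k (N x) = N x := by
    intro k x
    rw [hN, map_sum]
    refine Fintype.sum_equiv (Equiv.mulLeft k) _ _ fun l => ?_
    rw [Equiv.coe_mulLeft, ← h.translation_comp, LinearMap.comp_apply]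
  have hNN : ∀ x, N (N x) = 0 := by
    intro x
    rw [hN, Finset.sum_congr rfl fun k _ => htr k x, Finset.sum_const, Finset.card_univ,
      ← Nat.card_eq_fintype_card, ← Nat.cast_smul_eq_nsmul F, hcard, zero_smul]
  have hbot : LinearMap.range N = ⊥ := by
    refine hL.eq_bot_of_mul_eq_zero ?_ ?_
    · rintro x _ ⟨y, rfl⟩
      exact ⟨⟨x * y, (hmul x y).2⟩, ⟨y * x, (hmul y x).1⟩⟩
    · rintro _ ⟨x, rfl⟩ _ ⟨y, rfl⟩
      rw [← (hmul x _).1, (hmul x _).2, hNN, mul_zero]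
  obtain ⟨v, hv⟩ := h.target.exists_ne_bot h0
  obtain ⟨g, rfl⟩ := h.surj v
  rw [← h.ne_bot_iff] at hv
  obtain ⟨x, hx, hx0⟩ := (Submodule.ne_bot_iff _).1 hv
  apply hx0
  have h1 : h.source.toIsDecomp.proj g (N x) = x := by
    rw [hN, map_sum, Finset.sum_eq_single 1, h.translation_one, LinearMap.id_apply,
      h.source.toIsDecomp.proj_of_mem hx]
    · intro k _ hk
      refine h.source.toIsDecomp.proj_of_mem_ne (h.translation_mem k hx) fun e => hk ?_
      exact Subtype.ext (mul_eq_left.1 e)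
    · simp
  rw [← h1, LinearMap.range_eq_bot.1 hbot, LinearMap.zero_apply, map_zero]

variable [IsScalarTower F A A] [SMulCommClass F A A]

theorem IsLoop.isSemisimpleAlgebra_iff [IsAlgClosed F] [Finite π.ker] (h : IsLoop ℒ 𝒜 π p)
    (hA : IsSimpleAlgebra F A) :
    IsSemisimpleAlgebra F L ↔ ¬ ringChar F ∣ Nat.card π.ker := by
  rw [← ringChar.spec F]
  constructor
  · exact h.card_ker_ne_zero hA.1
  · intro hne
    have : NeZero (Nat.card π.ker : F) := ⟨hne⟩
    exact h.isSemisimpleAlgebra_of_card hA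

end LoopSemisimple

/-! ### The components of a free product group-grading -/

section FreeProduct

variable {F : Type w} [Field F] {n : ℕ} {C : Fin n → Type u}
  [∀ i, NonUnitalNonAssocRing (C i)] [∀ i, Module F (C i)] {Δ : ∀ i, Set (Submodule F (C i))}

theorem single_mul (i : Fin n) (x : C i) (y : ∀ i, C i) :
    LinearMap.single F C i x * y = LinearMap.single F C i (x * y i) ∧
      y * LinearMap.single F C i x = LinearMap.single F C i (y i * x) := by
  constructor
  · funext j
    by_cases h : j = i
    · subst h; simp
    · simp [Pi.single_eq_of_ne h]
  · funext j
    by_cases h : j = i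
    · subst h; simp
    · simp [Pi.single_eq_of_ne h]

theorem single_mul_single (i : Fin n) (x y : C i) :
    LinearMap.single F C i (x * y) = LinearMap.single F C i x * LinearMap.single F C i y := by
  rw [(single_mul i x _).1]
  simp

theorem single_injective (i : Fin n) : Function.Injective (LinearMap.single F C i) :=
  Pi.single_injective i

theorem sum_single (x : ∀ i, C i) : ∑ i, LinearMap.single F C i (x i) = x := by
  simpa using Finset.univ_sum_single x

theorem isGrading_productGrading (h : ∀ i, IsGrading (Δ i)) : IsGrading (productGrading Δ) where
  ne_bot := by
    intro U hU
    obtain ⟨i, V, hV, rfl⟩ := Set.mem_iUnion.1 hU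
    intro h0
    exact (h i).ne_bot V hV (Submodule.map_injective_of_injective (single_injective i)
      (h0.trans (Submodule.map_bot _).symm))
  indep := by
    intro U hU
    obtain ⟨i, V, hV, rfl⟩ := Set.mem_iUnion.1 hU
    rw [Submodule.disjoint_def]
    rintro _ ⟨x, hx, rfl⟩ hx'
    have hle : sSup (productGrading Δ \ {V.map (LinearMap.single F C i)}) ≤
        (sSup (Δ i \ {V})).comap (LinearMap.proj i) := by
      refine sSup_le fun W hW => ?_
      obtain ⟨j, W, hWj, rfl⟩ := Set.mem_iUnion.1 hW.1
      rintro _ ⟨y, hy, rfl⟩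
      by_cases hj : j = i
      · subst hj
        have : W ≠ V := fun e => hW.2 (e ▸ rfl)
        simpa using (le_sSup (a := W) ⟨hWj, this⟩ : W ≤ sSup (Δ j \ {V})) hy
      · simp [Pi.single_eq_of_ne (Ne.symm hj)]
    have h1 := hle hx'
    simp only [Submodule.mem_comap, LinearMap.proj_apply, LinearMap.single_apply,
      Pi.single_eq_same] at h1
    rw [Submodule.disjoint_def.1 ((h i).indep hV) x hx h1, map_zero]
  sSup_eq_top := by
    rw [eq_top_iff]
    intro x _
    rw [← sum_single (F := F) x]
    refine sum_mem fun i _ => ?_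
    suffices hle : (⊤ : Submodule F (C i)) ≤
        (sSup (productGrading Δ)).comap (LinearMap.single F C i) from hle (x := x i) trivial
    rw [← (h i).sSup_eq_top]
    refine sSup_le fun V hV => ?_
    rw [← Submodule.map_le_iff_le_comap]
    exact le_sSup (Set.mem_iUnion.2 ⟨i, V, hV, rfl⟩)
  exists_mulLE := by
    intro U hU V hV
    obtain ⟨i, U, hUi, rfl⟩ := Set.mem_iUnion.1 hU
    obtain ⟨j, V, hVj, rfl⟩ := Set.mem_iUnion.1 hV
    by_cases hij : i = j
    · subst hij
      obtain ⟨W, hW, hle⟩ := (h i).exists_mulLE U hUi V hVj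
      refine ⟨_, Set.mem_iUnion.2 ⟨i, W, hW, rfl⟩, ?_⟩
      rintro _ ⟨x, hx, rfl⟩ _ ⟨y, hy, rfl⟩
      exact ⟨x * y, hle x hx y hy, single_mul_single i x y⟩
    · refine ⟨_, hU, ?_⟩
      rintro _ ⟨x, hx, rfl⟩ _ ⟨y, hy, rfl⟩
      rw [(single_mul i x _).1]
      simp [Pi.single_eq_of_ne hij]

theorem freeProductGrading_eq_support (h : ∀ i, IsGrading (Δ i)) :
    freeProductGrading Δ = support (universalFamily (productGrading Δ)) := by
  ext S
  constructor
  · rintro ⟨_, ⟨U, rfl⟩, rfl⟩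
    refine mem_support fun h0 => (isGrading_productGrading h).ne_bot U.1 U.2 ?_
    rw [eq_bot_iff, ← h0]
    exact le_component _ U
  · rintro ⟨h0, g, rfl⟩
    refine ⟨g, ?_, rfl⟩
    by_contra hg
    refine h0 (eq_bot_iff.2 (component_le fun U hU => ?_))
    exact absurd ⟨U, hU⟩ hg

/-- The components of the free product group-grading, indexed by the product of the universal
groups. -/
def freeFamily (Δ : ∀ i, Set (Submodule F (C i))) (g : ∀ i, UniversalGroup (Δ i)) :
    Submodule F (∀ i, C i) where
  carrier := {x | ∀ i, x i ∈ universalFamily (Δ i) (g i) ∧ ∀ j, j ≠ i → g j ≠ 1 → x i = 0}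
  add_mem' := fun {x y} hx hy i => ⟨add_mem (hx i).1 (hy i).1, fun j hj hg => by
    rw [Pi.add_apply, (hx i).2 j hj hg, (hy i).2 j hj hg, add_zero]⟩
  zero_mem' := fun i => ⟨zero_mem _, fun _ _ _ => rfl⟩
  smul_mem' := fun c x hx i => ⟨Submodule.smul_mem _ c (hx i).1, fun j hj hg => by
    rw [Pi.smul_apply, (hx i).2 j hj hg, smul_zero]⟩

/-- The nonzero components lie in degrees on the coordinate axes of the product of groups. The axes
meet only in degree one, the only degree that mixes several factors. -/
theorem mulSingle_of_ne_zero {g : ∀ i, UniversalGroup (Δ i)} {x : ∀ i, C i}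
    (hx : x ∈ freeFamily Δ g) {i : Fin n} (hi : x i ≠ 0) : g = Pi.mulSingle i (g i) := by
  funext j
  by_cases hj : j = i
  · subst hj; simp
  · rw [Pi.mulSingle_eq_of_ne hj]
    by_contra hg
    exact hi ((hx i).2 j hj hg)

theorem eq_one_of_ne_zero {g : ∀ i, UniversalGroup (Δ i)} {x : ∀ i, C i}
    (hx : x ∈ freeFamily Δ g) {i j : Fin n} (hij : i ≠ j) (hi : x i ≠ 0) (hj : x j ≠ 0) :
    g = 1 := by
  funext k
  by_contra hk
  by_cases hki : k = i
  · exact hj ((hx j).2 k (hki ▸ hij) hk)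
  · exact hi ((hx i).2 k hki hk)

theorem single_mem_freeFamily {i : Fin n} {u : UniversalGroup (Δ i)} {x : C i}
    (hx : x ∈ universalFamily (Δ i) u) :
    LinearMap.single F C i x ∈ freeFamily Δ (Pi.mulSingle i u) := by
  intro k
  by_cases hk : k = i
  · subst hk
    simp only [LinearMap.single_apply, Pi.single_eq_same, Pi.mulSingle_eq_same]
    exact ⟨hx, fun j hj hg => absurd (Pi.mulSingle_eq_of_ne hj _) hg⟩
  · simp only [LinearMap.single_apply, Pi.single_eq_of_ne hk]
    exact ⟨zero_mem _, fun _ _ _ => trivial⟩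

theorem single_apply_mem_freeFamily {g : ∀ i, UniversalGroup (Δ i)} {x : ∀ i, C i}
    (hx : x ∈ freeFamily Δ g) (i : Fin n) :
    LinearMap.single F C i (x i) ∈ freeFamily Δ g := by
  by_cases hi : x i = 0
  · rw [hi, map_zero]; exact zero_mem _
  · rw [mulSingle_of_ne_zero hx hi]
    exact single_mem_freeFamily (hx i).1

theorem isGradedFamily_freeFamily (h : ∀ i, IsGroupGrading (Δ i)) :
    IsGradedFamily (freeFamily Δ) where
  indep := by
    classical
    rw [iSupIndep_iff_finsetSum_eq_zero_imp_eq_zero]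
    intro s v hv h0 g hg
    -- The projection onto degree `g`: a coordinate survives only if `g` is trivial at all other
    -- indices.
    let q : (∀ i, C i) →ₗ[F] ∀ i, C i := LinearMap.pi fun i =>
      if ∀ j, j ≠ i → g j = 1 then
        ((h i).isGradedFamily.toIsDecomp.proj (g i)) ∘ₗ LinearMap.proj i else 0
    have hq : ∀ x i, q x i = if ∀ j, j ≠ i → g j = 1 then
        (h i).isGradedFamily.toIsDecomp.proj (g i) (x i) else 0 := by
      intro x i
      simp only [q, LinearMap.pi_apply]
      split_ifs <;> rfl
    have hq1 : q (v g) = v g := by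
      funext i
      rw [hq]
      split_ifs with hc
      · exact (h i).isGradedFamily.toIsDecomp.proj_of_mem (hv g hg i).1
      · push Not at hc
        obtain ⟨j, hj, hgj⟩ := hc
        exact ((hv g hg i).2 j hj hgj).symm
    have hq2 : ∀ k ∈ s, k ≠ g → q (v k) = 0 := by
      intro k hk hkg
      funext i
      rw [hq]
      split_ifs with hc
      · by_cases hi : v k i = 0
        · rw [hi, map_zero]; rfl
        · refine (h i).isGradedFamily.toIsDecomp.proj_of_mem_ne (hv k hk i).1 fun e => hkg ?_
          rw [mulSingle_of_ne_zero (hv k hk) hi, e]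
          funext j
          by_cases hj : j = i
          · subst hj; simp
          · rw [Pi.mulSingle_eq_of_ne hj, hc j hj]
      · rfl
    rw [← hq1, ← map_zero q, ← h0, map_sum]
    exact (Finset.sum_eq_single_of_mem g hg hq2).symm
  iSup_eq_top := by
    rw [eq_top_iff]
    intro x _
    rw [← sum_single (F := F) x]
    refine sum_mem fun i _ => ?_
    refine (h i).isGradedFamily.toIsDecomp.induction
      (P := fun y => LinearMap.single F C i y ∈ iSup (freeFamily Δ)) (fun u y hy => ?_)
      (by rw [map_zero]; exact zero_mem _)
      (fun a b ha hb => by rw [map_add]; exact add_mem ha hb) (x i)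
    exact Submodule.mem_iSup_of_mem _ (single_mem_freeFamily hy)
  mul_mem := by
    intro g k x y hx hy i
    refine ⟨(h i).isGradedFamily.mul_mem (hx i).1 (hy i).1, fun j hj hgk => ?_⟩
    rw [Pi.mul_apply]
    by_cases hg : g j = 1
    · rw [(hy i).2 j hj fun hk => hgk (by rw [Pi.mul_apply, hg, hk, one_mul]), mul_zero]
    · rw [(hx i).2 j hj hg, zero_mul]

/-- The free product group-grading is the finest among the group-gradings that are coarser than
the product grading. -/
theorem exists_freeFamily_le {K : Type*} [CommGroup K] {ℬ : K → Submodule F (∀ i, C i)}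
    (hℬ : IsGradedFamily ℬ)
    (hle : ∀ i, ∀ U ∈ Δ i, ∃ k, U.map (LinearMap.single F C i) ≤ ℬ k) :
    ∃ f : (∀ i, UniversalGroup (Δ i)) →* K, ∀ g, freeFamily Δ g ≤ ℬ (f g) := by
  choose d hd using hle
  have hdeg : ∀ i, IsDegree fun U : Δ i => d i U.1 U.2 := by
    rintro i U V W ⟨x, hx, y, hy, hxy⟩ hle
    refine hℬ.toIsDecomp.eq_of_mem_of_mem (x := LinearMap.single F C i (x * y)) ?_
      (hd i _ W.2 ⟨_, hle x hx y hy, rfl⟩) ?_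
    · rw [single_mul_single]
      exact hℬ.mul_mem (hd i _ U.2 ⟨x, hx, rfl⟩) (hd i _ V.2 ⟨y, hy, rfl⟩)
    · exact fun h0 => hxy (single_injective i (h0.trans (map_zero _).symm))
  choose f hf using fun i => exists_universalGroup_hom (hdeg i)
  have hf' : ∀ i u, universalFamily (Δ i) u ≤ (ℬ (f i u)).comap (LinearMap.single F C i) := by
    refine fun i u => component_le fun U hU => ?_
    rw [← Submodule.map_le_iff_le_comap, ← hU, hf]
    exact hd i _ U.2
  have hcomm : Pairwise fun i j => ∀ x y, Commute (f i x) (f j y) := fun i j _ x y =>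
    Commute.all _ _
  refine ⟨MonoidHom.noncommPiCoprod f hcomm, fun g x hx => ?_⟩
  rw [← sum_single (F := F) x]
  refine sum_mem fun i _ => ?_
  by_cases hi : x i = 0
  · rw [hi, map_zero]; exact zero_mem _
  · have := hf' i _ (hx i).1
    rw [mulSingle_of_ne_zero hx hi, MonoidHom.noncommPiCoprod_mulSingle]
    exact this

/-- Both families are coarser than the product grading and finest with this property, so each
component of one lies in a component of the other. A nonzero element then forces equality. -/
theorem freeProductGrading_eq (h : ∀ i, IsGroupGrading (Δ i)) :
    freeProductGrading Δ = support (freeFamily Δ) := by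
  have hgr : ∀ i, IsGrading (Δ i) := fun i => (h i).universal.isGrading
  have hP : IsGradedFamily (universalFamily (productGrading Δ)) :=
    (isGrading_productGrading hgr).isGradedFamily_component isDegree_universalDegree
  have hF := isGradedFamily_freeFamily h
  rw [freeProductGrading_eq_support hgr]
  obtain ⟨f, hf⟩ := exists_freeFamily_le (Δ := Δ) hP fun i U hU =>
    ⟨_, le_component (universalDegree (productGrading Δ))
      ⟨U.map (LinearMap.single F C i), Set.mem_iUnion.2 ⟨i, U, hU, rfl⟩⟩⟩
  obtain ⟨f', hf'⟩ := exists_hom_of_refines (Γ := productGrading Δ) hF (by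
    intro V hV
    obtain ⟨i, U, hU, rfl⟩ := Set.mem_iUnion.1 hV
    refine ⟨Pi.mulSingle i (universalDegree _ ⟨U, hU⟩), ?_⟩
    rintro _ ⟨x, hx, rfl⟩
    exact single_mem_freeFamily ((h i).universalFamily_degree ⟨U, hU⟩ ▸ hx))
  refine (hF.isGrading.eq_of_subset ?_ hP.isGrading.sSup_eq_top)
  rintro _ ⟨h0, g, rfl⟩
  obtain ⟨x, hx, hx0⟩ := (Submodule.ne_bot_iff _).1 h0
  refine ⟨h0, f' g, le_antisymm (hf' g) ?_⟩
  have h1 := hf (f' g) (hf' g hx)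
  have h2 := hP.toIsDecomp.eq_of_mem_of_mem hx h1 hx0
  have h3 := hf (f' g)
  rwa [← h2] at h3

end FreeProduct

/-! ### Restriction of gradings to ideals; minimal graded ideals -/

section Comap

variable {F : Type*} [Field F] {A B : Type*} [NonUnitalNonAssocRing A] [Module F A]
  [NonUnitalNonAssocRing B] [Module F B] {G : Type*} [CommGroup G] {𝓑 : G → Submodule F B}

theorem IsDecomp.comap {ι : Type*} {I : ι → Submodule F B} (h : IsDecomp I) {φ : A →ₗ[F] B}
    (hinj : Function.Injective φ) (hφ : ∀ i x, h.proj i (φ x) ∈ LinearMap.range φ) :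
    IsDecomp fun i => (I i).comap φ where
  indep := by
    classical
    rw [iSupIndep_iff_finsetSum_eq_zero_imp_eq_zero]
    intro s v hv h0 i hi
    apply hinj
    rw [map_zero]
    refine (iSupIndep_iff_finsetSum_eq_zero_imp_eq_zero _).1 h.indep s (fun i => φ (v i)) hv ?_ i hi
    rw [← map_sum, h0, map_zero]
  iSup_eq_top := by
    rw [eq_top_iff]
    intro x _
    obtain ⟨s, hs⟩ := h.exists_sum_proj (φ x)
    choose y hy using fun i => hφ i x
    have hx : x = ∑ i ∈ s, y i := by
      apply hinj
      rw [hs s subset_rfl, map_sum]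
      exact Finset.sum_congr rfl fun i _ => (hy i).symm
    rw [hx]
    refine sum_mem fun i _ => Submodule.mem_iSup_of_mem i ?_
    rw [Submodule.mem_comap, hy]
    exact h.proj_mem i _

theorem IsGradedFamily.comap (h : IsGradedFamily 𝓑) {φ : A →ₗ[F] B}
    (hmul : ∀ x y, φ (x * y) = φ x * φ y) (hinj : Function.Injective φ)
    (hφ : ∀ g x, h.toIsDecomp.proj g (φ x) ∈ LinearMap.range φ) :
    IsGradedFamily fun g => (𝓑 g).comap φ :=
  { h.toIsDecomp.comap hinj hφ with
    mul_mem := fun {g k x y} hx hy => by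
      rw [Submodule.mem_comap, hmul]
      exact h.mul_mem hx hy }

theorem IsGradedFamily.comap_equiv (h : IsGradedFamily 𝓑) (e : A ≃ₗ[F] B)
    (hmul : ∀ x y, e (x * y) = e x * e y) :
    IsGradedFamily fun g => (𝓑 g).comap (e : A →ₗ[F] B) :=
  h.comap hmul e.injective fun _ _ => e.range ▸ Submodule.mem_top

theorem IsFineGroupGrading.comap_equiv (h : IsGradedFamily 𝓑)
    (hfine : IsFineGroupGrading (support 𝓑)) (e : A ≃ₗ[F] B)
    (hmul : ∀ x y, e (x * y) = e x * e y) :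
    IsFineGroupGrading (support fun g => (𝓑 g).comap (e : A →ₗ[F] B)) := by
  have hA := h.comap_equiv e hmul
  refine isFineGroupGrading_of_forall_eq hA.isGroupGrading fun Γ₁ hΓ₁ hle => ?_
  have hmul' : ∀ x y, e.symm (x * y) = e.symm x * e.symm y := fun x y => by
    apply e.injective
    simp [hmul]
  have h₁ := hΓ₁.isGradedFamily.comap_equiv e.symm hmul'
  have hcomap : ∀ S : Submodule F A,
      (S.comap (e.symm : B →ₗ[F] A)).comap (e : A →ₗ[F] B) = S := fun S => by
    ext x
    simp
  have heq : support (fun g => (universalFamily Γ₁ g).comap (e.symm : B →ₗ[F] A)) = support 𝓑 := by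
    refine hfine.support_eq_of_refines h₁ fun g hg => ?_
    have hg' : universalFamily Γ₁ g ≠ ⊥ := by
      intro h0
      rw [h0, Submodule.comap_bot, LinearEquiv.ker] at hg
      exact hg rfl
    obtain ⟨V, ⟨hV, k, rfl⟩, hgk⟩ := hle _ (hΓ₁.support_eq ▸ mem_support hg')
    refine ⟨𝓑 k, mem_support fun h0 => hV ?_, fun x hx => ?_⟩
    · beta_reduce
      rw [h0, Submodule.comap_bot, LinearEquiv.ker]
    · simpa using hgk hx
  refine hA.isGrading.eq_of_subset (fun U hU => ?_) hΓ₁.universal.isGrading.sSup_eq_top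
  rw [← hΓ₁.support_eq] at hU
  obtain ⟨h0, g, rfl⟩ := hU
  refine ⟨h0, ?_⟩
  have hmem : (universalFamily Γ₁ g).comap (e.symm : B →ₗ[F] A) ∈ support 𝓑 := by
    rw [← heq]
    refine ⟨fun h1 => h0 ?_, g, rfl⟩
    rw [← hcomap (universalFamily Γ₁ g), h1, Submodule.comap_bot, LinearEquiv.ker]
  obtain ⟨-, k, hk⟩ := hmem
  exact ⟨k, by beta_reduce; rw [← hk, hcomap]⟩

theorem IsGradedFamily.proj_mul (h : IsGradedFamily 𝓑) {k : G} {y : B} (hy : y ∈ 𝓑 k) (g : G)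
    (x : B) : h.toIsDecomp.proj (g * k) (x * y) = h.toIsDecomp.proj g x * y ∧
      h.toIsDecomp.proj (g * k) (y * x) = y * h.toIsDecomp.proj g x := by
  refine h.toIsDecomp.induction (P := fun x =>
    h.toIsDecomp.proj (g * k) (x * y) = h.toIsDecomp.proj g x * y ∧
      h.toIsDecomp.proj (g * k) (y * x) = y * h.toIsDecomp.proj g x) (fun l x hx => ?_) (by simp)
    (fun a b ha hb => by
      rw [add_mul, mul_add, map_add, map_add, map_add, ha.1, ha.2, hb.1, hb.2, add_mul, mul_add]
      exact ⟨rfl, rfl⟩) x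
  have h1 := h.mul_mem hx hy
  have h2 := h.mul_mem hy hx
  rw [mul_comm] at h2
  by_cases hl : l = g
  · subst hl
    rw [h.toIsDecomp.proj_of_mem h1, h.toIsDecomp.proj_of_mem h2, h.toIsDecomp.proj_of_mem hx]
    exact ⟨rfl, rfl⟩
  · have hl' : l * k ≠ g * k := fun e => hl (mul_right_cancel e)
    rw [h.toIsDecomp.proj_of_mem_ne h1 hl', h.toIsDecomp.proj_of_mem_ne h2 hl',
      h.toIsDecomp.proj_of_mem_ne hx hl, zero_mul, mul_zero]
    exact ⟨rfl, rfl⟩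

/-- Ideals of an ideal with a complementary annihilator are ideals. -/
theorem IsIdeal.map_of_sup_annihilator [IsScalarTower F B B] [SMulCommClass F B B]
    {φ : A →ₗ[F] B} (hmul : ∀ x y, φ (x * y) = φ x * φ y)
    (htop : LinearMap.range φ ⊔ annihilator (LinearMap.range φ) = ⊤) {I : Submodule F A}
    (hI : IsIdeal I) : IsIdeal (I.map φ) := by
  rintro x _ ⟨y, hy, rfl⟩
  obtain ⟨_, ⟨a, rfl⟩, b, hb, rfl⟩ := Submodule.mem_sup.1 (htop.ge (Submodule.mem_top : x ∈ ⊤))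
  have hb' := hb (φ y) ⟨y, rfl⟩
  rw [add_mul, mul_add, hb'.1, hb'.2, add_zero, add_zero]
  exact ⟨⟨a * y, (hI a y hy).1, hmul a y⟩, ⟨y * a, (hI a y hy).2, hmul y a⟩⟩

/-- Graded ideals, in terms of the projections. -/
structure IsGradedIdeal (h : IsGradedFamily 𝓑) (S : Submodule F B) : Prop where
  isIdeal : IsIdeal S
  proj_mem : ∀ x ∈ S, ∀ g, h.toIsDecomp.proj g x ∈ S

theorem IsGradedFamily.isGradedIdeal_iff (h : IsGradedFamily 𝓑) {S : Submodule F B} :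
    IsGradedIdeal h S ↔ IsIdeal S ∧ IsGradedSubspace (support 𝓑) S := by
  rw [h.isGradedSubspace_iff]
  exact ⟨fun hS => ⟨hS.1, hS.2⟩, fun hS => ⟨hS.1, hS.2⟩⟩

theorem IsGradedIdeal.inf {h : IsGradedFamily 𝓑} {S T : Submodule F B} (hS : IsGradedIdeal h S)
    (hT : IsGradedIdeal h T) : IsGradedIdeal h (S ⊓ T) :=
  ⟨hS.1.inf hT.1, fun x hx g => ⟨hS.2 x hx.1 g, hT.2 x hx.2 g⟩⟩

theorem isGradedIdeal_iSup {ι : Sort*} {h : IsGradedFamily 𝓑} {S : ι → Submodule F B}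
    (hS : ∀ i, IsGradedIdeal h (S i)) : IsGradedIdeal h (iSup S) := by
  refine ⟨isIdeal_iSup fun i => (hS i).1, fun x hx g => ?_⟩
  have : iSup S ≤ (iSup S).comap (h.toIsDecomp.proj g) :=
    iSup_le fun i y hy => Submodule.mem_iSup_of_mem i ((hS i).2 y hy g)
  exact this hx

/-- Minimal graded ideals. -/
structure IsMinimalGradedIdeal (h : IsGradedFamily 𝓑) (S : Submodule F B) : Prop
    extends IsGradedIdeal h S where
  ne_bot : S ≠ ⊥
  eq_bot_or_eq : ∀ T, IsGradedIdeal h T → T ≤ S → T = ⊥ ∨ T = S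

variable [IsScalarTower F B B] [SMulCommClass F B B]

/-- For homogeneous `y` in `S`, the homogeneous parts of `x * y = 0` have distinct degrees, so they
vanish separately; `S` is spanned by such `y`. -/
theorem IsGradedFamily.proj_mem_annihilator (h : IsGradedFamily 𝓑) {S : Submodule F B}
    (hS : ∀ x ∈ S, ∀ g, h.toIsDecomp.proj g x ∈ S) {x : B} (hx : x ∈ annihilator S) (g : G) :
    h.toIsDecomp.proj g x ∈ annihilator S := by
  intro y hy
  have key : ∀ k, h.toIsDecomp.proj g x * h.toIsDecomp.proj k y = 0 ∧
      h.toIsDecomp.proj k y * h.toIsDecomp.proj g x = 0 := by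
    intro k
    have h1 := h.proj_mul (h.toIsDecomp.proj_mem k y) g x
    have h2 := hx _ (hS y hy k)
    rw [h2.1, h2.2, map_zero] at h1
    exact ⟨h1.1.symm, h1.2.symm⟩
  obtain ⟨s, hs⟩ := h.toIsDecomp.exists_sum_proj y
  rw [hs s subset_rfl, Finset.mul_sum, Finset.sum_mul]
  exact ⟨Finset.sum_eq_zero fun k _ => (key k).1, Finset.sum_eq_zero fun k _ => (key k).2⟩

/-- Distinct minimal graded ideals meet in zero, so all others lie in the annihilator of a given
one, which is complementary to it: this is independence. If their sum were not everything, its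
annihilator would be a nonzero graded ideal and contain another minimal one. -/
theorem exists_minimalGradedIdeals [FiniteDimensional F B] (h : IsGradedFamily 𝓑)
    (hB : IsSemisimpleAlgebra F B) :
    ∃ (n : ℕ) (J : Fin n → Submodule F B), IsDecomp J ∧ ∀ i, IsMinimalGradedIdeal h (J i) := by
  let M : Set (Submodule F B) := {S | IsMinimalGradedIdeal h S}
  have hindep : sSupIndep M := by
    intro S hS
    refine (hB.isCompl_annihilator hS.isIdeal).disjoint.mono_right (sSup_le fun T hT => ?_)
    have hTM : IsMinimalGradedIdeal h T := hT.1
    have hdisj : T ⊓ S = ⊥ := by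
      rcases hTM.eq_bot_or_eq _ (hTM.toIsGradedIdeal.inf hS.toIsGradedIdeal) inf_le_left with h0 | h1
      · exact h0
      · rcases hS.eq_bot_or_eq T hTM.toIsGradedIdeal (inf_eq_left.1 h1) with h2 | h2
        · exact absurd h2 hTM.ne_bot
        · exact absurd h2 hT.2
    exact fun x hx y hy => hTM.isIdeal.mul_eq_zero hS.isIdeal (disjoint_iff.2 hdisj) hx hy
  have htop : sSup M = ⊤ := by
    have hgr : IsGradedIdeal h (sSup M) := by
      rw [sSup_eq_iSup']
      exact isGradedIdeal_iSup fun S => S.2.toIsGradedIdeal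
    have hcompl := hB.isCompl_annihilator hgr.isIdeal
    suffices h0 : annihilator (sSup M) = ⊥ by
      have := hcompl.sup_eq_top
      rwa [h0, sup_bot_eq] at this
    by_contra hne
    have hgr' : IsGradedIdeal h (annihilator (sSup M)) :=
      ⟨hB.isIdeal_annihilator hgr.isIdeal, fun x hx g => h.proj_mem_annihilator hgr.proj_mem hx g⟩
    obtain ⟨S, ⟨hS, hS0, hSle⟩, hmin⟩ := WellFounded.has_min
      (wellFounded_lt : WellFounded ((· < ·) : Submodule F B → Submodule F B → Prop))
      {S | IsGradedIdeal h S ∧ S ≠ ⊥ ∧ S ≤ annihilator (sSup M)} ⟨_, hgr', hne, le_rfl⟩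
    have hSM : IsMinimalGradedIdeal h S := by
      refine ⟨hS, hS0, fun T hT hTS => ?_⟩
      by_contra! hT'
      exact hmin T ⟨hT, hT'.1, hTS.trans hSle⟩ (lt_of_le_of_ne hTS hT'.2)
    exact hS0 (disjoint_self.1 (hcompl.disjoint.mono (le_sSup (show S ∈ M from hSM)) hSle))
  have hfin : Finite M := WellFoundedGT.finite_of_sSupIndep hindep
  let e := Finite.equivFin M
  refine ⟨Nat.card M, fun i => (e.symm i).1, ⟨?_, ?_⟩, fun i => (e.symm i).2⟩
  · exact ((sSupIndep_iff M).1 hindep).comp e.symm.injective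
  · rw [← htop, sSup_eq_iSup']
    exact Equiv.iSup_comp (g := fun S : M => S.1) e.symm

/-- A graded ideal of the summand is a graded ideal of `B`, because the annihilator supplies a
complement that multiplies it to zero. -/
theorem IsMinimalGradedIdeal.isGradedSimple {h : IsGradedFamily 𝓑} {φ : A →ₗ[F] B}
    (hS : IsMinimalGradedIdeal h (LinearMap.range φ)) (hmul : ∀ x y, φ (x * y) = φ x * φ y)
    (hinj : Function.Injective φ)
    (htop : LinearMap.range φ ⊔ annihilator (LinearMap.range φ) = ⊤)
    (h0 : ∃ x y : A, x * y ≠ 0) : IsGradedSimple (support fun g => (𝓑 g).comap φ) := by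
  have hgr : ∀ g x, h.toIsDecomp.proj g (φ x) ∈ LinearMap.range φ :=
    fun g x => hS.proj_mem _ ⟨x, rfl⟩ g
  have hA := h.comap hmul hinj hgr
  refine ⟨h0, fun I hI hIgr => ?_⟩
  rw [hA.isGradedSubspace_iff] at hIgr
  have hproj : ∀ g x, φ (hA.toIsDecomp.proj g x) = h.toIsDecomp.proj g (φ x) := by
    intro g x
    refine hA.toIsDecomp.induction (P := fun x => φ (hA.toIsDecomp.proj g x) =
      h.toIsDecomp.proj g (φ x)) (fun k x hx => ?_) (by simp)
      (fun a b ha hb => by simp only [map_add, ha, hb]) x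
    by_cases hk : k = g
    · subst hk
      rw [hA.toIsDecomp.proj_of_mem hx, h.toIsDecomp.proj_of_mem hx]
    · rw [hA.toIsDecomp.proj_of_mem_ne hx hk, h.toIsDecomp.proj_of_mem_ne hx hk, map_zero]
  have hmap : IsGradedIdeal h (I.map φ) := by
    refine ⟨hI.map_of_sup_annihilator hmul htop, ?_⟩
    rintro _ ⟨x, hx, rfl⟩ g
    exact ⟨_, hIgr x hx g, hproj g x⟩
  rcases hS.eq_bot_or_eq _ hmap (LinearMap.map_le_range) with h1 | h1
  · left
    exact Submodule.map_injective_of_injective hinj (h1.trans (Submodule.map_bot φ).symm)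
  · right
    exact Submodule.map_injective_of_injective hinj (h1.trans (Submodule.map_top φ).symm)

end Comap

/-! ### Ideals as subalgebras -/

section Subalgebra

variable {F : Type*} [Field F] {A : Type*} [NonUnitalNonAssocRing A] [Module F A]
  {I : Submodule F A}

/-- An ideal as a subalgebra. -/
def IsIdeal.subalgebra (hI : IsIdeal I) : NonUnitalSubalgebra F A where
  __ := I
  mul_mem' := fun {x y} _ hy => (hI x y hy).1

/-- The inclusion of an ideal. -/
def IsIdeal.inclusion (hI : IsIdeal I) : hI.subalgebra →ₗ[F] A where
  toFun := Subtype.val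
  map_add' := fun _ _ => rfl
  map_smul' := fun _ _ => rfl

theorem IsIdeal.inclusion_mul (hI : IsIdeal I) (x y : hI.subalgebra) :
    hI.inclusion (x * y) = hI.inclusion x * hI.inclusion y := rfl

theorem IsIdeal.inclusion_injective (hI : IsIdeal I) : Function.Injective hI.inclusion :=
  Subtype.val_injective

theorem IsIdeal.range_inclusion (hI : IsIdeal I) : LinearMap.range hI.inclusion = I := by
  ext x
  exact ⟨fun ⟨y, hy⟩ => hy ▸ y.2, fun hx => ⟨⟨x, hx⟩, rfl⟩⟩

variable [IsScalarTower F A A] [SMulCommClass F A A]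

theorem IsSemisimpleAlgebra.subalgebra (hA : IsSemisimpleAlgebra F A) (hI : IsIdeal I) :
    IsSemisimpleAlgebra F hI.subalgebra := by
  obtain ⟨n, S, hS, hd⟩ := hA
  have hd := IsDecomp.of_isInternal hd
  have hle : ∀ i : {i // S i ≤ I}, S i.1 ≤ LinearMap.range hI.inclusion := fun i => by
    rw [hI.range_inclusion]
    exact i.2
  refine isSemisimpleAlgebra_of_finite (fun i : {i // S i ≤ I} =>
    (hS i.1).comap hI.inclusion_mul hI.inclusion_injective (hle i)) ⟨?_, ?_⟩
  · have := hd.comap hI.inclusion_injective fun i x => ?_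
    · exact this.indep.comp Subtype.val_injective
    · rw [hI.range_inclusion]
      rcases (hS i).le_or_le_annihilator hI with hi | hi
      · exact hi (hd.proj_mem i _)
      · have h0 : hd.proj i (hI.inclusion x) = 0 :=
          hd.proj_eq_zero hS fun y hy => (hi hy _ x.2).symm
        rw [h0]
        exact zero_mem _
  · refine Submodule.map_injective_of_injective hI.inclusion_injective ?_
    rw [Submodule.map_iSup, Submodule.map_top, hI.range_inclusion]
    refine Eq.trans ?_ (hd.eq_iSup_of_isIdeal hS hI).symm
    refine iSup_congr fun i => ?_
    rw [Submodule.map_comap_eq, inf_eq_right.2 (hle i)]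

end Subalgebra

/-! ### The factors of a free product group-grading -/

section FreeProduct

variable {F : Type w} [Field F] {n : ℕ} {C : Fin n → Type u}
  [∀ i, NonUnitalNonAssocRing (C i)] [∀ i, Module F (C i)] {Δ : ∀ i, Set (Submodule F (C i))}

theorem comap_single_freeFamily (i : Fin n) (u : UniversalGroup (Δ i)) :
    (freeFamily Δ (Pi.mulSingle i u)).comap (LinearMap.single F C i) =
      universalFamily (Δ i) u := by
  ext x
  constructor
  · intro hx
    have := (hx i).1
    rwa [LinearMap.single_apply, Pi.single_eq_same, Pi.mulSingle_eq_same] at this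
  · exact fun hx => single_mem_freeFamily hx

/-- The factors of a free product group-grading. -/
theorem mem_iff_of_freeProductGrading (h : ∀ i, IsGroupGrading (Δ i)) (i : Fin n)
    {V : Submodule F (C i)} :
    V ∈ Δ i ↔ V ≠ ⊥ ∧ ∃ S ∈ freeProductGrading Δ, V = S.comap (LinearMap.single F C i) := by
  rw [freeProductGrading_eq h]
  constructor
  · intro hV
    have h0 := (h i).universal.isGrading.ne_bot V hV
    have heq : V = (freeFamily Δ (Pi.mulSingle i (universalDegree (Δ i) ⟨V, hV⟩))).comap
        (LinearMap.single F C i) := by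
      rw [comap_single_freeFamily, (h i).universalFamily_degree]
    refine ⟨h0, _, mem_support fun h1 => h0 ?_, heq⟩
    rw [heq, h1, Submodule.comap_bot, LinearMap.ker_eq_bot.2 (single_injective i)]
  · rintro ⟨h0, S, ⟨-, g, rfl⟩, rfl⟩
    obtain ⟨x, hx, hx0⟩ := (Submodule.ne_bot_iff _).1 h0
    have hg : g = Pi.mulSingle i (g i) := mulSingle_of_ne_zero hx (by
      rwa [LinearMap.single_apply, Pi.single_eq_same])
    rw [hg, comap_single_freeFamily] at h0 ⊢
    exact (h i).support_eq.le (mem_support h0)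

theorem freeProductGrading_injective {Θ : ∀ i, Set (Submodule F (C i))}
    (hΔ : ∀ i, IsGroupGrading (Δ i)) (hΘ : ∀ i, IsGroupGrading (Θ i))
    (h : freeProductGrading Δ = freeProductGrading Θ) : Δ = Θ := by
  funext i
  ext V
  rw [mem_iff_of_freeProductGrading hΔ, mem_iff_of_freeProductGrading hΘ, h]

/-- Refining one factor refines the free product, which therefore does not change; and the free
product determines its factors. -/
theorem isFine_of_freeProductGrading (h : ∀ i, IsGroupGrading (Δ i))
    (hfine : IsFineGroupGrading (freeProductGrading Δ)) (i : Fin n) :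
    IsFineGroupGrading (Δ i) := by
  refine isFineGroupGrading_of_forall_eq (h i) fun Γ₁ hΓ₁ hle => ?_
  have h' : ∀ j, IsGroupGrading (Function.update Δ i Γ₁ j) := by
    intro j
    by_cases hj : j = i
    · subst hj
      rwa [Function.update_self]
    · rw [Function.update_of_ne hj]
      exact h j
  have hle' : ∀ j, ∀ U ∈ Function.update Δ i Γ₁ j, ∃ V ∈ Δ j, U ≤ V := by
    intro j
    by_cases hj : j = i
    · subst hj
      rwa [Function.update_self]
    · rw [Function.update_of_ne hj]
      exact fun U hU => ⟨U, hU, le_rfl⟩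
  obtain ⟨f, hf⟩ := exists_freeFamily_le (Δ := Function.update Δ i Γ₁)
    (isGradedFamily_freeFamily h) (by
      intro j U hU
      obtain ⟨V, hV, hUV⟩ := hle' j U hU
      refine ⟨Pi.mulSingle j (universalDegree _ ⟨V, hV⟩), ?_⟩
      rintro _ ⟨x, hx, rfl⟩
      exact single_mem_freeFamily ((h j).universalFamily_degree ⟨V, hV⟩ ▸ hUV hx))
  have heq : freeProductGrading (Function.update Δ i Γ₁) = freeProductGrading Δ := by
    rw [freeProductGrading_eq h']
    refine hfine.support_eq_of_refines (isGradedFamily_freeFamily h') fun g hg => ?_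
    rw [freeProductGrading_eq h]
    obtain ⟨x, hx, hx0⟩ := (Submodule.ne_bot_iff _).1 hg
    exact ⟨_, mem_support_of_mem (hf g hx) hx0, hf g⟩
  rw [← freeProductGrading_injective h' h heq, Function.update_self]

section Single

variable {K : Type*} [CommGroup K] {ℬ : K → Submodule F (∀ i, C i)}

theorem proj_single (h : IsGradedFamily ℬ) {i : Fin n}
    (hs : ∀ k, ∀ x ∈ ℬ k, LinearMap.single F C i (x i) ∈ ℬ k) (k : K) (y : ∀ i, C i) :
    LinearMap.single F C i (h.toIsDecomp.proj k y i) =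
      h.toIsDecomp.proj k (LinearMap.single F C i (y i)) := by
  refine h.toIsDecomp.induction (P := fun y => LinearMap.single F C i (h.toIsDecomp.proj k y i) =
    h.toIsDecomp.proj k (LinearMap.single F C i (y i))) (fun l y hy => ?_) (by simp)
    (fun a b ha hb => by rw [map_add, Pi.add_apply, map_add, ha, hb, Pi.add_apply, map_add,
      map_add]) y
  by_cases hl : l = k
  · subst hl
    rw [h.toIsDecomp.proj_of_mem hy, h.toIsDecomp.proj_of_mem (hs l y hy)]
  · rw [h.toIsDecomp.proj_of_mem_ne hy hl, h.toIsDecomp.proj_of_mem_ne (hs l y hy) hl,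
      Pi.zero_apply, map_zero]

theorem IsGradedFamily.comap_single (h : IsGradedFamily ℬ) {i : Fin n}
    (hs : ∀ k, ∀ x ∈ ℬ k, LinearMap.single F C i (x i) ∈ ℬ k) :
    IsGradedFamily fun k => (ℬ k).comap (LinearMap.single F C i) := by
  refine h.comap (single_mul_single i) (single_injective i) fun k x => ⟨
    h.toIsDecomp.proj k (LinearMap.single F C i x) i, ?_⟩
  rw [proj_single h hs]
  simp

theorem exists_freeFamily_le_of_single (h : IsGradedFamily ℬ)
    (hΔ : ∀ i, Δ i = support fun k => (ℬ k).comap (LinearMap.single F C i)) :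
    ∃ f : (∀ i, UniversalGroup (Δ i)) →* K, ∀ g, freeFamily Δ g ≤ ℬ (f g) := by
  refine exists_freeFamily_le h fun i U hU => ?_
  rw [hΔ] at hU
  obtain ⟨-, k, rfl⟩ := hU
  exact ⟨k, Submodule.map_comap_le _ _⟩

/-- A fine group-grading for which the factors are graded is a free product group-grading. -/
theorem IsFineGroupGrading.eq_freeProductGrading (h : IsGradedFamily ℬ)
    (hfine : IsFineGroupGrading (support ℬ))
    (hs : ∀ i k, ∀ x ∈ ℬ k, LinearMap.single F C i (x i) ∈ ℬ k)
    (hΔ : ∀ i, Δ i = support fun k => (ℬ k).comap (LinearMap.single F C i)) :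
    freeProductGrading Δ = support ℬ := by
  have hgr : ∀ i, IsGroupGrading (Δ i) := fun i => by
    rw [hΔ]
    exact (h.comap_single (hs i)).isGroupGrading
  obtain ⟨f, hf⟩ := exists_freeFamily_le_of_single h hΔ
  rw [freeProductGrading_eq hgr]
  refine hfine.support_eq_of_refines (isGradedFamily_freeFamily hgr) fun g hg => ?_
  obtain ⟨x, hx, hx0⟩ := (Submodule.ne_bot_iff _).1 hg
  exact ⟨_, mem_support_of_mem (hf g hx) hx0, hf g⟩

end Single

end FreeProduct

/-! ### Automorphisms of finite order and fine gradings -/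

section Eigen

variable {F : Type*} [Field F] [IsAlgClosed F] {A : Type*} [NonUnitalNonAssocRing A] [Module F A]
  {G : Type*} [CommGroup G] {𝒜 : G → Submodule F A}

/-- The polynomial `X ^ m - 1` is separable and `F` is algebraically closed, so `s` is
diagonalizable. -/
theorem iSup_eigenspace_of_pow_eq_one [FiniteDimensional F A] {s : Module.End F A} {m : ℕ}
    (hm : (m : F) ≠ 0) (hs : s ^ m = 1) : ⨆ c : F, s.eigenspace c = ⊤ := by
  have hm0 : 0 < m := Nat.pos_of_ne_zero fun h => hm (by rw [h, Nat.cast_zero])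
  have hsq : Squarefree (Polynomial.X ^ m - 1 : Polynomial F) :=
    (Polynomial.X_pow_sub_one_separable_iff.2 hm).squarefree
  have hss : s.IsSemisimple := Module.End.isSemisimple_of_squarefree_aeval_eq_zero hsq (by
    simp [hs])
  rw [← Module.End.iSup_maxGenEigenspace_eq_top s]
  refine iSup_congr fun c => ?_
  exact (hss.isFinitelySemisimple.maxGenEigenspace_eq_eigenspace c).symm

variable [IsScalarTower F A A] [SMulCommClass F A A]

/-- Automorphisms of finite order, prime to the characteristic, that preserve the components of a
fine group-grading act on them as scalars. -/
theorem IsFineGroupGrading.exists_smul_of_pow_eq_one [FiniteDimensional F A]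
    (h : IsGradedFamily 𝒜) (hfine : IsFineGroupGrading (support 𝒜)) {s : Module.End F A}
    (hmul : ∀ x y, s (x * y) = s x * s y) (hs : ∀ g, ∀ x ∈ 𝒜 g, s x ∈ 𝒜 g) {m : ℕ}
    (hm : (m : F) ≠ 0) (hsm : s ^ m = 1) (g : G) : ∃ c : F, ∀ x ∈ 𝒜 g, s x = c • x := by
  by_cases hg : 𝒜 g = ⊥
  · refine ⟨0, fun x hx => ?_⟩
    rw [hg, Submodule.mem_bot] at hx
    rw [hx, map_zero, smul_zero]
  have htop := iSup_eigenspace_of_pow_eq_one hm hsm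
  -- Zero is not an eigenvalue, so the eigenvalues can serve as degrees in the group `Fˣ`.
  have h0 : s.eigenspace 0 = ⊥ := by
    rw [Submodule.eq_bot_iff]
    intro x hx
    rw [Module.End.mem_eigenspace_iff, zero_smul] at hx
    have h1 : (s ^ m) x = x := by rw [hsm, Module.End.one_apply]
    have hm0 : m ≠ 0 := fun e => hm (by rw [e, Nat.cast_zero])
    obtain ⟨l, rfl⟩ := Nat.exists_eq_succ_of_ne_zero hm0
    rw [← h1, pow_succ, Module.End.mul_apply, hx, map_zero]
  have hind : iSupIndep fun c : Fˣ => s.eigenspace (c : F) :=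
    s.eigenspaces_iSupIndep.comp Units.val_injective
  have href : IsGradedFamily fun q : G × Fˣ => 𝒜 q.1 ⊓ s.eigenspace (q.2 : F) := by
    refine h.refine (𝒞 := fun g (c : Fˣ) => 𝒜 g ⊓ s.eigenspace (c : F)) (fun g c => inf_le_left)
      (fun g => le_antisymm (iSup_le fun c => inf_le_left) ?_) (fun g => ?_) ?_
    · nth_rw 1 [Submodule.eq_iSup_inf_genEigenspace (f := s) (p := 𝒜 g) 1 (hs g) htop]
      refine iSup_le fun c => ?_
      by_cases hc : c = 0
      · exact inf_le_right.trans (by rw [hc]; exact h0.le.trans bot_le)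
      · exact le_iSup (fun c : Fˣ => 𝒜 g ⊓ s.eigenspace (c : F)) (Units.mk0 c hc)
    · exact hind.mono fun c => inf_le_right
    · intro g g' k k' x y hx hy
      refine ⟨h.mul_mem hx.1 hy.1, ?_⟩
      have h1 := Module.End.mem_eigenspace_iff.1 hx.2
      have h2 := Module.End.mem_eigenspace_iff.1 hy.2
      refine Module.End.mem_eigenspace_iff.2 ?_
      rw [hmul, h1, h2, smul_mul_assoc, mul_smul_comm, smul_smul,
        Units.val_mul]
  have heq := hfine.support_eq_of_refines href fun q hq => by
    obtain ⟨x, hx, hx0⟩ := (Submodule.ne_bot_iff _).1 hq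
    exact ⟨_, mem_support_of_mem hx.1 hx0, inf_le_left⟩
  -- By fineness the component is one of the refined pieces, hence contained in a single eigenspace.
  obtain ⟨-, q, hq⟩ := heq.ge (mem_support hg)
  refine ⟨q.2, fun x hx => ?_⟩
  rw [hq] at hx
  exact Module.End.mem_eigenspace_iff.1 hx.2

end Eigen

/-! ### Trivial gradings -/

section Trivial

variable {F : Type*} [Field F] {A : Type*} [NonUnitalNonAssocRing A] [Module F A]
  {B : Type*} [NonUnitalNonAssocRing B] [Module F B]
  {Γ : Set (Submodule F A)} {Γ' : Set (Submodule F B)}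

theorem GradingEquivalent.refl (Γ : Set (Submodule F A)) : GradingEquivalent Γ Γ :=
  ⟨LinearEquiv.refl F A, fun _ _ => rfl, fun U hU => by
    rw [LinearEquiv.refl_toLinearMap, Submodule.map_id]
    exact hU⟩

/-- The only degree is idempotent because the product is not zero, so it is the identity. -/
theorem IsTrivialGrading.universalFamily_one (h : IsTrivialGrading Γ) (hΓ : IsGroupGrading Γ)
    (h0 : ∃ x y : A, x * y ≠ 0) : universalFamily Γ 1 = ⊤ := by
  have hmem : (⊤ : Submodule F A) ∈ Γ := by
    rw [h]
    rfl
  obtain ⟨x, y, hxy⟩ := h0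
  have h1 := isDegree_universalDegree (Γ := Γ) ⟨⊤, hmem⟩ ⟨⊤, hmem⟩ ⟨⊤, hmem⟩
    ⟨x, trivial, y, trivial, hxy⟩ (fun _ _ _ _ => trivial)
  rw [← mul_eq_left.1 h1, hΓ.universalFamily_degree]

theorem IsTrivialGrading.of_equivalent (h : IsTrivialGrading Γ) (hΓ' : IsGrading Γ')
    (he : GradingEquivalent Γ Γ') : IsTrivialGrading Γ' := by
  obtain ⟨φ, hφ⟩ := he
  have hmem : (⊤ : Submodule F B) ∈ Γ' := by
    have := hφ.map_mem ⊤ (by rw [h]; rfl)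
    rwa [Submodule.map_top, LinearEquiv.range] at this
  refine (hΓ'.eq_of_subset (Set.singleton_subset_iff.2 hmem) ?_).symm
  rw [sSup_singleton]

end Trivial

/-! ### Necessity of the multiplicity condition -/

section Multiplicity

variable {F : Type w} [Field F] {n : ℕ} {C : Fin n → Type u}
  [∀ i, NonUnitalNonAssocRing (C i)] [∀ i, Module F (C i)] {Δ : ∀ i, Set (Submodule F (C i))}

/-- The automorphism of a product that permutes isomorphic factors. -/
theorem exists_permutation_automorphism {T : Type*} [Finite T] {t : T → Fin n}
    (ht : Function.Injective t) {A : Type*} [NonUnitalNonAssocRing A] [Module F A]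
    (θ : ∀ a, A ≃ₗ[F] C (t a)) (hθ : ∀ a x y, θ a (x * y) = θ a x * θ a y) (σ : Equiv.Perm T) :
    ∃ s : Module.End F (∀ i, C i), (∀ x a, s x (t (σ a)) = θ (σ a) ((θ a).symm (x (t a)))) ∧
      (∀ x l, (∀ a, l ≠ t a) → s x l = x l) ∧ ∀ x y, s (x * y) = s x * s y := by
  have := Fintype.ofFinite T
  have hθ' : ∀ a x y, (θ a).symm (x * y) = (θ a).symm x * (θ a).symm y := fun a x y => by
    apply (θ a).injective
    rw [hθ]
    simp
  -- The correction at the index `t a` that turns the identity into the permuted map.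
  let z : ∀ a, (∀ i, C i) →ₗ[F] C (t a) := fun a =>
    (θ a : A →ₗ[F] C (t a)) ∘ₗ ((θ (σ.symm a)).symm : C (t (σ.symm a)) →ₗ[F] A) ∘ₗ
      LinearMap.proj (t (σ.symm a)) - LinearMap.proj (t a)
  let s : Module.End F (∀ i, C i) :=
    LinearMap.id + ∑ a, LinearMap.single F C (t a) ∘ₗ z a
  have hs : ∀ x l, s x l = x l + ∑ a, Pi.single (t a) (z a x) l := by
    intro x l
    simp [s, LinearMap.sum_apply, Finset.sum_apply]
  have hs1 : ∀ x a, s x (t a) = θ a ((θ (σ.symm a)).symm (x (t (σ.symm a)))) := by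
    intro x a
    rw [hs, Finset.sum_eq_single a, Pi.single_eq_same]
    · simp [z]
    · intro b _ hb
      rw [Pi.single_eq_of_ne]
      exact fun e => hb (ht e).symm
    · simp
  have hs2 : ∀ x l, (∀ a, l ≠ t a) → s x l = x l := by
    intro x l hl
    rw [hs, Finset.sum_eq_zero, add_zero]
    exact fun a _ => Pi.single_eq_of_ne (hl a) _
  refine ⟨s, fun x a => ?_, hs2, fun x y => ?_⟩
  · rw [hs1, Equiv.symm_apply_apply]
  · funext l
    by_cases hl : ∃ a, l = t a
    · obtain ⟨a, rfl⟩ := hl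
      rw [Pi.mul_apply, hs1, hs1, hs1, Pi.mul_apply, hθ', hθ]
    · rw [not_exists] at hl
      rw [Pi.mul_apply, hs2 _ l hl, hs2 _ l hl, hs2 _ l hl, Pi.mul_apply]

variable [IsAlgClosed F] [∀ i, IsScalarTower F (C i) (C i)] [∀ i, SMulCommClass F (C i) (C i)]
  [∀ i, FiniteDimensional F (C i)]

/-- Trivially graded factors of a fine free product group-grading cannot be permuted by an
automorphism of order prime to the characteristic. -/
theorem false_of_permutation (h : ∀ i, IsGroupGrading (Δ i))
    (hfine : IsFineGroupGrading (freeProductGrading Δ)) {T : Type*} [Finite T] {t : T → Fin n}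
    (ht : Function.Injective t) {i : Fin n} (h0 : ∃ x y : C i, x * y ≠ 0)
    (hi : IsTrivialGrading (Δ i)) (heq : ∀ a, GradingEquivalent (Δ i) (Δ (t a)))
    {σ : Equiv.Perm T} {m : ℕ} (hm : (m : F) ≠ 0) (hσ : σ ^ m = 1) {a : T} (ha : σ a ≠ a) :
    False := by
  choose θ hθ using heq
  obtain ⟨s, hs1, hs2, hsmul⟩ := exists_permutation_automorphism ht θ (fun a => (hθ a).map_mul) σ
  have hpow : s ^ m = 1 := by
    have key : ∀ k x a b, b = (σ ^ k) a → (s ^ k) x (t b) = θ b ((θ a).symm (x (t a))) := by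
      intro k x
      induction k with
      | zero =>
        rintro a _ rfl
        simp
      | succ k ih =>
        rintro a _ rfl
        rw [pow_succ', pow_succ', Equiv.Perm.mul_apply, Module.End.mul_apply, hs1, ih a _ rfl,
          LinearEquiv.symm_apply_apply]
    have key' : ∀ k x l, (∀ a, l ≠ t a) → (s ^ k) x l = x l := by
      intro k x l hl
      induction k with
      | zero => rfl
      | succ k ih => rw [pow_succ', Module.End.mul_apply, hs2 _ l hl, ih]
    refine LinearMap.ext fun x => funext fun l => ?_
    by_cases hl : ∃ a, l = t a
    · obtain ⟨a, rfl⟩ := hl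
      rw [key m x a a (by rw [hσ]; rfl), LinearEquiv.apply_symm_apply]
      rfl
    · rw [not_exists] at hl
      exact key' m x l hl
  have hone : ∀ b, universalFamily (Δ (t b)) 1 = ⊤ := by
    intro b
    refine (hi.of_equivalent (h (t b)).universal.isGrading ⟨θ b, hθ b⟩).universalFamily_one
      (h (t b)) ?_
    obtain ⟨x, y, hxy⟩ := h0
    refine ⟨θ b x, θ b y, ?_⟩
    rw [← (hθ b).map_mul]
    simpa using hxy
  -- A component that involves one of the permuted factors has degree one, and in this degree those
  -- factors are contained whole; all other coordinates are fixed.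
  have hpres : ∀ g, ∀ x ∈ freeFamily Δ g, s x ∈ freeFamily Δ g := by
    intro g x hx
    by_cases hx0 : ∀ b, x (t b) = 0
    · have : s x = x := by
        funext l
        by_cases hl : ∃ a, l = t a
        · obtain ⟨b, rfl⟩ := hl
          have := hs1 x (σ.symm b)
          rw [Equiv.apply_symm_apply] at this
          rw [this, hx0, hx0, map_zero, map_zero]
        · rw [not_exists] at hl
          exact hs2 x l hl
      rwa [this]
    · push Not at hx0
      obtain ⟨b, hb⟩ := hx0
      have hg : g (t b) = 1 := (h (t b)).isGradedFamily.toIsDecomp.eq_of_mem_of_mem (hx _).1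
        ((hone b).ge trivial) hb
      have hg1 : g = 1 := by
        rw [mulSingle_of_ne_zero hx hb, hg, Pi.mulSingle_one]
      rw [hg1] at hx ⊢
      refine fun l => ⟨?_, fun j _ hj => absurd rfl hj⟩
      by_cases hl : ∃ a, l = t a
      · obtain ⟨b, rfl⟩ := hl
        exact (hone b).ge trivial
      · rw [not_exists] at hl
        rw [hs2 x l hl]
        exact (hx l).1
  rw [freeProductGrading_eq h] at hfine
  -- Acting as a scalar on degree one is impossible, since `s` moves the factor at `t a` to the
  -- different factor at `t (σ a)`.
  obtain ⟨c, hc⟩ := hfine.exists_smul_of_pow_eq_one (isGradedFamily_freeFamily h) hsmul hpres hm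
    hpow 1
  obtain ⟨x, y, hxy⟩ := h0
  have hmem : LinearMap.single F C (t a) (θ a x) ∈ freeFamily Δ 1 := by
    have := single_mem_freeFamily (i := t a) (u := 1) ((hone a).ge (trivial : θ a x ∈ ⊤))
    rwa [Pi.mulSingle_one] at this
  have h1 := congrFun (hc _ hmem) (t (σ a))
  rw [hs1, Pi.smul_apply, LinearMap.single_apply, Pi.single_eq_same,
    Pi.single_eq_of_ne (fun e => ha (ht e)), smul_zero, LinearEquiv.symm_apply_apply,
    LinearEquiv.map_eq_zero_iff] at h1
  rw [h1, zero_mul] at hxy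
  exact hxy rfl

/-- The order of the permutation must be invertible in `F`: two equivalent factors are exchanged if
the characteristic is not two, and in characteristic two, where order two is useless, three of them
are permuted cyclically. -/
theorem multiplicityCondition_of_isFine (h : ∀ i, IsGroupGrading (Δ i))
    (h0 : ∀ i, ∃ x y : C i, x * y ≠ 0) (hfine : IsFineGroupGrading (freeProductGrading Δ)) :
    MultiplicityCondition Δ := by
  by_cases hF : ringChar F = 2
  · refine Or.inl ⟨hF, fun i hi j k hj hk hij hik => ?_⟩
    by_contra hjk
    have h3 : ((3 : ℕ) : F) ≠ 0 := by
      intro h3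
      have := (ringChar.spec F 3).1 h3
      rw [hF] at this
      omega
    have ht : Function.Injective ![i, j, k] := by
      intro a b hab
      fin_cases a <;> fin_cases b <;> simp_all
    refine false_of_permutation h hfine ht (h0 i) hi (fun a => ?_) (σ := finRotate 3) h3 (by decide)
      (a := 0) (by decide)
    fin_cases a
    · exact GradingEquivalent.refl _
    · exact hij
    · exact hik
  · refine Or.inr ⟨hF, fun i hi j hj hij => ?_⟩
    have h2 : ((2 : ℕ) : F) ≠ 0 := by
      rw [Nat.cast_ofNat]
      exact Ring.two_ne_zero hF
    have ht : Function.Injective ![i, j] := by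
      intro a b hab
      fin_cases a <;> fin_cases b <;> simp_all
    refine false_of_permutation h hfine ht (h0 i) hi (fun a => ?_) (σ := finRotate 2) h2 (by decide)
      (a := 0) (by decide)
    fin_cases a
    · exact GradingEquivalent.refl _
    · exact hij

end Multiplicity

/-! ### Existence of the free product decomposition -/

section Existence

variable {F : Type w} [Field F] {n : ℕ} {C : Fin n → Type u}
  [∀ i, NonUnitalNonAssocRing (C i)] [∀ i, Module F (C i)] {Δ : ∀ i, Set (Submodule F (C i))}
  {B : Type u} [NonUnitalNonAssocRing B] [Module F B] {G : Type*} [CommGroup G]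
  {𝓑 : G → Submodule F B}

/-- The sum of the `φ i` is an isomorphism from the product. The summands are graded, so projections
to them commute with degree projections; the transported grading is then fine with graded factors,
hence a free product. -/
theorem gradingEquivalent_freeProductGrading (h : IsGradedFamily 𝓑)
    (hfine : IsFineGroupGrading (support 𝓑)) (φ : ∀ i, C i →ₗ[F] B)
    (hmul : ∀ i x y, φ i (x * y) = φ i x * φ i y) (hinj : ∀ i, Function.Injective (φ i))
    (hd : IsDecomp fun i => LinearMap.range (φ i))
    (hJ : ∀ i, IsGradedIdeal h (LinearMap.range (φ i)))
    (hΔ : ∀ i, Δ i = support fun g => (𝓑 g).comap (φ i)) :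
    IsFineGroupGrading (freeProductGrading Δ) ∧
      GradingEquivalent (support 𝓑) (freeProductGrading Δ) := by
  let e' : (∀ i, C i) →ₗ[F] B := ∑ i, φ i ∘ₗ LinearMap.proj i
  have he' : ∀ x, e' x = ∑ i, φ i (x i) := fun x => by simp [e', LinearMap.sum_apply]
  have hproj : ∀ x i, hd.proj i (e' x) = φ i (x i) := by
    intro x i
    rw [he', map_sum, Finset.sum_eq_single i, hd.proj_of_mem ⟨x i, rfl⟩]
    · exact fun j _ hj => hd.proj_of_mem_ne ⟨x j, rfl⟩ hj
    · simp
  have hbij : Function.Bijective e' := by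
    constructor
    · rw [← LinearMap.ker_eq_bot, LinearMap.ker_eq_bot']
      refine fun x hx => funext fun i => hinj i ?_
      rw [← hproj, hx, map_zero, Pi.zero_apply, map_zero]
    · intro y
      choose x hx using fun i => hd.proj_mem i y
      obtain ⟨s, hs⟩ := hd.exists_sum_proj y
      refine ⟨x, ?_⟩
      rw [he', hs Finset.univ (Finset.subset_univ s)]
      exact Finset.sum_congr rfl fun i _ => hx i
  let e : (∀ i, C i) ≃ₗ[F] B := LinearEquiv.ofBijective e' hbij
  have hemul : ∀ x y, e (x * y) = e x * e y := by
    intro x y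
    change e' (x * y) = e' x * e' y
    rw [he', he', Finset.sum_mul]
    refine Finset.sum_congr rfl fun i _ => ?_
    rw [(hd.mul_eq_proj_mul (fun i => (hJ i).isIdeal) ⟨x i, rfl⟩ _).2, hproj]
    exact hmul i _ _
  have hcomm : ∀ i g y, hd.proj i (h.toIsDecomp.proj g y) = h.toIsDecomp.proj g (hd.proj i y) := by
    intro i g y
    refine hd.induction (P := fun y => hd.proj i (h.toIsDecomp.proj g y) =
      h.toIsDecomp.proj g (hd.proj i y)) (fun j y hy => ?_) (by simp)
      (fun a b ha hb => by simp only [map_add, ha, hb]) y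
    by_cases hj : j = i
    · subst hj
      rw [hd.proj_of_mem hy, hd.proj_of_mem ((hJ j).proj_mem y hy g)]
    · rw [hd.proj_of_mem_ne hy hj, hd.proj_of_mem_ne ((hJ j).proj_mem y hy g) hj, map_zero]
  have hsingle : ∀ i x, e (LinearMap.single F C i x) = φ i x := by
    intro i x
    change e' _ = _
    rw [he', Finset.sum_eq_single i]
    · simp
    · intro j _ hj
      simp [Pi.single_eq_of_ne hj]
    · simp
  have hfine' := hfine.comap_equiv h e hemul
  have heq : freeProductGrading Δ = support fun g => (𝓑 g).comap (e : (∀ i, C i) →ₗ[F] B) := by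
    refine hfine'.eq_freeProductGrading (h.comap_equiv e hemul) (fun i k x hx => ?_) fun i => ?_
    · rw [Submodule.mem_comap] at hx ⊢
      change e (LinearMap.single F C i (x i)) ∈ 𝓑 k
      have hx : e' x ∈ 𝓑 k := hx
      rw [hsingle, ← hproj, ← h.toIsDecomp.proj_of_mem hx, hcomm]
      exact h.toIsDecomp.proj_mem k _
    · rw [hΔ]
      congr 1
      funext k
      ext x
      simp only [Submodule.mem_comap]
      rw [← hsingle]
      rfl
  rw [heq]
  refine ⟨hfine', e.symm, isEquivalence_support (fun x y => ?_) (β := id) fun g => ?_⟩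
  · apply e.injective
    simp [hemul]
  · exact Submodule.map_equiv_eq_comap_symm e.symm (𝓑 g)

/-- The factors are the minimal graded ideals. Their fineness and the multiplicity condition follow
from the fineness of the whole. -/
theorem exists_freeProduct_decomposition [IsAlgClosed F] [IsScalarTower F B B]
    [SMulCommClass F B B] [FiniteDimensional F B] (hB : IsSemisimpleAlgebra F B)
    {Γ : Set (Submodule F B)} (hfine : IsFineGroupGrading Γ) :
    ∃ (n : ℕ) (C : Fin n → Type u) (_ : ∀ i, NonUnitalNonAssocRing (C i))
      (_ : ∀ i, Module F (C i)) (_ : ∀ i, IsScalarTower F (C i) (C i))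
      (_ : ∀ i, SMulCommClass F (C i) (C i)) (Δ : ∀ i, Set (Submodule F (C i))),
      IsFineFamily Δ ∧ GradingEquivalent Γ (freeProductGrading Δ) := by
  have h := hfine.1.isGradedFamily
  obtain ⟨n, J, hd, hJ⟩ := exists_minimalGradedIdeals h hB
  let φ := fun i => (hJ i).isIdeal.inclusion
  have hmul : ∀ i x y, φ i (x * y) = φ i x * φ i y := fun i => (hJ i).isIdeal.inclusion_mul
  have hinj : ∀ i, Function.Injective (φ i) := fun i => (hJ i).isIdeal.inclusion_injective
  have hrange : ∀ i, LinearMap.range (φ i) = J i := fun i => (hJ i).isIdeal.range_inclusion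
  have hmin : ∀ i, IsMinimalGradedIdeal h (LinearMap.range (φ i)) := fun i => by
    rw [hrange]
    exact hJ i
  let Δ := fun i => support fun g => (universalFamily Γ g).comap (φ i)
  have hgr : ∀ i, IsGroupGrading (Δ i) := fun i =>
    (h.comap (hmul i) (hinj i) fun g x => (hmin i).proj_mem _ ⟨x, rfl⟩ g).isGroupGrading
  have h0 : ∀ i, ∃ x y : (hJ i).isIdeal.subalgebra, x * y ≠ 0 := by
    intro i
    by_contra! hzero
    refine (hJ i).ne_bot (hB.eq_bot_of_mul_eq_zero (hJ i).isIdeal fun x hx y hy => ?_)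
    exact congrArg Subtype.val (hzero ⟨x, hx⟩ ⟨y, hy⟩)
  have hfd : ∀ i, FiniteDimensional F (hJ i).isIdeal.subalgebra := fun i =>
    FiniteDimensional.of_injective (φ i) (hinj i)
  obtain ⟨hfine', heq⟩ := gradingEquivalent_freeProductGrading (Δ := Δ) h
    (hfine.1.support_eq.symm ▸ hfine) φ hmul hinj
    (by simpa only [hrange] using hd) (fun i => (hmin i).toIsGradedIdeal) fun i => rfl
  rw [hfine.1.support_eq] at heq
  refine ⟨n, fun i => (hJ i).isIdeal.subalgebra, fun i => inferInstance, fun i => inferInstance,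
    fun i => inferInstance, fun i => inferInstance, Δ, ⟨hfd, fun i => hB.subalgebra _,
    fun i => (hmin i).isGradedSimple (hmul i) (hinj i)
      (hB.isCompl_annihilator (hmin i).isIdeal).sup_eq_top (h0 i),
    isFine_of_freeProductGrading hgr hfine', multiplicityCondition_of_isFine hgr h0 hfine'⟩, heq⟩

end Existence

/-! ### Loops in characteristic two -/

section Loops

variable {F : Type*} [Field F] {A L : Type*} [NonUnitalNonAssocRing A] [Module F A]
  [NonUnitalNonAssocRing L] [Module F L] {U V : Type*} [CommGroup U] [CommGroup V]
  {ℒ : U → Submodule F L} {𝒜 : V → Submodule F A} {π : U →* V} {p : L →ₗ[F] A}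

/-- When `π` is injective, `p` intertwines the degree projections, so its kernel is graded. -/
theorem IsLoop.injective_of_injective (h : IsLoop ℒ 𝒜 π p) (hπ : Function.Injective π) :
    Function.Injective p := by
  rw [← LinearMap.ker_eq_bot, LinearMap.ker_eq_bot']
  intro x hx
  refine h.source.toIsDecomp.eq_zero_of_proj fun k =>
    h.eq_zero k _ (h.source.toIsDecomp.proj_mem k x) ?_
  have key : p ∘ₗ h.source.toIsDecomp.proj k = h.target.toIsDecomp.proj (π k) ∘ₗ p := by
    refine h.source.toIsDecomp.hom_ext fun l y hy => ?_
    rw [LinearMap.comp_apply, LinearMap.comp_apply]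
    by_cases hl : l = k
    · subst hl
      rw [h.source.toIsDecomp.proj_of_mem hy, h.target.toIsDecomp.proj_of_mem (h.mem hy)]
    · rw [h.source.toIsDecomp.proj_of_mem_ne hy hl, map_zero,
        h.target.toIsDecomp.proj_of_mem_ne (h.mem hy) fun e => hl (hπ e)]
  have := LinearMap.congr_fun key x
  rw [LinearMap.comp_apply, LinearMap.comp_apply, hx, map_zero] at this
  exact this

variable {A' : Type*} [NonUnitalNonAssocRing A'] [Module F A']
  [IsScalarTower F A' A'] [SMulCommClass F A' A']

/-- In characteristic two, a loop algebra that is a subdirect product of two simple algebras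
cannot be a proper one. -/
theorem IsLoop.injective_of_two_eq_zero [IsAlgClosed F] (h : IsLoop ℒ 𝒜 π p)
    (hA : IsSimpleAlgebra F A) (hA' : IsCentralSimpleAlgebra F A') {q : L →ₗ[F] A'}
    (hq : ∀ x y, q (x * y) = q x * q y) (hqs : Function.Surjective q)
    (hpq : ∀ x, p x = 0 → q x = 0 → x = 0) (h2 : (2 : F) = 0) : Function.Injective p := by
  obtain ⟨χ, φ, -, hφ⟩ := h.exists_equiv_of_surjective hA hA' hq hqs
  refine h.injective_of_injective ((injective_iff_map_eq_one π).2 fun c hc => ?_)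
  by_contra hc1
  obtain ⟨v, hv⟩ := h.target.exists_ne_bot hA.1
  obtain ⟨k, rfl⟩ := h.surj v
  rw [← h.ne_bot_iff] at hv
  obtain ⟨x, hx, hx0⟩ := (Submodule.ne_bot_iff _).1 hv
  let T := h.translation ⟨c, hc⟩
  have hT : ∀ {g y}, y ∈ ℒ g → T y ∈ ℒ (g * c) := fun hy => h.translation_mem ⟨c, hc⟩ hy
  have hpT : ∀ y, p (T y) = p y := h.map_translation ⟨c, hc⟩
  have hqT : ∀ {g y}, y ∈ ℒ g → q (T y) = (χ c : F) • q y := by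
    intro g y hy
    rw [hφ _ _ (hT hy), hφ _ _ hy, hpT, _root_.map_mul, mul_comm, Units.val_mul, smul_smul]
  -- That is, `(T - 1)(T - χ c) = 0` at `x`, because `T` acts as the identity through `p` and as `χ
  -- c` through `q`.
  have hrel : T (T x) = (1 + χ c : F) • T x - (χ c : F) • x := by
    refine sub_eq_zero.1 (hpq _ ?_ ?_)
    · rw [map_sub, map_sub, map_smul, map_smul, hpT, hpT, add_smul, one_smul]
      abel
    · rw [map_sub, map_sub, map_smul, map_smul, hqT (hT hx), hqT hx, add_smul, one_smul]
      abel
  have hne : k * c ≠ k := fun e => hc1 (mul_eq_left.1 e)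
  -- The degrees of `x`, `T x`, `T (T x)` are `k`, `k c`, `k c²`. If `c² = 1` then `χ c` has square
  -- one, hence equals one in characteristic two, and `T x = x` contradicts the degrees. Otherwise
  -- `T (T x)` is alone in its degree, hence zero.
  by_cases hcc : k * c * c = k
  · have hone : (χ c : F) = 1 := by
      have h1 : χ c * χ c = 1 := by
        rw [← _root_.map_mul, mul_eq_left.1 ((mul_assoc k c c).symm.trans hcc), map_one]
      have h1' : (χ c : F) * (χ c : F) = 1 := by
        rw [← Units.val_mul, h1, Units.val_one]
      have h3 : ((χ c : F) - 1) * ((χ c : F) - 1) = 0 := by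
        linear_combination h1' + (1 - (χ c : F)) * h2
      exact sub_eq_zero.1 (mul_self_eq_zero.1 h3)
    have heq : T x = x := by
      refine sub_eq_zero.1 (hpq _ ?_ ?_)
      · rw [map_sub, hpT, sub_self]
      · rw [map_sub, hqT hx, hone, one_smul, sub_self]
    exact hne (h.source.toIsDecomp.eq_of_mem_of_mem (heq ▸ hT hx) hx hx0)
  · have h0 := congrArg (h.source.toIsDecomp.proj (k * c * c)) hrel
    rw [map_sub, map_smul, map_smul, h.source.toIsDecomp.proj_of_mem (hT (hT hx)),
      h.source.toIsDecomp.proj_of_mem_ne (hT hx) fun e => hc1 (mul_eq_left.1 e.symm),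
      h.source.toIsDecomp.proj_of_mem_ne hx (Ne.symm hcc), smul_zero, smul_zero, sub_zero] at h0
    refine hx0 (h.eq_zero k x hx ?_)
    rw [← hpT, ← hpT, h0, map_zero]

end Loops

/-! ### Graded ideals under refinement and equivalence -/

section GradedIdeals

variable {F : Type*} [Field F] {A : Type*} [NonUnitalNonAssocRing A] [Module F A]
  {G K : Type*} [CommGroup G] [CommGroup K] {𝒜 : G → Submodule F A}

theorem IsGradedIdeal.of_refines {ℬ : K → Submodule F A} {hℬ : IsGradedFamily ℬ}
    (h : IsGradedFamily 𝒜) (hle : ∀ k, ∃ g, ℬ k ≤ 𝒜 g) {S : Submodule F A}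
    (hS : IsGradedIdeal hℬ S) : IsGradedIdeal h S := by
  refine ⟨hS.isIdeal, fun x hx g => ?_⟩
  obtain ⟨s, hs⟩ := hℬ.toIsDecomp.exists_sum_proj x
  rw [hs s subset_rfl, map_sum]
  refine sum_mem fun k _ => ?_
  obtain ⟨g', hg'⟩ := hle k
  have hmem := hg' (hℬ.toIsDecomp.proj_mem k x)
  by_cases hg : g' = g
  · rw [h.toIsDecomp.proj_of_mem (hg ▸ hmem)]
    exact hS.proj_mem x hx k
  · rw [h.toIsDecomp.proj_of_mem_ne hmem hg]
    exact zero_mem _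

theorem IsGradedSimple.eq_zero_of_mul_eq_zero [IsScalarTower F A A] [SMulCommClass F A A]
    (h : IsGradedFamily 𝒜) (hs : IsGradedSimple (support 𝒜)) {x : A}
    (hx : ∀ y, x * y = 0 ∧ y * x = 0) : x = 0 := by
  have hgr : IsGradedIdeal h (annihilator ⊤) :=
    ⟨isIdeal_annihilator_top, fun x hx g => h.proj_mem_annihilator (S := ⊤) (fun _ _ _ => Submodule.mem_top) hx g⟩
  rw [h.isGradedIdeal_iff] at hgr
  rcases hs.2 _ hgr.1 hgr.2 with h0 | h1
  · rw [← Submodule.mem_bot F, ← h0]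
    exact fun y _ => hx y
  · obtain ⟨a, b, hab⟩ := hs.1
    exact absurd ((h1.ge (Submodule.mem_top : a ∈ ⊤)) b trivial).1 hab

theorem IsGradedSimple.isSimpleAlgebra {Γ : Set (Submodule F A)} (hs : IsGradedSimple Γ)
    (hΓ : IsTrivialGrading Γ) : IsSimpleAlgebra F A := by
  refine ⟨hs.1, fun I hI => hs.2 I hI (le_antisymm ?_ (iSup_le fun U => inf_le_right))⟩
  refine le_iSup_of_le ⟨⊤, by rw [hΓ]; rfl⟩ ?_
  rw [top_inf_eq]

variable {B : Type*} [NonUnitalNonAssocRing B] [Module F B] {ℬ : K → Submodule F B}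

theorem IsGradedIdeal.comap_equivalence {h𝒜 : IsGradedFamily 𝒜} {hℬ : IsGradedFamily ℬ}
    {e : A ≃ₗ[F] B} (he : IsEquivalence (support 𝒜) (support ℬ) e) {S : Submodule F B}
    (hS : IsGradedIdeal hℬ S) : IsGradedIdeal h𝒜 (S.comap (e : A →ₗ[F] B)) := by
  refine ⟨hS.isIdeal.comap he.map_mul, fun x hx g => ?_⟩
  by_cases hg : 𝒜 g = ⊥
  · have := h𝒜.toIsDecomp.proj_mem g x
    rw [hg, Submodule.mem_bot] at this
    rw [this]
    exact zero_mem _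
  obtain ⟨-, k, hk⟩ := he.map_mem _ (mem_support hg)
  have key : (e : A →ₗ[F] B) ∘ₗ h𝒜.toIsDecomp.proj g =
      hℬ.toIsDecomp.proj k ∘ₗ (e : A →ₗ[F] B) := by
    refine h𝒜.toIsDecomp.hom_ext fun l y hy => ?_
    rw [LinearMap.comp_apply, LinearMap.comp_apply]
    by_cases hl : l = g
    · subst hl
      rw [h𝒜.toIsDecomp.proj_of_mem hy, hℬ.toIsDecomp.proj_of_mem (hk ▸ ⟨y, hy, rfl⟩)]
    · rw [h𝒜.toIsDecomp.proj_of_mem_ne hy hl, map_zero]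
      by_cases hy0 : y = 0
      · rw [hy0, map_zero, map_zero]
      obtain ⟨-, k', hk'⟩ := he.map_mem _ (mem_support_of_mem hy hy0)
      refine (hℬ.toIsDecomp.proj_of_mem_ne (j := k') (hk' ▸ ⟨y, hy, rfl⟩) fun e1 => hl ?_).symm
      rw [e1, ← hk] at hk'
      refine h𝒜.toIsDecomp.eq_of_eq (Submodule.map_injective_of_injective e.injective hk')
        fun h0 => hy0 ?_
      rw [h0] at hy
      exact hy
  rw [Submodule.mem_comap, ← LinearMap.comp_apply, key]
  exact hS.proj_mem _ hx k

end GradedIdeals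

/-! ### Graded ideals of a free product -/

section FreeProduct

variable {F : Type w} [Field F] {n : ℕ} {C : Fin n → Type u}
  [∀ i, NonUnitalNonAssocRing (C i)] [∀ i, Module F (C i)]
  {Δ : ∀ i, Set (Submodule F (C i))}

theorem proj_single_freeFamily (h : ∀ i, IsGroupGrading (Δ i)) (g : ∀ i, UniversalGroup (Δ i))
    (i : Fin n) (y : ∀ i, C i) :
    LinearMap.single F C i ((isGradedFamily_freeFamily h).toIsDecomp.proj g y i) =
      (isGradedFamily_freeFamily h).toIsDecomp.proj g (LinearMap.single F C i (y i)) :=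
  proj_single (C := C) (isGradedFamily_freeFamily h)
    (fun _ _ hx => single_apply_mem_freeFamily hx i) g y

variable [∀ i, IsScalarTower F (C i) (C i)] [∀ i, SMulCommClass F (C i) (C i)]

/-- The part of `J` inside the `l`-th factor is a graded ideal of a graded-simple algebra. If it is
zero, the `l`-th coordinates of `J` annihilate that factor, hence vanish. -/
theorem single_mem_or_apply_eq_zero (h : ∀ i, IsGroupGrading (Δ i))
    (hs : ∀ i, IsGradedSimple (Δ i)) {J : Submodule F (∀ i, C i)}
    (hJ : IsGradedIdeal (isGradedFamily_freeFamily h) J) (l : Fin n) :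
    (∀ y, LinearMap.single F C l y ∈ J) ∨ ∀ x ∈ J, x l = 0 := by
  have hgr : IsGradedIdeal (h l).isGradedFamily (J.comap (LinearMap.single F C l)) := by
    refine ⟨hJ.isIdeal.comap (single_mul_single l), fun x hx u => ?_⟩
    have h1 := hJ.proj_mem _ hx (Pi.mulSingle l u)
    suffices h2 : (isGradedFamily_freeFamily h).toIsDecomp.proj (Pi.mulSingle l u)
        (LinearMap.single F C l x) =
          LinearMap.single F C l ((h l).isGradedFamily.toIsDecomp.proj u x) by
      rwa [h2] at h1
    refine (h l).isGradedFamily.toIsDecomp.induction (P := fun x =>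
      (isGradedFamily_freeFamily h).toIsDecomp.proj (Pi.mulSingle l u)
        (LinearMap.single F C l x) =
          LinearMap.single F C l ((h l).isGradedFamily.toIsDecomp.proj u x)) (fun v y hy => ?_)
      (by simp) (fun a b ha hb => by simp only [map_add, ha, hb]) x
    by_cases hv : v = u
    · subst hv
      rw [(h l).isGradedFamily.toIsDecomp.proj_of_mem hy,
        (isGradedFamily_freeFamily h).toIsDecomp.proj_of_mem (single_mem_freeFamily hy)]
    · rw [(h l).isGradedFamily.toIsDecomp.proj_of_mem_ne hy hv, map_zero,
        (isGradedFamily_freeFamily h).toIsDecomp.proj_of_mem_ne (single_mem_freeFamily hy)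
          fun e => hv (Pi.mulSingle_injective l e)]
  have hs' := hs l
  rw [← (h l).support_eq] at hs'
  rw [(h l).isGradedFamily.isGradedIdeal_iff] at hgr
  rcases hs'.2 _ hgr.1 hgr.2 with h0 | h1
  · right
    intro x hx
    refine hs'.eq_zero_of_mul_eq_zero (h l).isGradedFamily fun y => ?_
    have h2 := hJ.isIdeal (LinearMap.single F C l y) x hx
    rw [(single_mul l y x).1, (single_mul l y x).2] at h2
    rw [← Submodule.mem_bot F, ← Submodule.mem_bot F, ← h0]
    exact ⟨h2.2, h2.1⟩
  · left
    intro y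
    exact h1.ge (Submodule.mem_top : y ∈ ⊤)

end FreeProduct

/-! ### Uniqueness of the factors -/

section Uniqueness

variable {F : Type w} [Field F] {n : ℕ} {C : Fin n → Type u}
  [∀ i, NonUnitalNonAssocRing (C i)] [∀ i, Module F (C i)]
  {Δ : ∀ i, Set (Submodule F (C i))}

theorem single_apply_of_mem_range {i : Fin n} {x : ∀ i, C i}
    (hx : x ∈ LinearMap.range (LinearMap.single F C i)) : LinearMap.single F C i (x i) = x := by
  obtain ⟨y, rfl⟩ := hx
  rw [LinearMap.single_apply, LinearMap.single_apply, Pi.single_eq_same]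

theorem isIdeal_range_single (i : Fin n) : IsIdeal (LinearMap.range (LinearMap.single F C i)) := by
  rintro x _ ⟨y, rfl⟩
  rw [(single_mul i y x).1, (single_mul i y x).2]
  exact ⟨⟨_, rfl⟩, ⟨_, rfl⟩⟩

theorem range_single_ne_bot {i : Fin n} (h : ∃ x y : C i, x * y ≠ 0) :
    LinearMap.range (LinearMap.single F C i) ≠ ⊥ := by
  obtain ⟨x, y, hxy⟩ := h
  intro h0
  have hx : LinearMap.single F C i x ∈ (⊥ : Submodule F (∀ i, C i)) := h0.le ⟨x, rfl⟩
  rw [Submodule.mem_bot] at hx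
  rw [single_injective i (hx.trans (map_zero _).symm), zero_mul] at hxy
  exact hxy rfl

theorem range_single_injective (h : ∀ i, ∃ x y : C i, x * y ≠ 0) :
    Function.Injective fun i => LinearMap.range (LinearMap.single F C i) := by
  intro i j hij
  by_contra hne
  apply range_single_ne_bot (F := F) (h i)
  rw [Submodule.eq_bot_iff]
  rintro _ ⟨x, rfl⟩
  have hx : LinearMap.single F C i x ∈ LinearMap.range (LinearMap.single F C j) :=
    hij.le ⟨x, rfl⟩
  have h0 : LinearMap.single F C i x j = 0 := Pi.single_eq_of_ne (Ne.symm hne) x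
  rw [← single_apply_of_mem_range hx, h0, map_zero]

/-- The restriction of `e` is an isomorphism of factors. It respects the gradings because these are
recovered from the free product by restriction. -/
theorem gradingEquivalent_of_map_range_single {m : ℕ} {D : Fin m → Type u}
    [∀ i, NonUnitalNonAssocRing (D i)] [∀ i, Module F (D i)]
    {Θ : ∀ i, Set (Submodule F (D i))}
    (hΔ : ∀ i, IsGroupGrading (Δ i)) (hΘ : ∀ i, IsGroupGrading (Θ i))
    {e : (∀ i, C i) ≃ₗ[F] ∀ i, D i}
    (he : IsEquivalence (freeProductGrading Δ) (freeProductGrading Θ) e) {i : Fin n} {j : Fin m}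
    (hij : LinearMap.range (LinearMap.single F D j) =
      (LinearMap.range (LinearMap.single F C i)).map (e : (∀ i, C i) →ₗ[F] ∀ i, D i)) :
    GradingEquivalent (Δ i) (Θ j) := by
  let φ' : C i →ₗ[F] D j :=
    LinearMap.proj j ∘ₗ (e : (∀ i, C i) →ₗ[F] ∀ i, D i) ∘ₗ LinearMap.single F C i
  have hφ' : ∀ x, LinearMap.single F D j (φ' x) = e (LinearMap.single F C i x) := by
    intro x
    have hx : e (LinearMap.single F C i x) ∈ LinearMap.range (LinearMap.single F D j) :=
      hij.ge ⟨_, ⟨x, rfl⟩, rfl⟩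
    obtain ⟨y, hy⟩ := hx
    change LinearMap.single F D j (e (LinearMap.single F C i x) j) = _
    rw [← hy, LinearMap.single_apply, LinearMap.single_apply, Pi.single_eq_same]
  have hbij : Function.Bijective φ' := by
    constructor
    · intro x y hxy
      apply single_injective (F := F) i
      apply e.injective
      rw [← hφ', ← hφ', hxy]
    · intro y
      obtain ⟨_, ⟨x, rfl⟩, hx⟩ := hij.le ⟨y, rfl⟩
      exact ⟨x, single_injective (F := F) j ((hφ' x).trans hx)⟩
  refine ⟨LinearEquiv.ofBijective φ' hbij, fun x y => ?_, fun V hV => ?_⟩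
  · apply single_injective (F := F) j
    change LinearMap.single F D j (φ' (x * y)) = LinearMap.single F D j (φ' x * φ' y)
    rw [hφ', single_mul_single, he.map_mul, single_mul_single, hφ', hφ']
  · have hV0 := (hΔ i).universal.isGrading.ne_bot V hV
    obtain ⟨-, S, hS, rfl⟩ := (mem_iff_of_freeProductGrading hΔ i).1 hV
    refine (mem_iff_of_freeProductGrading hΘ j).2 ⟨fun h0 => hV0 ?_, _, he.map_mem S hS, ?_⟩
    · exact Submodule.map_injective_of_injective hbij.1 (h0.trans (Submodule.map_bot _).symm)
    · ext y
      constructor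
      · rintro ⟨x, hx, rfl⟩
        exact ⟨_, hx, (hφ' x).symm⟩
      · rintro ⟨z, hz, hzy⟩
        obtain ⟨x, rfl⟩ := hbij.2 y
        refine ⟨x, ?_, rfl⟩
        rw [hφ'] at hzy
        have hzx := e.injective hzy
        rw [hzx] at hz
        exact hz

variable [∀ i, IsScalarTower F (C i) (C i)] [∀ i, SMulCommClass F (C i) (C i)]

theorem isMinimalGradedIdeal_range_single (h : ∀ i, IsGroupGrading (Δ i))
    (hs : ∀ i, IsGradedSimple (Δ i)) (i : Fin n) :
    IsMinimalGradedIdeal (isGradedFamily_freeFamily h)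
      (LinearMap.range (LinearMap.single F C i)) := by
  refine ⟨⟨isIdeal_range_single i, fun x hx g => ?_⟩, range_single_ne_bot (hs i).1,
    fun T hT hle => ?_⟩
  · rw [← single_apply_of_mem_range hx, ← proj_single_freeFamily h]
    exact ⟨_, rfl⟩
  · rcases single_mem_or_apply_eq_zero h hs hT i with h1 | h0
    · right
      refine le_antisymm hle ?_
      rintro _ ⟨y, rfl⟩
      exact h1 y
    · left
      rw [Submodule.eq_bot_iff]
      intro x hx
      rw [← single_apply_of_mem_range (hle hx), h0 x hx, map_zero]

/-- A graded ideal that is none of the factors contains none of them, by minimality, so all its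
coordinates vanish. -/
theorem IsMinimalGradedIdeal.exists_eq_range_single {h : ∀ i, IsGroupGrading (Δ i)}
    {J : Submodule F (∀ i, C i)} (hJ : IsMinimalGradedIdeal (isGradedFamily_freeFamily h) J)
    (hs : ∀ i, IsGradedSimple (Δ i)) :
    ∃ i, LinearMap.range (LinearMap.single F C i) = J := by
  by_contra! hne
  refine hJ.ne_bot ((Submodule.eq_bot_iff _).2 fun x hx => funext fun l => ?_)
  refine (single_mem_or_apply_eq_zero h hs hJ.toIsGradedIdeal l).resolve_left (fun h1 => ?_) x hx
  have hR := isMinimalGradedIdeal_range_single h hs l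
  rcases hJ.eq_bot_or_eq _ hR.toIsGradedIdeal (by rintro _ ⟨y, rfl⟩; exact h1 y) with h0 | h1
  · exact hR.ne_bot h0
  · exact hne l h1

theorem IsMinimalGradedIdeal.map_equivalence {A B : Type*} [NonUnitalNonAssocRing A] [Module F A]
    [NonUnitalNonAssocRing B] [Module F B] {G K : Type*} [CommGroup G] [CommGroup K]
    {𝒜 : G → Submodule F A} {ℬ : K → Submodule F B} {h𝒜 : IsGradedFamily 𝒜}
    {hℬ : IsGradedFamily ℬ} {e : A ≃ₗ[F] B} (he : IsEquivalence (support 𝒜) (support ℬ) e)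
    {S : Submodule F A} (hS : IsMinimalGradedIdeal h𝒜 S) :
    IsMinimalGradedIdeal hℬ (S.map (e : A →ₗ[F] B)) := by
  have he' := he.symm h𝒜.isGrading hℬ.isGrading
  refine ⟨?_, fun h0 => hS.ne_bot ?_, fun T hT hle => ?_⟩
  · rw [Submodule.map_equiv_eq_comap_symm]
    exact hS.toIsGradedIdeal.comap_equivalence he'
  · exact Submodule.map_injective_of_injective (f := (e : A →ₗ[F] B)) e.injective
      (h0.trans (Submodule.map_bot _).symm)
  · have hTmap : (T.comap (e : A →ₗ[F] B)).map (e : A →ₗ[F] B) = T :=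
      Submodule.map_comap_eq_of_surjective e.surjective T
    rcases hS.eq_bot_or_eq _ (hT.comap_equivalence (h𝒜 := h𝒜) he) (by
      rw [← Submodule.comap_map_eq_of_injective (f := (e : A →ₗ[F] B)) e.injective S]
      exact Submodule.comap_mono hle) with h0 | h1
    · left
      rw [← hTmap, h0, Submodule.map_bot]
    · right
      rw [← hTmap, h1]

theorem exists_factor_of_equivalence {m : ℕ} {D : Fin m → Type u}
    [∀ i, NonUnitalNonAssocRing (D i)] [∀ i, Module F (D i)] [∀ i, IsScalarTower F (D i) (D i)]
    [∀ i, SMulCommClass F (D i) (D i)] {Θ : ∀ i, Set (Submodule F (D i))}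
    (hΔ : ∀ i, IsGroupGrading (Δ i)) (hΘ : ∀ i, IsGroupGrading (Θ i))
    (hΔs : ∀ i, IsGradedSimple (Δ i)) (hΘs : ∀ i, IsGradedSimple (Θ i))
    {e : (∀ i, C i) ≃ₗ[F] ∀ i, D i}
    (he : IsEquivalence (freeProductGrading Δ) (freeProductGrading Θ) e) (i : Fin n) :
    ∃ j, LinearMap.range (LinearMap.single F D j) =
      (LinearMap.range (LinearMap.single F C i)).map (e : (∀ i, C i) →ₗ[F] ∀ i, D i) := by
  rw [freeProductGrading_eq hΔ, freeProductGrading_eq hΘ] at he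
  exact IsMinimalGradedIdeal.exists_eq_range_single (h := hΘ)
    ((isMinimalGradedIdeal_range_single hΔ hΔs i).map_equivalence he) hΘs

/-- An equivalence permutes minimal graded ideals, and these are exactly the factors. -/
theorem exists_equiv_of_freeProductGrading {m : ℕ} {D : Fin m → Type u}
    [∀ i, NonUnitalNonAssocRing (D i)] [∀ i, Module F (D i)] [∀ i, IsScalarTower F (D i) (D i)]
    [∀ i, SMulCommClass F (D i) (D i)] {Θ : ∀ i, Set (Submodule F (D i))}
    (hΔ : ∀ i, IsGroupGrading (Δ i)) (hΘ : ∀ i, IsGroupGrading (Θ i))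
    (hΔs : ∀ i, IsGradedSimple (Δ i)) (hΘs : ∀ i, IsGradedSimple (Θ i))
    (he : GradingEquivalent (freeProductGrading Δ) (freeProductGrading Θ)) :
    ∃ σ : Fin n ≃ Fin m, ∀ i, GradingEquivalent (Δ i) (Θ (σ i)) := by
  obtain ⟨e, he⟩ := he
  have hgr : ∀ {k : ℕ} {E : Fin k → Type u} [∀ i, NonUnitalNonAssocRing (E i)]
      [∀ i, Module F (E i)] {Λ : ∀ i, Set (Submodule F (E i))}, (∀ i, IsGroupGrading (Λ i)) →
      IsGrading (freeProductGrading Λ) := fun h => by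
    rw [freeProductGrading_eq h]
    exact (isGradedFamily_freeFamily h).isGrading
  have he' := he.symm (hgr hΔ) (hgr hΘ)
  choose σ hσ using exists_factor_of_equivalence hΔ hΘ hΔs hΘs he
  choose τ hτ using exists_factor_of_equivalence hΘ hΔ hΘs hΔs he'
  refine ⟨⟨σ, τ, fun i => ?_, fun j => ?_⟩, fun i =>
    gradingEquivalent_of_map_range_single hΔ hΘ he (hσ i)⟩
  · apply range_single_injective (F := F) fun i => (hΔs i).1
    beta_reduce
    rw [hτ, hσ, ← Submodule.map_comp, LinearEquiv.symm_comp, Submodule.map_id]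
  · apply range_single_injective (F := F) fun i => (hΘs i).1
    beta_reduce
    rw [hσ, hτ, ← Submodule.map_comp, LinearEquiv.comp_symm, Submodule.map_id]

end Uniqueness

/-! ### Partial products and graded ideals of refinements -/

section PartialProduct

variable {F : Type w} [Field F] {n : ℕ} {C : Fin n → Type u}
  [∀ i, NonUnitalNonAssocRing (C i)] [∀ i, Module F (C i)]
  {Δ : ∀ i, Set (Submodule F (C i))}

/-- The product of the factors with indices in `S`. -/
def partialProduct (F : Type w) [Field F] {n : ℕ} (C : Fin n → Type u)
    [∀ i, NonUnitalNonAssocRing (C i)] [∀ i, Module F (C i)] (S : Set (Fin n)) :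
    Submodule F (∀ i, C i) :=
  ⨅ l : {l // l ∉ S}, LinearMap.ker (LinearMap.proj l.1 : (∀ i, C i) →ₗ[F] C l.1)

theorem mem_partialProduct {S : Set (Fin n)} {x : ∀ i, C i} :
    x ∈ partialProduct F C S ↔ ∀ l, l ∉ S → x l = 0 := by
  simp [partialProduct, Submodule.mem_iInf]

theorem single_mem_partialProduct {S : Set (Fin n)} {l : Fin n} (hl : l ∈ S) (y : C l) :
    LinearMap.single F C l y ∈ partialProduct F C S := by
  rw [mem_partialProduct]
  intro k hk
  rw [LinearMap.single_apply, Pi.single_eq_of_ne]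
  rintro rfl
  exact hk hl

theorem partialProduct_inf (S T : Set (Fin n)) :
    partialProduct F C S ⊓ partialProduct F C T = partialProduct F C (S ∩ T) := by
  ext x
  simp only [Submodule.mem_inf, mem_partialProduct]
  constructor
  · rintro ⟨hS, hT⟩ l hl
    by_cases h : l ∈ S
    · exact hT l fun h' => hl ⟨h, h'⟩
    · exact hS l h
  · exact fun h => ⟨fun l hl => h l fun h' => hl h'.1, fun l hl => h l fun h' => hl h'.2⟩

theorem subset_of_partialProduct_le (h0 : ∀ i, ∃ x y : C i, x * y ≠ 0) {S T : Set (Fin n)}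
    (h : partialProduct F C S ≤ partialProduct F C T) : S ⊆ T := by
  intro l hl
  by_contra hT
  obtain ⟨x, y, hxy⟩ := h0 l
  have := mem_partialProduct.1 (h (single_mem_partialProduct (F := F) hl x)) l hT
  rw [LinearMap.single_apply, Pi.single_eq_same] at this
  rw [this, zero_mul] at hxy
  exact hxy rfl

theorem exists_add_partialProduct (S : Set (Fin n)) (x : ∀ i, C i) :
    ∃ y ∈ partialProduct F C S, ∃ z ∈ partialProduct F C Sᶜ, y + z = x := by
  classical
  refine ⟨fun l => if l ∈ S then x l else 0, ?_, fun l => if l ∈ S then 0 else x l, ?_, ?_⟩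
  · rw [mem_partialProduct]
    exact fun l hl => if_neg hl
  · rw [mem_partialProduct]
    exact fun l hl => if_pos (not_not.1 hl)
  · funext l
    rw [Pi.add_apply]
    split_ifs <;> simp

variable [∀ i, IsScalarTower F (C i) (C i)] [∀ i, SMulCommClass F (C i) (C i)]

theorem eq_partialProduct (h : ∀ i, IsGroupGrading (Δ i)) (hs : ∀ i, IsGradedSimple (Δ i))
    {J : Submodule F (∀ i, C i)} (hJ : IsGradedIdeal (isGradedFamily_freeFamily h) J) :
    J = partialProduct F C {l | ∀ y, LinearMap.single F C l y ∈ J} := by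
  apply le_antisymm
  · intro x hx
    rw [mem_partialProduct]
    exact fun l hl => (single_mem_or_apply_eq_zero h hs hJ l).resolve_left hl x hx
  · intro x hx
    rw [mem_partialProduct] at hx
    rw [← sum_single (F := F) x]
    refine sum_mem fun l _ => ?_
    by_cases hl : ∀ y, LinearMap.single F C l y ∈ J
    · exact hl _
    · rw [hx l hl, map_zero]
      exact zero_mem _

theorem annihilator_partialProduct (h : ∀ i, IsGroupGrading (Δ i))
    (hs : ∀ i, IsGradedSimple (Δ i)) (S : Set (Fin n)) :
    annihilator (partialProduct F C S) = partialProduct F C Sᶜ := by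
  ext x
  rw [mem_partialProduct, mem_annihilator]
  constructor
  · intro hx l hl
    have hsl := hs l
    rw [← (h l).support_eq] at hsl
    refine hsl.eq_zero_of_mul_eq_zero (h l).isGradedFamily fun y => ?_
    have h1 := hx _ (single_mem_partialProduct (not_not.1 hl) y)
    rw [(single_mul l y x).1, (single_mul l y x).2] at h1
    exact ⟨single_injective (F := F) l (h1.1.trans (map_zero _).symm),
      single_injective (F := F) l (h1.2.trans (map_zero _).symm)⟩
  · intro hx y hy
    rw [mem_partialProduct] at hy
    constructor
    · funext l
      by_cases hl : l ∈ S
      · rw [Pi.mul_apply, hx l (not_not.2 hl), zero_mul]; rfl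
      · rw [Pi.mul_apply, hy l hl, mul_zero]; rfl
    · funext l
      by_cases hl : l ∈ S
      · rw [Pi.mul_apply, hx l (not_not.2 hl), mul_zero]; rfl
      · rw [Pi.mul_apply, hy l hl, zero_mul]; rfl

/-- The complementary product is the annihilator, and annihilators of graded ideals are graded. -/
theorem IsGradedIdeal.partialProduct_compl {K : Type*} [CommGroup K]
    {ℬ : K → Submodule F (∀ i, C i)} {hℬ : IsGradedFamily ℬ} (h : ∀ i, IsGroupGrading (Δ i))
    (hs : ∀ i, IsGradedSimple (Δ i)) {S : Set (Fin n)}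
    (hS : IsGradedIdeal hℬ (partialProduct F C S)) :
    IsGradedIdeal hℬ (partialProduct F C Sᶜ) := by
  rw [← annihilator_partialProduct h hs]
  refine ⟨?_, fun x hx g => hℬ.proj_mem_annihilator hS.proj_mem hx g⟩
  rw [annihilator_partialProduct h hs]
  intro x y hy
  rw [mem_partialProduct] at hy
  simp only [mem_partialProduct]
  exact ⟨fun l hl => by rw [Pi.mul_apply, hy l hl, mul_zero],
    fun l hl => by rw [Pi.mul_apply, hy l hl, zero_mul]⟩

/-- The minimal graded ideals of a refinement of a free product group-grading. -/
theorem exists_minimal_partialProduct {K : Type*} [CommGroup K]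
    {ℬ : K → Submodule F (∀ i, C i)} (hℬ : IsGradedFamily ℬ) (h : ∀ i, IsGroupGrading (Δ i))
    (hs : ∀ i, IsGradedSimple (Δ i)) (hle : ∀ k, ∃ g, ℬ k ≤ freeFamily Δ g) (i : Fin n) :
    ∃ S : Set (Fin n), i ∈ S ∧ IsMinimalGradedIdeal hℬ (partialProduct F C S) := by
  have huniv : IsGradedIdeal hℬ (partialProduct F C Set.univ) := by
    have : partialProduct F C Set.univ = ⊤ := by
      rw [eq_top_iff]
      exact fun x _ => mem_partialProduct.2 fun l hl => absurd trivial hl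
    rw [this]
    exact ⟨isIdeal_top, fun _ _ _ => Submodule.mem_top⟩
  obtain ⟨S, hS⟩ := Set.Finite.exists_minimal
    (s := {S : Set (Fin n) | i ∈ S ∧ IsGradedIdeal hℬ (partialProduct F C S)}) (Set.toFinite _)
    ⟨Set.univ, trivial, huniv⟩
  refine ⟨S, hS.1.1, hS.1.2, fun h0 => ?_, fun T hT hTS => ?_⟩
  · have := subset_of_partialProduct_le (F := F) (S := S) (T := ∅) (fun i => (hs i).1)
      (h0.le.trans bot_le)
    exact this hS.1.1
  · have hT' := hT.of_refines (isGradedFamily_freeFamily h) hle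
    rw [eq_partialProduct h hs hT'] at hT hTS ⊢
    have hsub := subset_of_partialProduct_le (fun i => (hs i).1) hTS
    generalize {l | ∀ y, LinearMap.single F C l y ∈ T} = T at hT hTS hsub
    by_cases hi : i ∈ T
    · right
      rw [hsub.antisymm (hS.2 ⟨hi, hT⟩ hsub)]
    · left
      -- If `i` is outside `T`, then `S ∩ Tᶜ` still contains `i` and gives a graded ideal;
      -- minimality of `S` then makes `T` empty.
      have h1 := hS.1.2.inf (hT.partialProduct_compl h hs)
      rw [partialProduct_inf] at h1
      have h2 := hS.2 (y := S ∩ Tᶜ) ⟨⟨hS.1.1, hi⟩, h1⟩ Set.inter_subset_left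
      rw [Submodule.eq_bot_iff]
      intro x hx
      funext l
      by_cases hl : l ∈ T
      · exact absurd hl (h2 (hsub hl)).2
      · exact mem_partialProduct.1 hx l hl

end PartialProduct

/-! ### Fineness of free products -/

section FineFreeProduct

variable {F : Type w} [Field F] {n : ℕ} {C : Fin n → Type u}
  [∀ i, NonUnitalNonAssocRing (C i)] [∀ i, Module F (C i)]
  {Δ : ∀ i, Set (Submodule F (C i))} {K : Type*} [CommGroup K]
  {ℬ : K → Submodule F (∀ i, C i)} {S : Set (Fin n)}

/-- The projection of an ideal that contains the `m`-th factor onto this factor. -/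
def idealProjection (hS : IsIdeal (partialProduct F C S)) (m : Fin n) :
    hS.subalgebra →ₗ[F] C m :=
  LinearMap.proj m ∘ₗ hS.inclusion

theorem idealProjection_mul (hS : IsIdeal (partialProduct F C S)) (m : Fin n)
    (x y : hS.subalgebra) :
    idealProjection hS m (x * y) = idealProjection hS m x * idealProjection hS m y := rfl

theorem idealProjection_surjective (hS : IsIdeal (partialProduct F C S)) {m : Fin n}
    (hm : m ∈ S) : Function.Surjective (idealProjection hS m) :=
  fun y => ⟨⟨_, single_mem_partialProduct hm y⟩, Pi.single_eq_same m y⟩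

/-- In a degree other than `k`, the parts of `x l` and of the remaining coordinates of `x` are
opposite and lie in complementary graded ideals, so both vanish. -/
theorem single_mem_of_isGradedIdeal {l : Fin n} {hℬ : IsGradedFamily ℬ}
    (hS : IsGradedIdeal hℬ (partialProduct F C {l}))
    (hS' : IsGradedIdeal hℬ (partialProduct F C {l}ᶜ)) {k : K} {x : ∀ i, C i} (hx : x ∈ ℬ k) :
    LinearMap.single F C l (x l) ∈ ℬ k := by
  have hy : LinearMap.single F C l (x l) ∈ partialProduct F C {l} :=
    single_mem_partialProduct (Set.mem_singleton l) _
  have hz : x - LinearMap.single F C l (x l) ∈ partialProduct F C {l}ᶜ := by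
    rw [mem_partialProduct]
    intro m hm
    have hml : m = l := not_not.1 hm
    subst hml
    rw [Pi.sub_apply, LinearMap.single_apply, Pi.single_eq_same, sub_self]
  refine hℬ.toIsDecomp.mem_of_proj_mem fun m => ?_
  by_cases hm : m = k
  · rw [hm]
    exact hℬ.toIsDecomp.proj_mem k _
  · have h1 := hS.proj_mem _ hy m
    have h2 := hS'.proj_mem _ hz m
    rw [map_sub, hℬ.toIsDecomp.proj_of_mem_ne hx (Ne.symm hm), zero_sub, neg_mem_iff] at h2
    have h3 : hℬ.toIsDecomp.proj m (LinearMap.single F C l (x l)) = 0 := by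
      funext j
      by_cases hj : j ∈ ({l} : Set (Fin n))
      · exact mem_partialProduct.1 h2 j fun h' => h' hj
      · exact mem_partialProduct.1 h1 j hj
    rw [h3]
    exact zero_mem _

theorem isTrivialGrading_of_universalFamily_one {A : Type*} [NonUnitalNonAssocRing A] [Module F A]
    {Γ : Set (Submodule F A)} (h : IsGroupGrading Γ) (h0 : ∃ x y : A, x * y ≠ 0)
    (h1 : universalFamily Γ 1 = ⊤) : IsTrivialGrading Γ := by
  have hmem : (⊤ : Submodule F A) ∈ Γ := by
    rw [← h.support_eq, ← h1]
    refine mem_support fun hbot => ?_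
    rw [h1] at hbot
    obtain ⟨x, y, hxy⟩ := h0
    have hxb : x ∈ (⊥ : Submodule F A) := hbot ▸ Submodule.mem_top
    rw [(Submodule.mem_bot F).1 hxb, zero_mul] at hxy
    exact hxy rfl
  exact (h.universal.isGrading.eq_of_subset (Set.singleton_subset_iff.2 hmem) sSup_singleton).symm

theorem GradingEquivalent.of_isTrivialGrading {A B : Type*} [NonUnitalNonAssocRing A]
    [Module F A] [NonUnitalNonAssocRing B] [Module F B] {Γ : Set (Submodule F A)}
    {Γ' : Set (Submodule F B)} (hΓ : IsTrivialGrading Γ) (hΓ' : IsTrivialGrading Γ')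
    (e : A ≃ₗ[F] B) (he : ∀ x y, e (x * y) = e x * e y) : GradingEquivalent Γ Γ' := by
  refine ⟨e, he, fun U hU => ?_⟩
  rw [hΓ, Set.mem_singleton_iff] at hU
  rw [hΓ', hU, Submodule.map_top, LinearEquiv.range]
  rfl

theorem isGradedFamily_comap_partialProduct {hℬ : IsGradedFamily ℬ}
    (hS : IsGradedIdeal hℬ (partialProduct F C S)) :
    IsGradedFamily fun k => (ℬ k).comap hS.isIdeal.inclusion :=
  hℬ.comap hS.isIdeal.inclusion_mul hS.isIdeal.inclusion_injective fun g x => by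
    rw [hS.isIdeal.range_inclusion]
    exact hS.proj_mem _ x.2 g

variable [∀ i, IsScalarTower F (C i) (C i)] [∀ i, SMulCommClass F (C i) (C i)]

theorem isGradedSimpleFamily_comap_partialProduct {hℬ : IsGradedFamily ℬ}
    (h : ∀ i, IsGroupGrading (Δ i)) (hs : ∀ i, IsGradedSimple (Δ i))
    (hS : IsMinimalGradedIdeal hℬ (partialProduct F C S)) {l : Fin n} (hl : l ∈ S) :
    IsGradedSimpleFamily fun k => (ℬ k).comap hS.isIdeal.inclusion := by
  rw [← (isGradedFamily_comap_partialProduct hS.toIsGradedIdeal).isGradedSimple_support_iff]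
  have hrange := hS.isIdeal.range_inclusion
  refine IsMinimalGradedIdeal.isGradedSimple (h := hℬ) ?_ hS.isIdeal.inclusion_mul
    hS.isIdeal.inclusion_injective ?_ ?_
  · rwa [hrange]
  · rw [hrange, annihilator_partialProduct h hs, eq_top_iff]
    intro x _
    obtain ⟨y, hy, z, hz, rfl⟩ := exists_add_partialProduct (F := F) S x
    exact Submodule.add_mem_sup hy hz
  · obtain ⟨a, b, hab⟩ := (hs l).1
    obtain ⟨x, rfl⟩ := idealProjection_surjective hS.isIdeal hl a
    obtain ⟨y, rfl⟩ := idealProjection_surjective hS.isIdeal hl b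
    refine ⟨x, y, fun h0 => hab ?_⟩
    rw [← idealProjection_mul, h0, map_zero]

/-- A minimal graded ideal is graded-simple, so its projection to a factor is injective on
homogeneous elements. -/
theorem eq_zero_of_mem_partialProduct {hℬ : IsGradedFamily ℬ}
    (h : ∀ i, IsGroupGrading (Δ i)) (hs : ∀ i, IsGradedSimple (Δ i))
    (hS : IsMinimalGradedIdeal hℬ (partialProduct F C S)) {m : Fin n} (hm : m ∈ S) {k : K}
    {x : ∀ i, C i} (hx : x ∈ ℬ k) (hxS : x ∈ partialProduct F C S) (h0 : x m = 0) : x = 0 := by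
  have hp0 : idealProjection hS.isIdeal m ≠ 0 := by
    intro hp
    obtain ⟨a, b, hab⟩ := (hs m).1
    obtain ⟨y, hy⟩ := idealProjection_surjective hS.isIdeal hm (a * b)
    exact hab (hy.symm.trans (by rw [hp]; rfl))
  have := (isGradedSimpleFamily_comap_partialProduct h hs hS hm).eq_zero_of_map_eq_zero
    (isGradedFamily_comap_partialProduct hS.toIsGradedIdeal) (idealProjection_mul hS.isIdeal m)
    hp0 (g := k) (x := ⟨x, hxS⟩) hx h0
  exact congrArg Subtype.val this

/-- A nonzero homogeneous element of the minimal ideal has nonzero coordinates at all indices of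
`S`. With two such indices it must have degree one in the free product. The elements of the `m`-th
factor are sums of such elements. -/
theorem isTrivialGrading_of_mem {hℬ : IsGradedFamily ℬ}
    (h : ∀ i, IsGroupGrading (Δ i)) (hs : ∀ i, IsGradedSimple (Δ i))
    (hle : ∀ k, ∃ g, ℬ k ≤ freeFamily Δ g)
    (hS : IsMinimalGradedIdeal hℬ (partialProduct F C S)) {i j : Fin n} (hi : i ∈ S)
    (hj : j ∈ S) (hij : i ≠ j) {m : Fin n} (hm : m ∈ S) : IsTrivialGrading (Δ m) := by
  refine isTrivialGrading_of_universalFamily_one (h m) (hs m).1 (eq_top_iff.2 fun y _ => ?_)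
  have h1 : LinearMap.single F C m y ∈ freeFamily Δ 1 := by
    refine hℬ.toIsDecomp.mem_of_proj_mem fun k => ?_
    have hxS := hS.proj_mem _ (single_mem_partialProduct hm y) k
    have hx := hℬ.toIsDecomp.proj_mem k (LinearMap.single F C m y)
    generalize hℬ.toIsDecomp.proj k (LinearMap.single F C m y) = x at hx hxS
    by_cases hx0 : x = 0
    · rw [hx0]
      exact zero_mem _
    · obtain ⟨g, hg⟩ := hle k
      have hne : ∀ {r}, r ∈ S → x r ≠ 0 := fun hr h0 =>
        hx0 (eq_zero_of_mem_partialProduct h hs hS hr hx hxS h0)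
      rw [← eq_one_of_ne_zero (hg hx) hij (hne hi) (hne hj)]
      exact hg hx
  have h2 := (h1 m).1
  rwa [LinearMap.single_apply, Pi.single_eq_same] at h2

variable [IsAlgClosed F]

/-- Otherwise the minimal graded ideal containing the `l`-th factor involves several factors, all
trivially graded and hence central simple. It is a loop over `C l`, and its projections to the other
factors make them isomorphic to `C l`. Outside characteristic two this contradicts the multiplicity
condition. -/
theorem single_mem_of_refines [∀ i, FiniteDimensional F (C i)] (hℬ : IsGradedFamily ℬ)
    (h : ∀ i, IsGroupGrading (Δ i)) (hs : ∀ i, IsGradedSimple (Δ i))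
    (hmult : MultiplicityCondition Δ) (hle : ∀ k, ∃ g, ℬ k ≤ freeFamily Δ g) (l : Fin n) {k : K}
    {x : ∀ i, C i} (hx : x ∈ ℬ k) : LinearMap.single F C l (x l) ∈ ℬ k := by
  obtain ⟨S, hl, hS⟩ := exists_minimal_partialProduct hℬ h hs hle l
  by_cases hSl : S = {l}
  · subst hSl
    exact single_mem_of_isGradedIdeal hS.toIsGradedIdeal
      (hS.toIsGradedIdeal.partialProduct_compl h hs) hx
  exfalso
  obtain ⟨j, hj, hjl⟩ : ∃ j ∈ S, j ≠ l := by
    by_contra! hall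
    exact hSl (Set.eq_singleton_iff_unique_mem.2 ⟨hl, hall⟩)
  have htriv : ∀ {m}, m ∈ S → IsTrivialGrading (Δ m) :=
    fun hm => isTrivialGrading_of_mem h hs hle hS hl hj hjl.symm hm
  have hsimple : ∀ {m}, m ∈ S → IsCentralSimpleAlgebra F (C m) :=
    fun hm => ((hs _).isSimpleAlgebra (htriv hm)).isCentral
  have hloop := isLoop_quotientFamily (isGradedFamily_comap_partialProduct hS.toIsGradedIdeal)
    (isGradedSimpleFamily_comap_partialProduct h hs hS hl) (idealProjection_mul hS.isIdeal l)
    (idealProjection_surjective hS.isIdeal hl) (hsimple hl)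
  have hequiv : ∀ {m}, m ∈ S → GradingEquivalent (Δ l) (Δ m) := fun {m} hm => by
    obtain ⟨-, φ, hφ, -⟩ := hloop.exists_equiv_of_surjective (hsimple hl).1 (hsimple hm)
      (idealProjection_mul hS.isIdeal m) (idealProjection_surjective hS.isIdeal hm)
    exact .of_isTrivialGrading (htriv hl) (htriv hm) φ hφ
  rcases hmult with ⟨h2, hmult⟩ | ⟨-, hmult⟩
  · have htwo : (2 : F) = 0 := by
      have := (ringChar.spec F 2).2 (by rw [h2])
      exact_mod_cast this
    -- In characteristic two there are just two factors, so the projections to `l` and `j` separate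
    -- points. Injectivity of the projection to `l` then contradicts its vanishing on the `j`-th
    -- factor.
    have hinj := hloop.injective_of_two_eq_zero (hsimple hl).1 (hsimple hj)
      (idealProjection_mul hS.isIdeal j) (idealProjection_surjective hS.isIdeal hj)
      (fun y hyl hyj => ?_) htwo
    · obtain ⟨a, b, hab⟩ := (hs j).1
      have h0 := hinj (a₁ := ⟨_, single_mem_partialProduct hj a⟩) (a₂ := 0)
        ((Pi.single_eq_of_ne hjl.symm a).trans (map_zero _).symm)
      have h1 : a = 0 := by
        have := congrArg (idealProjection hS.isIdeal j) h0
        rw [map_zero] at this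
        exact (Pi.single_eq_same j a).symm.trans this
      rw [h1, zero_mul] at hab
      exact hab rfl
    · refine Subtype.ext (funext fun m => ?_)
      by_cases hm : m ∈ S
      · by_cases hml : m = l
        · rw [hml]
          exact hyl
        · rw [hmult l (htriv hl) m j hml hjl (hequiv hm) (hequiv hj)]
          exact hyj
      · exact mem_partialProduct.1 y.2 m hm
  · exact hmult l (htriv hl) j hjl (hequiv hj)

theorem isFineGroupGrading_freeProductGrading (hΔ : IsFineFamily Δ) :
    IsFineGroupGrading (freeProductGrading Δ) := by
  have := hΔ.finiteDimensional
  have h : ∀ i, IsGroupGrading (Δ i) := fun i => (hΔ.isFine i).1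
  have hfree := isGradedFamily_freeFamily h
  have hgr : IsGroupGrading (freeProductGrading Δ) := by
    rw [freeProductGrading_eq h]
    exact hfree.isGroupGrading
  refine isFineGroupGrading_of_forall_eq hgr fun Γ' hΓ' hle => ?_
  have hℬ := hΓ'.isGradedFamily
  have hle' : ∀ k, ∃ g, universalFamily Γ' k ≤ freeFamily Δ g := by
    intro k
    by_cases hk : universalFamily Γ' k = ⊥
    · exact ⟨1, hk ▸ bot_le⟩
    · obtain ⟨T, hT, hkT⟩ := hle _ (hΓ'.support_eq ▸ mem_support hk)
      rw [freeProductGrading_eq h] at hT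
      obtain ⟨-, g, rfl⟩ := hT
      exact ⟨g, hkT⟩
  have hsingle : ∀ i k, ∀ x ∈ universalFamily Γ' k,
      LinearMap.single F C i (x i) ∈ universalFamily Γ' k := fun i _ _ hx =>
    single_mem_of_refines hℬ h hΔ.isGradedSimple hΔ.multiplicity hle' i hx
  -- The refinement restricts to a refinement of each `Δ i`, equal to it by fineness.
  have heq : ∀ i, Δ i =
      support fun k => (universalFamily Γ' k).comap (LinearMap.single F C i) := fun i => by
    refine ((hΔ.isFine i).eq_of_refines (hℬ.comap_single (hsingle i)).isGroupGrading ?_).symm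
    rintro U ⟨hU, k, rfl⟩
    have hk : universalFamily Γ' k ≠ ⊥ := by
      intro h0
      refine hU ((Submodule.eq_bot_iff _).2 fun y hy => single_injective (F := F) i ?_)
      rw [map_zero, ← Submodule.mem_bot F, ← h0]
      exact hy
    obtain ⟨T, hT, hkT⟩ := hle _ (hΓ'.support_eq ▸ mem_support hk)
    have hsub := Submodule.comap_mono (f := LinearMap.single F C i) hkT
    refine ⟨_, (mem_iff_of_freeProductGrading h i).2 ⟨fun h0 => hU ?_, T, hT, rfl⟩, hsub⟩
    rw [h0] at hsub
    exact le_bot_iff.1 hsub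
  -- Since the free product is the finest group-grading coarser than the product grading, it refines
  -- `Γ'`; two gradings that refine each other coincide.
  obtain ⟨f, hf⟩ := exists_freeFamily_le_of_single hℬ heq
  refine (hΓ'.universal.isGrading.eq_of_subset (fun T hT => ?_)
    hgr.universal.isGrading.sSup_eq_top).symm
  have hT' := hT
  rw [freeProductGrading_eq h] at hT'
  obtain ⟨hT0, g, rfl⟩ := hT'
  have hfg : universalFamily Γ' (f g) ≠ ⊥ := fun h0 => hT0 (le_bot_iff.1 (h0 ▸ hf g))
  have hmem : universalFamily Γ' (f g) ∈ Γ' := by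
    have := mem_support hfg
    rwa [hΓ'.support_eq] at this
  obtain ⟨T', hT', hle''⟩ := hle _ hmem
  have h1 := hgr.universal.isGrading.eq_of_le hT hT' ((hf g).trans hle'')
  rw [le_antisymm (hf g) (h1 ▸ hle'')]
  exact hmem

end FineFreeProduct

end GradedAlg

/-! ### The theorem -/

theorem corollary5 (F : Type w) [Field F] [IsAlgClosed F] :
    -- (1) existence of the decomposition
    (∀ (B : Type u) [NonUnitalNonAssocRing B] [Module F B] [IsScalarTower F B B]
        [SMulCommClass F B B] (Γ : Set (Submodule F B)),
      FiniteDimensional F B → IsSemisimpleAlgebra F B → IsFineGroupGrading Γ →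
      ∃ (n : ℕ) (C : Fin n → Type u) (_ : ∀ i, NonUnitalNonAssocRing (C i))
        (_ : ∀ i, Module F (C i)) (_ : ∀ i, IsScalarTower F (C i) (C i))
        (_ : ∀ i, SMulCommClass F (C i) (C i)) (Δ : ∀ i, Set (Submodule F (C i))),
        IsFineFamily Δ ∧ GradingEquivalent Γ (freeProductGrading Δ)) ∧
    -- (1) converse
    (∀ (n : ℕ) (C : Fin n → Type u) [∀ i, NonUnitalNonAssocRing (C i)]
        [∀ i, Module F (C i)] [∀ i, IsScalarTower F (C i) (C i)]
        [∀ i, SMulCommClass F (C i) (C i)] (Δ : ∀ i, Set (Submodule F (C i))),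
      IsFineFamily Δ → IsFineGroupGrading (freeProductGrading Δ)) ∧
    -- (1) uniqueness of the factors
    (∀ (n m : ℕ) (C : Fin n → Type u) (D : Fin m → Type u)
        [∀ i, NonUnitalNonAssocRing (C i)] [∀ i, Module F (C i)]
        [∀ i, IsScalarTower F (C i) (C i)] [∀ i, SMulCommClass F (C i) (C i)]
        [∀ i, NonUnitalNonAssocRing (D i)] [∀ i, Module F (D i)]
        [∀ i, IsScalarTower F (D i) (D i)] [∀ i, SMulCommClass F (D i) (D i)]
        (Δ : ∀ i, Set (Submodule F (C i))) (Θ : ∀ i, Set (Submodule F (D i))),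
      IsFineFamily Δ → IsFineFamily Θ →
      GradingEquivalent (freeProductGrading Δ) (freeProductGrading Θ) →
      ∃ σ : Fin n ≃ Fin m, ∀ i, GradingEquivalent (Δ i) (Θ (σ i))) ∧
    -- (2) fine graded-simple algebras are loop algebras
    (∀ (B : Type u) [NonUnitalNonAssocRing B] [Module F B] [IsScalarTower F B B]
        [SMulCommClass F B B] (Γ' : Set (Submodule F B)),
      FiniteDimensional F B → IsGradedSimple Γ' → IsFineGroupGrading Γ' →
      ∃ (A : Type u) (_ : NonUnitalNonAssocRing A) (_ : Module F A) (_ : IsScalarTower F A A)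
        (_ : SMulCommClass F A A) (U U' : Type u) (_ : CommGroup U) (_ : CommGroup U')
        (Γ : Set (Submodule F A)) (δ : Γ → U') (hδ : IsGradingBy Γ δ) (π : U →* U'),
        FiniteDimensional F A ∧ IsSimpleAlgebra F A ∧ IsFineGroupGrading Γ ∧
        IsUniversalGroup Γ δ ∧ Function.Surjective π ∧ Finite π.ker ∧
        GradingEquivalent Γ' (loopGrading hδ π)) ∧
    -- (2) converse
    (∀ (A : Type u) [NonUnitalNonAssocRing A] [Module F A] [IsScalarTower F A A]
        [SMulCommClass F A A] (U U' : Type v) [CommGroup U] [CommGroup U']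
        (Γ : Set (Submodule F A)) (δ : Γ → U') (hδ : IsGradingBy Γ δ) (π : U →* U'),
      FiniteDimensional F A → IsSimpleAlgebra F A → IsFineGroupGrading Γ →
      IsUniversalGroup Γ δ → Function.Surjective π → Finite π.ker →
      IsFineGroupGrading (loopGrading hδ π)) ∧
    -- (2) semisimplicity
    (∀ (B : Type x) [NonUnitalNonAssocRing B] [Module F B] [IsScalarTower F B B]
        [SMulCommClass F B B] (Γ' : Set (Submodule F B))
        (A : Type u) [NonUnitalNonAssocRing A] [Module F A] [IsScalarTower F A A]
        [SMulCommClass F A A] (U U' : Type v) [CommGroup U] [CommGroup U']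
        (Γ : Set (Submodule F A)) (δ : Γ → U') (hδ : IsGradingBy Γ δ) (π : U →* U'),
      IsGrading Γ' → FiniteDimensional F A → IsSimpleAlgebra F A → IsFineGroupGrading Γ →
      IsUniversalGroup Γ δ → Function.Surjective π → Finite π.ker →
      GradingEquivalent Γ' (loopGrading hδ π) →
      (IsSemisimpleAlgebra F B ↔ ¬ ringChar F ∣ Nat.card π.ker)) ∧
    -- (3) equivalence of loop algebras
    (∀ (A₁ A₂ : Type u) [NonUnitalNonAssocRing A₁] [Module F A₁] [IsScalarTower F A₁ A₁]
        [SMulCommClass F A₁ A₁] [NonUnitalNonAssocRing A₂] [Module F A₂]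
        [IsScalarTower F A₂ A₂] [SMulCommClass F A₂ A₂]
        (U₁ U₁' U₂ U₂' : Type v) [CommGroup U₁] [CommGroup U₁'] [CommGroup U₂] [CommGroup U₂']
        (Γ₁ : Set (Submodule F A₁)) (Γ₂ : Set (Submodule F A₂))
        (δ₁ : Γ₁ → U₁') (δ₂ : Γ₂ → U₂')
        (hδ₁ : IsGradingBy Γ₁ δ₁) (hδ₂ : IsGradingBy Γ₂ δ₂)
        (π₁ : U₁ →* U₁') (π₂ : U₂ →* U₂'),
      IsCentralSimpleAlgebra F A₁ → IsCentralSimpleAlgebra F A₂ →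
      IsFineGroupGrading Γ₁ → IsFineGroupGrading Γ₂ →
      IsUniversalGroup Γ₁ δ₁ → IsUniversalGroup Γ₂ δ₂ →
      Function.Surjective π₁ → Function.Surjective π₂ →
      (GradingEquivalent (loopGrading hδ₁ π₁) (loopGrading hδ₂ π₂) ↔
        ∃ (φ : A₁ ≃ₗ[F] A₂) (hφ : IsEquivalence Γ₁ Γ₂ φ) (α : U₁' ≃* U₂') (β : U₁ ≃* U₂),
          (∀ V : Γ₁, α (δ₁ V) =
            δ₂ ⟨V.1.map (φ : A₁ →ₗ[F] A₂), hφ.map_mem V.1 V.2⟩) ∧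
          ∀ g : U₁, π₂ (β g) = α (π₁ g))) := by
  refine ⟨fun B _ _ _ _ Γ _ hB hfine => exists_freeProduct_decomposition hB hfine,
    fun n C _ _ _ _ Δ hΔ => isFineGroupGrading_freeProductGrading hΔ,
    fun n m C D _ _ _ _ _ _ _ _ Δ Θ hΔ hΘ he => exists_equiv_of_freeProductGrading
      (fun i => (hΔ.isFine i).1) (fun i => (hΘ.isFine i).1) hΔ.isGradedSimple
      hΘ.isGradedSimple he,
    fun B _ _ _ _ Γ' _ hs hfine => exists_loop_realization hs hfine, ?_, ?_, ?_⟩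
  · intro A _ _ _ _ U U' _ _ Γ δ hδ π _ hA hfine _ hπ _
    rw [← support_loopFamily]
    exact (isLoop_loopFamily hδ π hπ).isFine hA.isCentral (hδ.support_component.symm ▸ hfine)
  · intro B _ _ _ _ Γ' A _ _ _ _ U U' _ _ Γ δ hδ π hΓ' _ hA _ _ hπ _ he
    obtain ⟨φ, hφ⟩ := he
    have hloop := isLoop_loopFamily hδ π hπ
    have hφ' := hφ.symm hΓ' hloop.source.isGrading
    rw [← hloop.isSemisimpleAlgebra_iff hA]
    exact ⟨fun h => h.of_equiv φ.symm hφ'.map_mul, fun h => h.of_equiv φ hφ.map_mul⟩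
  · intro A₁ A₂ _ _ _ _ _ _ _ _ U₁ U₁' U₂ U₂' _ _ _ _ Γ₁ Γ₂ δ₁ δ₂ hδ₁ hδ₂ π₁ π₂ hA₁ hA₂ _ _
      hu₁ hu₂ hπ₁ hπ₂
    have h₁ := isLoop_loopFamily hδ₁ π₁ hπ₁
    have h₂ := isLoop_loopFamily hδ₂ π₂ hπ₂
    exact ⟨h₁.exists_of_gradingEquivalent hδ₁ hδ₂ h₂ hA₁ hA₂ hu₁ hu₂,
      fun ⟨φ, hφ, α, β, hα, hβ⟩ => h₁.gradingEquivalent hδ₁ hδ₂ h₂ hφ α β hα hβ⟩
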